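/- Environments. An environment is a family $a=(a_t(e))_{t\in\mathbb R,\,e\in E(\mathbb Z)}$ of numbers in $[0,\infty)$, where $E(\mathbb Z)$ is the set of unordered nearest-neighbour edges of $\mathbb Z$; write $b_t(x):=a_t(x,x+1)$. For $t\in\mathbb R$, $x\in\mathbb Z$ let $\tau_{t,x}$ be the space-time shift $(\tau_{t,x}a)_s(y,y+1)=a_{t+s}(y+x,y+x+1)$. Let $\Omega\subseteq[0,\infty)^{\mathbb R\times E(\mathbb Z)}$ be a set of environments with $\tau_{t,x}\Omega\subseteq\Omega$ for all $t,x$, such that $t\mapsto a_t(e)$ is Borel measurable and locally Lebesgue integrable for each $a\in\Omega$ and each edge $e$. Let $\mathcal F$ be a $\sigma$-algebra on $\Omega$ for which all coordinate maps $a\mapsto a_t(e)$ are measurable and $(t,a)\mapsto\tau_{t,x}a$ is jointly measurable for each $x$ (for $\mathcal F$ the trace of the product $\sigma$-algebra, the latter says that $(t,a)\mapsto a_t(e)$ is jointly measurable for each $e$). Let $\mathbb P$ be a probability measure on $(\Omega,\mathcal F)$, with expectation $\mathbb E$, that is invariant and ergodic with respect to $\{\tau_{t,x}\colon t\in\mathbb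 R,\,x\in\mathbb Z\}$. The dual walk. For $a\in\Omega$, $t\le s$ and $x,y\in\mathbb Z$ let $K(s,x;t,y):=\lim_{n\to\infty}K_n(s,x;t,y)$, where $K_0:=0$ and $$K_{n+1}(s,x;t,y):=e^{-\int_t^s2b_u(x)\,du}\,\delta_{x,y}+\int_t^s e^{-\int_r^s2b_u(x)\,du}\,b_r(x)\sum_{z=\pm1}K_n(r,x+z;t,y)\,dr .$$ These are the transition probabilities of the continuous-time Markov chain on $\mathbb Z$, run in negative time, with generator $\mathcal L_tf(x)=b_t(x)[f(x+1)+f(x-1)-2f(x)]$. Let $Y$ be the walk started from $0$ at time $0$, so that $P_a(Y_t=y)=K(0,0;-t,y)$ for $t\ge0$; the environment seen from $Y$ is the Markov chain $t\mapsto\tau_{-t,Y_t}a$. A law $Q$ on $(\Omega,\mathcal F)$ is stationary for it if $\int P_a(\tau_{-t,Y_t}a\in A)\,Q(da)=Q(A)$ for all $t\ge0$, $A\in\mathcal F$, and ergodic for it if $Q(A)\in\{0,1\}$ for every $A\in\mathcal F$ such that, for each $t\ge0$, $P_a(\tau_{-t,Y_t}a\in A)=1_A(a)$ for $Q$-a.e.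 $a$. Let $\mathcal L_t^+$ be the adjoint operator $$\mathcal L_t^+f(x):=b_t(x+1)f(x+1)+b_t(x-1)f(x-1)-2b_t(x)f(x).$$ Theorem. Suppose that $a_t(e)\in[0,1]$ for all $a\in\Omega$, $t\in\mathbb R$ and $e\in E(\mathbb Z)$, and that $T:=\inf\{t\ge0\colon\int_0^ta_s(0,1)\,ds\ge1\}$ (with $\inf\emptyset=\infty$) satisfies $\mathbb E(T^{3+\varepsilon})<\infty$ for some $\varepsilon>0$. Then there exists an $\mathcal F$-measurable $\varphi\colon\Omega\to\mathbb R$ with $\varphi\in L^1(\mathbb P)$ such that (1) $\mathbb P(\varphi>0)=1$ and $\mathbb E\varphi=1$; (2) $\mathbb E(b_0(0)\varphi^2)\le\mathbb E\,b_0(0)$ (in particular, the left-hand side is finite); (3) for every $a\in\Omega$ and $x\in\mathbb Z$, the map $t\mapsto\varphi(\tau_{t,x}a)$ is continuous and weakly differentiable on $\mathbb R$, and in the weak sense $$\frac{\partial}{\partial t}\,\varphi\circ\tau_{t,x}+\mathcal L_t^+\,\varphi\circ\tau_{t,x}=0,$$ with $\mathcal L_t^+$ acting on the variable $x$; and the measure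 $\mathbb Q(A):=\mathbb E(\varphi1_A)$, $A\in\mathcal F$, is a probability measure on $(\Omega,\mathcal F)$ that is stationary and ergodic for the chain $t\mapsto\tau_{-t,Y_t}a$. -/

import Mathlib

open MeasureTheory
open scoped ENNReal NNReal

noncomputable section

namespace DynCond

/-- An environment of time-dependent nearest-neighbour conductances on `ℤ`, i.e. a point of
`[0,∞)^(ℝ × E(ℤ))`. The unordered edge `{x, x+1}` is labelled by its left endpoint `x`, so
`a.cond t x` is `a_t(x,x+1) = b_t(x)`. (A structure rather than a bare function type, so that it
carries no default σ-algebra.) -/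
@[ext]
structure Env where
  cond : ℝ → ℤ → ℝ≥0

/-- The canonical space-time shift `(τ_{t,x} a)_s(y,y+1) = a_{t+s}(y+x,y+x+1)`. -/
def Env.shift (t : ℝ) (x : ℤ) (a : Env) : Env := ⟨fun s y => a.cond (t + s) (y + x)⟩

/-- The set of environments `Ω` is stable under all space-time shifts. -/
def ShiftStable (Ω : Set Env) : Prop := ∀ (t : ℝ) (x : ℤ), ∀ a ∈ Ω, a.shift t x ∈ Ω

/-- The shift `τ_{t,x}` as a self-map of a shift-stable set of environments. -/
def tau {Ω : Set Env} (hΩ : ShiftStable Ω) (t : ℝ) (x : ℤ) (a : Ω) : Ω :=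
  ⟨(a : Env).shift t x, hΩ t x a a.2⟩

/-- The standing assumption on the law `P` of the environment, carried by a shift-stable set `Ω` of
environments with a σ-algebra that contains the trace of the product σ-algebra. -/
structure IsErgodicEnvironment {Ω : Set Env} (hΩ : ShiftStable Ω) [MeasurableSpace Ω]
    (P : Measure Ω) : Prop where
  /-- `t ↦ a_t(e)` is Borel measurable -/
  path_measurable : ∀ (a : Ω) (x : ℤ), Measurable fun t : ℝ => (a : Env).cond t x
  /-- `t ↦ a_t(e)` is locally Lebesgue integrable -/
  path_locallyIntegrable : ∀ (a : Ω) (x : ℤ),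
    LocallyIntegrable (fun t : ℝ => ((a : Env).cond t x : ℝ)) volume
  /-- the coordinate maps `a ↦ a_t(e)` are measurable -/
  cond_measurable : ∀ (t : ℝ) (x : ℤ), Measurable fun a : Ω => (a : Env).cond t x
  /-- `(t, a) ↦ τ_{t,x} a` is jointly measurable; when the σ-algebra is the trace of the product
  σ-algebra this says precisely that `(t, a) ↦ a_t(e)` is jointly measurable for every `e` -/
  shift_measurable : ∀ x : ℤ, Measurable fun p : ℝ × Ω => tau hΩ p.1 x p.2
  /-- `P` is invariant under the space-time shifts -/
  stationary : ∀ (t : ℝ) (x : ℤ), P.map (tau hΩ t x) = P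
  /-- `P` is ergodic with respect to the space-time shifts -/
  ergodic : ∀ A : Set Ω, MeasurableSet A → (∀ (t : ℝ) (x : ℤ), tau hΩ t x ⁻¹' A = A) →
    P A = 0 ∨ P A = 1

/-- `T = inf {t ≥ 0 : ∫₀ᵗ a_s(0,1) ds ≥ 1}`, with `inf ∅ = ∞`. -/
def accumTime (a : Env) : ℝ≥0∞ :=
  ⨅ (t : ℝ) (_ : 0 ≤ t ∧ 1 ≤ ∫ s in (0 : ℝ)..t, (a.cond s 0 : ℝ)), ENNReal.ofReal t

/-- The operator `L_t^+ f(x) = b_t(x+1) f(x+1) + b_t(x-1) f(x-1) - 2 b_t(x) f(x)`. -/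
def Env.adjGen (a : Env) (t : ℝ) (f : ℤ → ℝ) (x : ℤ) : ℝ :=
  (a.cond t (x + 1) : ℝ) * f (x + 1) + (a.cond t (x - 1) : ℝ) * f (x - 1)
    - 2 * (a.cond t x : ℝ) * f x

/-- `g` is the weak derivative of `f` on `ℝ`. -/
def HasWeakDeriv (f g : ℝ → ℝ) : Prop :=
  LocallyIntegrable f volume ∧ LocallyIntegrable g volume ∧
    ∀ η : ℝ → ℝ, ContDiff ℝ (⊤ : ℕ∞) η → HasCompactSupport η →
      ∫ t, deriv η t * f t = - ∫ t, η t * g t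

/-- The probability that the dual walk in the environment `a`, at `x` at time `s` and run backwards
in time, is at `y` at time `t ≤ s` after fewer than `n` jumps:
`K₀ = 0` and `K_{n+1}(s,x;t,y) = exp(-∫_t^s 2b_u(x) du) δ_{x,y}
  + ∫_t^s exp(-∫_r^s 2b_u(x) du) b_r(x) (K_n(r,x+1;t,y) + K_n(r,x-1;t,y)) dr`. -/
def dualKernelIter (a : Env) : ℕ → ℝ → ℤ → ℝ → ℤ → ℝ≥0∞
  | 0, _, _, _, _ => 0
  | n + 1, s, x, t, y =>
      ENNReal.ofReal (Real.exp (-∫ u in t..s, 2 * (a.cond u x : ℝ))) * (if x = y then 1 else 0)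
      + ∫⁻ r in Set.Ioc t s,
          ENNReal.ofReal (Real.exp (-∫ u in r..s, 2 * (a.cond u x : ℝ))) * (a.cond r x : ℝ≥0∞)
            * (dualKernelIter a n r (x + 1) t y + dualKernelIter a n r (x - 1) t y)

/-- Transition probabilities `K(s,x;t,y) = lim_n K_n(s,x;t,y)`, `t ≤ s`, of the dual walk: the
continuous-time Markov chain on `ℤ` run in negative time whose generator at time `t` is
`L_t f(x) = b_t(x) (f(x+1) + f(x-1) - 2 f(x))`. For the walk `Y` started at `0` at time `0` in the
environment `a`, the probability of `Y_t = y` is `K(0,0;-t,y)`. -/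
def dualKernel (a : Env) (s : ℝ) (x : ℤ) (t : ℝ) (y : ℤ) : ℝ≥0∞ :=
  ⨆ n : ℕ, dualKernelIter a n s x t y

/-- Transition kernel of the environment seen from the dual walk: the law of `τ_{-t,Y_t} a`. -/
def envKernel {Ω : Set Env} (hΩ : ShiftStable Ω) [MeasurableSpace Ω] (t : ℝ) (a : Ω) : Measure Ω :=
  Measure.sum fun y : ℤ => dualKernel (a : Env) 0 0 (-t) y • Measure.dirac (tau hΩ (-t) y a)

/-- `Q` is a stationary law of the Markov chain `t ↦ τ_{-t,Y_t} a`. -/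
def IsStationaryForDual {Ω : Set Env} (hΩ : ShiftStable Ω) [MeasurableSpace Ω]
    (Q : Measure Ω) : Prop :=
  ∀ t : ℝ, 0 ≤ t → ∀ A : Set Ω, MeasurableSet A → ∫⁻ a, envKernel hΩ t a A ∂Q = Q A

/-- `Q` is ergodic for the Markov chain `t ↦ τ_{-t,Y_t} a`: a measurable set `A` that is invariant
for the chain (for each `t ≥ 0` and `Q`-a.e. `a`, the law of `τ_{-t,Y_t} a` gives `A` mass `1` if
`a ∈ A` and `0` otherwise) has measure `0` or `1`. -/
def IsErgodicForDual {Ω : Set Env} (hΩ : ShiftStable Ω) [MeasurableSpace Ω]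
    (Q : Measure Ω) : Prop :=
  ∀ A : Set Ω, MeasurableSet A →
    (∀ t : ℝ, 0 ≤ t → ∀ᵐ a ∂Q, envKernel hΩ t a A = A.indicator 1 a) →
    Q A = 0 ∨ Q A = 1

/-- The measure `Q(A) = E(φ 1_A)`. -/
def densityLaw {Ω : Set Env} [MeasurableSpace Ω] (P : Measure Ω) (φ : Ω → ℝ) : Measure Ω :=
  P.withDensity fun a => ENNReal.ofReal (φ a)

end DynCond

end

/-!
Write `A f = 2 (1 - b) f + (b f) ∘ θ_{0,1} + (b f) ∘ θ_{0,-1}` with `b = b_0(0)`, and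
`R_μ = ∫_0^∞ e^{-μ t} (· ∘ θ_{t,0}) dt`. As `A - 2` is the adjoint generator, the equation for `φ` is
the fixed point equation `φ = R₂ A φ` for a positive operator that preserves the mean.

*Approximation.* For `l > 0`, the contraction `χ ↦ R_{2+l} (2 χ + L χ + V)`, with `L` the generator
of the symmetric walk among the conductances and `V` its drift, has a bounded fixed point, the
massive corrector `χ`. Its gradient `φ = 1 + χ ∘ θ_{0,1} - χ` is a nonnegative function of mean `1`
with `φ = l / (2 + l) + R_{2+l} A φ`, and stationarity yields the energy identity
`E[b φ (φ - 1)] = - l E[χ²]` (`IsFlow.exists_approxDensity`). It follows that `E[b φ²] ≤ E[b]`, but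
`b` may vanish, and this alone does not prevent the mass of `φ` from escaping as `l → 0`.

*Compactness.* Let `σ` be the time that the past rate at the origin needs to accumulate a unit of
mass. Since `φ' ≤ (l + 2 b) φ` along orbits, `φ` is controlled by its average over `[-σ, 0]` with
respect to `b`; hence `E[(1 + σ)⁻³ φ²]` is bounded uniformly in `l`
(`IsFlow.integral_weight_mul_sq_le`). As `E[(1 + σ)³] < ∞` by assumption, the mean is a continuous
functional on the `L²` space with weight `(1 + σ)⁻³`. The constraints `f ≥ 0`, `E f = 1`,
`E[b f²] ≤ E[b]` and `R_{2+l} A f ≤ f` are convex and tighten as `l` decreases, so elements of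
almost minimal norm converge strongly (`exists_cauchySeq_of_antitone_convex`). The limit satisfies
`R₂ A f ≤ f`, with equality because both sides have mean `1` (`IsFlow.exists_invariantDensity`).
Setting `f` to zero on the exceptional orbits, the equation holds on every orbit
(`IsFlow.exists_isStationaryDensity`), which is the continuity and the weak differentiability in
time. If `φ` vanishes at one site, then it does so at all later times, and because all sites
accumulate rate, it eventually vanishes at every site; ergodicity excludes this
(`IsStationaryDensity.ae_pos`).

*The dual walk.* The kernel of the walk is the sum over the number of jumps of kernels that may be
decomposed at the first or at the last jump (`IsFlow.jumpKernel_succ_last`). The number of jumps is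
dominated by a Poisson variable, so the walk is conservative. By the decomposition at the last jump,
the density transported by the walk is a limit of Picard iterates of the forward equation started
from zero, so it is at most `φ`; both have the same mass, so they coincide, which is stationarity
(`IsStationaryDensity.lintegral_walkKernel_eq`). Finally, the walk charges its starting point and,
eventually, the neighbouring site, so sets that are invariant for the environment seen from the walk
are almost surely shift invariant (`IsFlow.ae_mem_iff_of_walk_invariant`), hence trivial.
-/

noncomputable section

open Set Filter Topology

/-! ### Indefinite integrals and weak derivatives -/

/-- `u` is an indefinite integral of the locally integrable function `g`; equivalently `u` is
locally absolutely continuous with a.e. derivative `g`. -/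
def IsPrimitive (u g : ℝ → ℝ) : Prop :=
  LocallyIntegrable g volume ∧ ∀ s t, ∫ r in s..t, g r = u t - u s

theorem MeasureTheory.LocallyIntegrable.intervalIntegrable_real {g : ℝ → ℝ}
    (hg : LocallyIntegrable g volume) (s t : ℝ) : IntervalIntegrable g volume s t :=
  intervalIntegrable_iff.mpr
    ((hg.integrableOn_isCompact isCompact_uIcc).mono_set uIoc_subset_uIcc)

namespace IsPrimitive

variable {u v g h : ℝ → ℝ}

theorem intervalIntegrable (hu : IsPrimitive u g) (s t : ℝ) : IntervalIntegrable g volume s t :=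
  hu.1.intervalIntegrable_real s t

theorem eq_add (hu : IsPrimitive u g) (s : ℝ) : u = fun t => u s + ∫ r in s..t, g r := by
  ext t; rw [hu.2]; ring

theorem absolutelyContinuousOnInterval (hu : IsPrimitive u g) (s t : ℝ) :
    AbsolutelyContinuousOnInterval u s t := by
  have h1 : AbsolutelyContinuousOnInterval (fun _ : ℝ => u s) s t :=
    (contDiff_const (n := 1)).contDiffOn.absolutelyContinuousOnInterval
  have h2 := h1.add ((hu.intervalIntegrable s t).absolutelyContinuousOnInterval_intervalIntegral
    left_mem_uIcc)
  rw [hu.eq_add s]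
  exact h2

theorem ae_hasDerivAt (hu : IsPrimitive u g) : ∀ᵐ t, HasDerivAt u (g t) t := by
  filter_upwards [LocallyIntegrable.ae_hasDerivAt_integral hu.1] with t ht
  rw [hu.eq_add 0]
  exact (ht 0).const_add _

theorem continuous (hu : IsPrimitive u g) : Continuous u := by
  rw [hu.eq_add 0]
  exact continuous_const.add
    (intervalIntegral.continuous_primitive (fun s t => hu.intervalIntegrable s t) 0)

theorem of_ae_hasDerivAt (hac : ∀ s t, AbsolutelyContinuousOnInterval u s t)
    (hg : LocallyIntegrable g volume) (hd : ∀ᵐ t, HasDerivAt u (g t) t) : IsPrimitive u g := by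
  refine ⟨hg, fun s t => ?_⟩
  rw [← (hac s t).integral_deriv_eq_sub]
  refine intervalIntegral.integral_congr_ae ?_
  filter_upwards [hd] with r hr _
  exact hr.deriv.symm

theorem mul (hu : IsPrimitive u g) (hv : IsPrimitive v h) :
    IsPrimitive (fun t => u t * v t) (fun t => g t * v t + u t * h t) := by
  refine of_ae_hasDerivAt
    (fun s t => (hu.absolutelyContinuousOnInterval s t).mul (hv.absolutelyContinuousOnInterval s t))
    ?_ ?_
  · refine LocallyIntegrable.add ?_ ?_
    · simpa [mul_comm] using hu.1.continuous_smul hv.continuous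
    · exact hv.1.continuous_smul hu.continuous
  · filter_upwards [hu.ae_hasDerivAt, hv.ae_hasDerivAt] with t h1 h2 using h1.mul h2

theorem of_contDiff {u : ℝ → ℝ} (hu : ContDiff ℝ 1 u) : IsPrimitive u (deriv u) :=
  of_ae_hasDerivAt (fun _ _ => hu.contDiffOn.absolutelyContinuousOnInterval)
    (hu.continuous_deriv le_rfl).locallyIntegrable
    (.of_forall fun t => (hu.differentiable one_ne_zero t).hasDerivAt)

theorem congr {g' : ℝ → ℝ} (hu : IsPrimitive u g) (h : ∀ t, g t = g' t) : IsPrimitive u g' := by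
  rwa [← funext h]

theorem hasWeakDeriv (hu : IsPrimitive u g) : DynCond.HasWeakDeriv u g := by
  refine ⟨hu.continuous.locallyIntegrable, hu.1, fun η hη hc => ?_⟩
  have hp := (of_contDiff (hη.of_le (by exact_mod_cast le_top))).mul hu
  obtain ⟨R, hR⟩ := hc.isCompact.isBounded.subset_closedBall 0
  have hsupp : ∀ f : ℝ → ℝ, Function.support f ⊆ tsupport η →
      ∫ t in (-(R + 1))..(R + 1), f t = ∫ t, f t := fun f hf => by
    refine intervalIntegral.integral_eq_integral_of_support_subset (hf.trans (hR.trans ?_))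
    intro t ht
    rw [mem_closedBall_zero_iff, Real.norm_eq_abs, abs_le] at ht
    exact ⟨by linarith [ht.1], by linarith [ht.2]⟩
  have h0 : ∀ t, |t| = |R + 1| → η t = 0 := fun t ht => by
    by_contra hne
    have := hR (subset_tsupport η hne)
    rw [mem_closedBall_zero_iff, Real.norm_eq_abs, ht] at this
    linarith [le_abs_self (R + 1)]
  have h1 : Function.support (fun t => deriv η t * u t) ⊆ tsupport η :=
    (Function.support_mul_subset_left _ _).trans (support_deriv_subset)
  have h2 : Function.support (fun t => η t * g t) ⊆ tsupport η :=
    (Function.support_mul_subset_left _ _).trans (subset_tsupport η)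
  -- the fundamental theorem for `η u` on an interval at whose endpoints `η` vanishes
  have h3 := hp.2 (-(R + 1)) (R + 1)
  simp only at h3
  rw [h0 _ rfl, h0 _ (abs_neg _), intervalIntegral.integral_add, hsupp _ h1, hsupp _ h2] at h3
  · linarith
  · apply LocallyIntegrable.intervalIntegrable_real
    exact Continuous.locallyIntegrable
      ((hη.continuous_deriv (by simp)).mul hu.continuous)
  · exact (hu.1.continuous_smul hη.continuous).intervalIntegrable_real _ _

/-- Chain rule. The bound on `β` makes `B` Lipschitz, so that `F ∘ B` is absolutely continuous. -/
theorem comp_of_bounded {B β F : ℝ → ℝ} (hB : IsPrimitive B β) {C : ℝ≥0}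
    (hC : ∀ t, |β t| ≤ C) (hF : ContDiff ℝ 1 F) :
    IsPrimitive (fun t => F (B t)) (fun t => deriv F (B t) * β t) := by
  have hlip : LipschitzWith C B := by
    refine LipschitzWith.of_dist_le_mul fun s t => ?_
    rw [Real.dist_eq, ← hB.2, Real.dist_eq]
    simpa using intervalIntegral.norm_integral_le_of_norm_le_const (a := t) (b := s)
      (fun r _ => (Real.norm_eq_abs (β r)).trans_le (hC r))
  refine of_ae_hasDerivAt (fun s t => ?_) ?_ ?_
  · obtain ⟨R, hR⟩ := (isCompact_uIcc.image hB.continuous (X := ℝ) (s := uIcc s t)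
      ).isBounded.subset_closedBall 0
    obtain ⟨K, hK⟩ := (hF.contDiffOn (s := Metric.closedBall 0 R)).exists_lipschitzOnWith
      one_ne_zero (convex_closedBall _ _) (isCompact_closedBall _ _)
    exact (hK.comp hlip.lipschitzOnWith
      (fun r hr => hR (mem_image_of_mem B hr))).absolutelyContinuousOnInterval
  · exact hB.1.continuous_smul ((hF.continuous_deriv le_rfl).comp hB.continuous)
  · filter_upwards [hB.ae_hasDerivAt] with t ht
    exact ((hF.differentiable one_ne_zero _).hasDerivAt).comp t ht

end IsPrimitive

theorem locallyIntegrable_of_bounded {g : ℝ → ℝ} (hg : Measurable g) {C : ℝ}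
    (hC : ∀ t, |g t| ≤ C) : LocallyIntegrable g volume :=
  (locallyIntegrable_const C).mono hg.aestronglyMeasurable
    (.of_forall fun t => (hC t).trans (le_abs_self C))

theorem isPrimitive_integral {g : ℝ → ℝ} (hg : LocallyIntegrable g volume) (c : ℝ) :
    IsPrimitive (fun t => ∫ r in c..t, g r) g :=
  ⟨hg, fun _ _ => (intervalIntegral.integral_interval_sub_left (hg.intervalIntegrable_real _ _)
    (hg.intervalIntegrable_real _ _)).symm⟩

/-- The resolvent `u(s) = ∫_s^∞ e^{-μ(r-s)} h(r) dr` solves `u' = μ u - h`. -/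
theorem isPrimitive_resolvent {h : ℝ → ℝ} {μ : ℝ}
    (hh : ∀ s, IntegrableOn (fun r => Real.exp (-(μ * r)) * h r) (Ioi s)) :
    IsPrimitive (fun s => ∫ r in Ioi s, Real.exp (-(μ * (r - s))) * h r)
      (fun s => μ * (∫ r in Ioi s, Real.exp (-(μ * (r - s))) * h r) - h s) := by
  set k : ℝ → ℝ := fun r => Real.exp (-(μ * r)) * h r with hk
  have hkl : LocallyIntegrable k volume := fun x =>
    ⟨Ioi (x - 1), Ioi_mem_nhds (by linarith), hh _⟩
  have hG : IsPrimitive (fun s => ∫ r in Ioi s, k r) (fun r => -k r) := by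
    refine ⟨hkl.neg, fun s t => ?_⟩
    have := intervalIntegral.integral_Ioi_sub_Ioi' (μ := volume) (hh s) (hh t)
    simp only [intervalIntegral.integral_neg]
    linarith
  have hexp : IsPrimitive (fun s => Real.exp (μ * s)) (fun s => μ * Real.exp (μ * s)) := by
    refine (IsPrimitive.of_contDiff (by fun_prop)).congr fun t => ?_
    have : HasDerivAt (fun s => Real.exp (μ * s)) (Real.exp (μ * t) * (μ * 1)) t :=
      ((hasDerivAt_id t).const_mul μ).exp
    rw [this.deriv]; ring
  have hu : ∀ s, ∫ r in Ioi s, Real.exp (-(μ * (r - s))) * h r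
      = Real.exp (μ * s) * ∫ r in Ioi s, k r := fun s => by
    rw [← integral_const_mul]
    congr 1; ext r
    rw [hk, ← mul_assoc, ← Real.exp_add]; ring_nf
  simp only [hu]
  refine (hexp.mul hG).congr fun t => ?_
  have : Real.exp (μ * t) * k t = h t := by
    rw [hk, ← mul_assoc, ← Real.exp_add]; ring_nf; simp
  rw [← this]; ring

/-- The survival factor of a clock with rate `β`. -/
theorem isPrimitive_exp_integral {β : ℝ → ℝ} (hβ : Measurable β) {C : ℝ≥0}
    (hC : ∀ t, |β t| ≤ C) (t : ℝ) :
    IsPrimitive (fun r => Real.exp (-∫ u in t..r, β u))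
      (fun r => -(Real.exp (-∫ u in t..r, β u) * β r)) := by
  have h := (isPrimitive_integral (locallyIntegrable_of_bounded hβ hC) t).comp_of_bounded hC
    (F := fun x => Real.exp (-x)) (by fun_prop)
  refine h.congr fun r => ?_
  have : HasDerivAt (fun x => Real.exp (-x)) (Real.exp (-∫ u in t..r, β u) * (-1))
    (∫ u in t..r, β u) := (hasDerivAt_id _).neg.exp
  rw [this.deriv]; ring

/-! ### Space-time flows and time resolvents -/

/-- A measurable, measure-preserving action `θ` of the space-time group `ℝ × ℤ`. -/
structure IsFlow {Ω : Type*} [MeasurableSpace Ω] (θ : ℝ → ℤ → Ω → Ω) (P : Measure Ω) : Prop where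
  comp : ∀ t s x y a, θ t x (θ s y a) = θ (t + s) (x + y) a
  zero : ∀ a, θ 0 0 a = a
  measurable_joint : ∀ x, Measurable fun p : ℝ × Ω => θ p.1 x p.2
  map_eq : ∀ t x, P.map (θ t x) = P

/-- Bounded measurable functions. -/
def IsBddMeas {Ω : Type*} [MeasurableSpace Ω] (f : Ω → ℝ) : Prop :=
  Measurable f ∧ ∃ C, ∀ a, |f a| ≤ C

section Flow

variable {Ω : Type*} [MeasurableSpace Ω] {θ : ℝ → ℤ → Ω → Ω} {P : Measure Ω}

namespace IsBddMeas

variable {f g : Ω → ℝ}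

theorem const (c : ℝ) : IsBddMeas (fun _ : Ω => c) := ⟨measurable_const, |c|, fun _ => le_rfl⟩

theorem add (hf : IsBddMeas f) (hg : IsBddMeas g) : IsBddMeas (fun a => f a + g a) := by
  obtain ⟨⟨h1, C, hC⟩, h2, D, hD⟩ := And.intro hf hg
  exact ⟨h1.add h2, C + D, fun a => (abs_add_le _ _).trans (add_le_add (hC a) (hD a))⟩

theorem mul (hf : IsBddMeas f) (hg : IsBddMeas g) : IsBddMeas (fun a => f a * g a) := by
  obtain ⟨⟨h1, C, hC⟩, h2, D, hD⟩ := And.intro hf hg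
  refine ⟨h1.mul h2, C * D, fun a => ?_⟩
  rw [abs_mul]
  exact mul_le_mul (hC a) (hD a) (abs_nonneg _) ((abs_nonneg _).trans (hC a))

theorem neg (hf : IsBddMeas f) : IsBddMeas (fun a => -f a) := by
  obtain ⟨h1, C, hC⟩ := hf
  exact ⟨h1.neg, C, fun a => (abs_neg _).trans_le (hC a)⟩

theorem sub (hf : IsBddMeas f) (hg : IsBddMeas g) : IsBddMeas (fun a => f a - g a) := by
  simpa only [sub_eq_add_neg] using hf.add hg.neg

theorem max (hf : IsBddMeas f) (hg : IsBddMeas g) : IsBddMeas (fun a => max (f a) (g a)) := by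
  obtain ⟨⟨h1, C, hC⟩, h2, D, hD⟩ := And.intro hf hg
  refine ⟨h1.max h2, Max.max C D, fun a => ?_⟩
  exact abs_max_le_max_abs_abs.trans (max_le_max (hC a) (hD a))

theorem integrable [IsFiniteMeasure P] (hf : IsBddMeas f) : Integrable f P := by
  obtain ⟨h1, C, hC⟩ := hf
  exact Integrable.of_bound h1.aestronglyMeasurable C (.of_forall hC)

theorem integral_add [IsFiniteMeasure P] (hf : IsBddMeas f) (hg : IsBddMeas g) :
    ∫ a, (f a + g a) ∂P = ∫ a, f a ∂P + ∫ a, g a ∂P :=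
  MeasureTheory.integral_add hf.integrable hg.integrable

theorem integral_sub [IsFiniteMeasure P] (hf : IsBddMeas f) (hg : IsBddMeas g) :
    ∫ a, (f a - g a) ∂P = ∫ a, f a ∂P - ∫ a, g a ∂P :=
  MeasureTheory.integral_sub hf.integrable hg.integrable

theorem const_mul (hf : IsBddMeas f) (c : ℝ) : IsBddMeas (fun a => c * f a) := (const c).mul hf

end IsBddMeas

/-- The resolvent `∫_0^∞ e^{-μ r} f ∘ θ_{r,0} dr` of the time shifts. -/
def timeResolvent (θ : ℝ → ℤ → Ω → Ω) (μ : ℝ) (f : Ω → ℝ) (a : Ω) : ℝ :=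
  ∫ r in Ioi (0 : ℝ), Real.exp (-(μ * r)) * f (θ r 0 a)

/-- The positive operator `A f = 2 (1 - b) f + (b f) ∘ θ_{0,1} + (b f) ∘ θ_{0,-1}`, so that
`A - 2` is the adjoint generator `L⁺` evaluated at the origin. -/
def stepOp (θ : ℝ → ℤ → Ω → Ω) (b f : Ω → ℝ) (a : Ω) : ℝ :=
  2 * (1 - b a) * f a + b (θ 0 1 a) * f (θ 0 1 a) + b (θ 0 (-1) a) * f (θ 0 (-1) a)

namespace IsFlow

theorem measurable_map (h : IsFlow θ P) (t : ℝ) (x : ℤ) : Measurable (θ t x) :=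
  (h.measurable_joint x).comp measurable_prodMk_left

theorem measurable_path (h : IsFlow θ P) (x : ℤ) (a : Ω) : Measurable (fun t => θ t x a) :=
  (h.measurable_joint x).comp measurable_prodMk_right

theorem measurePreserving (h : IsFlow θ P) (t : ℝ) (x : ℤ) : MeasurePreserving (θ t x) P P :=
  ⟨h.measurable_map t x, h.map_eq t x⟩

theorem bddMeas_comp (h : IsFlow θ P) {f : Ω → ℝ} (hf : IsBddMeas f) (t : ℝ) (x : ℤ) :
    IsBddMeas (fun a => f (θ t x a)) :=
  ⟨hf.1.comp (h.measurable_map t x), hf.2.imp fun _ hC _ => hC _⟩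

theorem integral_comp (h : IsFlow θ P) {f : Ω → ℝ} (hf : Measurable f) (t : ℝ) (x : ℤ) :
    ∫ a, f (θ t x a) ∂P = ∫ a, f a ∂P := by
  conv_rhs => rw [← h.map_eq t x]
  rw [integral_map (h.measurable_map t x).aemeasurable hf.aestronglyMeasurable]

theorem lintegral_comp (h : IsFlow θ P) {f : Ω → ℝ≥0∞} (hf : Measurable f) (t : ℝ) (x : ℤ) :
    ∫⁻ a, f (θ t x a) ∂P = ∫⁻ a, f a ∂P :=
  (h.measurePreserving t x).lintegral_comp hf

theorem ae_comp (h : IsFlow θ P) {p : Ω → Prop} (hp : ∀ᵐ a ∂P, p a) (t : ℝ) (x : ℤ) :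
    ∀ᵐ a ∂P, p (θ t x a) :=
  (h.measurePreserving t x).quasiMeasurePreserving.ae hp

/-- Almost surely, an almost sure event occurs at almost all times. -/
theorem ae_ae_comp (h : IsFlow θ P) [SFinite P] {p : Ω → Prop} (hp : ∀ᵐ a ∂P, p a) (x : ℤ) :
    ∀ᵐ a ∂P, ∀ᵐ t : ℝ, p (θ t x a) := by
  obtain ⟨s, hs, hsm, hs0⟩ := exists_measurable_superset_of_null (ae_iff.mp hp)
  have h1 : ∀ᵐ q : ℝ × Ω ∂(volume.prod P), θ q.1 x q.2 ∉ s := by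
    rw [Measure.ae_prod_iff_ae_ae]
    · refine .of_forall fun t => h.ae_comp (p := fun a => a ∉ s) ?_ t x
      exact measure_eq_zero_iff_ae_notMem.mp hs0
    · exact (h.measurable_joint x) hsm.compl
  have h2 := Measure.ae_ae_comm (p := fun (t : ℝ) a => θ t x a ∉ s) (μ := volume) (ν := P)
    ((h.measurable_joint x) hsm.compl)
  have h3 := h2.mp (Measure.ae_ae_of_ae_prod h1)
  filter_upwards [h3] with a ha
  filter_upwards [ha] with t ht
  by_contra hcon
  exact ht (hs hcon)

variable {f g : Ω → ℝ} {μ : ℝ}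

theorem integrableOn_path (h : IsFlow θ P) (hμ : 0 < μ) (hf : IsBddMeas f) (x : ℤ) (a : Ω)
    (s : ℝ) : IntegrableOn (fun r => Real.exp (-(μ * r)) * f (θ r x a)) (Ioi s) := by
  obtain ⟨h1, C, hC⟩ := hf
  have he : IntegrableOn (fun r => Real.exp (-(μ * r))) (Ioi s) := by
    simpa using integrableOn_exp_mul_Ioi (neg_neg_of_pos hμ) s
  exact he.mul_bdd (h1.comp (h.measurable_path x a)).aestronglyMeasurable (.of_forall fun r => hC _)

theorem integral_exp_Ioi (hμ : 0 < μ) : ∫ r in Ioi (0 : ℝ), Real.exp (-(μ * r)) = 1 / μ := by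
  have := integral_exp_mul_Ioi (neg_neg_of_pos hμ) 0
  simp only [neg_mul] at this
  rw [this]; simp

omit [MeasurableSpace Ω] in
theorem abs_resolvent_le (hμ : 0 < μ) {C : ℝ} (hC : ∀ a, |f a| ≤ C) (a : Ω) :
    |timeResolvent θ μ f a| ≤ C / μ := by
  have he : IntegrableOn (fun r => Real.exp (-(μ * r))) (Ioi 0) := by
    simpa using integrableOn_exp_mul_Ioi (neg_neg_of_pos hμ) 0
  rw [timeResolvent, ← Real.norm_eq_abs]
  refine (norm_integral_le_of_norm_le (he.mul_const C) (.of_forall fun r => ?_)).trans_eq ?_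
  · rw [norm_mul, Real.norm_eq_abs, Real.abs_exp]
    exact mul_le_mul_of_nonneg_left (hC _) (Real.exp_nonneg _)
  · rw [integral_mul_const, integral_exp_Ioi hμ]; ring

theorem bddMeas_resolvent (h : IsFlow θ P) (hμ : 0 < μ) (hf : IsBddMeas f) :
    IsBddMeas (timeResolvent θ μ f) := by
  obtain ⟨C, hC⟩ := hf.2
  refine ⟨?_, C / μ, abs_resolvent_le hμ hC⟩
  have : StronglyMeasurable (fun q : ℝ × Ω => Real.exp (-(μ * q.1)) * f (θ q.1 0 q.2)) :=
    (Measurable.mul (by fun_prop) (hf.1.comp (h.measurable_joint 0))).stronglyMeasurable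
  exact this.integral_prod_left'.measurable

theorem resolvent_sub (h : IsFlow θ P) (hμ : 0 < μ) (hf : IsBddMeas f) (hg : IsBddMeas g) (a : Ω) :
    timeResolvent θ μ (fun a => f a - g a) a = timeResolvent θ μ f a - timeResolvent θ μ g a := by
  simp only [timeResolvent, mul_sub]
  exact integral_sub (h.integrableOn_path hμ hf 0 a 0) (h.integrableOn_path hμ hg 0 a 0)

omit [MeasurableSpace Ω] in
theorem resolvent_const (hμ : 0 < μ) (c : ℝ) (a : Ω) :
    timeResolvent θ μ (fun _ => c) a = c / μ := by
  simp only [timeResolvent]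
  rw [integral_mul_const, integral_exp_Ioi hμ]; ring

theorem resolvent_comp (h : IsFlow θ P) (x : ℤ) (a : Ω) :
    timeResolvent θ μ f (θ 0 x a) = timeResolvent θ μ (fun a => f (θ 0 x a)) a := by
  simp only [timeResolvent, h.comp, add_zero, add_comm]

theorem resolvent_mono (h : IsFlow θ P) (hμ : 0 < μ) (hf : IsBddMeas f) (hg : IsBddMeas g)
    (hfg : ∀ a, f a ≤ g a) (a : Ω) : timeResolvent θ μ f a ≤ timeResolvent θ μ g a :=
  integral_mono (h.integrableOn_path hμ hf 0 a 0) (h.integrableOn_path hμ hg 0 a 0)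
    fun _ => mul_le_mul_of_nonneg_left (hfg _) (Real.exp_nonneg _)

theorem resolvent_path (h : IsFlow θ P) (s : ℝ) (x : ℤ) (a : Ω) :
    timeResolvent θ μ f (θ s x a)
      = ∫ r in Ioi s, Real.exp (-(μ * (r - s))) * f (θ r x a) := by
  have := (measurePreserving_add_right (volume : Measure ℝ) s).setIntegral_preimage_emb
    (measurableEmbedding_addRight s) (fun r => Real.exp (-(μ * (r - s))) * f (θ r x a)) (Ioi s)
  rw [← this, timeResolvent]
  simp [h.comp]

theorem isPrimitive_resolvent_path (h : IsFlow θ P) (hμ : 0 < μ) (hf : IsBddMeas f) (x : ℤ)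
    (a : Ω) : IsPrimitive (fun s => timeResolvent θ μ f (θ s x a))
      (fun s => μ * timeResolvent θ μ f (θ s x a) - f (θ s x a)) := by
  simp only [h.resolvent_path]
  exact isPrimitive_resolvent (h.integrableOn_path hμ hf x a)

theorem integral_resolvent (h : IsFlow θ P) [IsFiniteMeasure P] (hμ : 0 < μ) (hf : IsBddMeas f) :
    ∫ a, timeResolvent θ μ f a ∂P = (∫ a, f a ∂P) / μ := by
  simp only [timeResolvent]
  rw [integral_integral_swap]
  · simp only [integral_const_mul, h.integral_comp hf.1]
    rw [integral_mul_const, integral_exp_Ioi hμ]; ring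
  · obtain ⟨h1, C, hC⟩ := hf
    have he : IntegrableOn (fun r => Real.exp (-(μ * r))) (Ioi 0) := by
      simpa using integrableOn_exp_mul_Ioi (neg_neg_of_pos hμ) 0
    have h2 : Integrable (fun q : Ω × ℝ => Real.exp (-(μ * q.2)))
        (P.prod (volume.restrict (Ioi 0))) := he.comp_snd P
    refine h2.mul_bdd (c := C) ?_ (.of_forall fun q => hC _)
    exact (h1.comp ((h.measurable_joint 0).comp measurable_swap)).aestronglyMeasurable

end IsFlow

end Flow

/-! ### The massive corrector and the approximate densities -/

/-- A measurable jump rate with values in `[0, 1]`. -/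
structure IsRate {Ω : Type*} [MeasurableSpace Ω] (b : Ω → ℝ) : Prop where
  meas : Measurable b
  nonneg : ∀ a, 0 ≤ b a
  le_one : ∀ a, b a ≤ 1

section Corrector

variable {Ω : Type*} [MeasurableSpace Ω] {θ : ℝ → ℤ → Ω → Ω} {P : Measure Ω} {b : Ω → ℝ}

theorem IsRate.bddMeas (hb : IsRate b) : IsBddMeas b :=
  ⟨hb.meas, 1, fun a => abs_le.mpr ⟨by linarith [hb.nonneg a], hb.le_one a⟩⟩

/-- `2 χ + L χ + V` with `L` the generator of the random walk among the conductances `b` and `V`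
its local drift. -/
def correctorOp (θ : ℝ → ℤ → Ω → Ω) (b χ : Ω → ℝ) (a : Ω) : ℝ :=
  (2 - b a - b (θ 0 (-1) a)) * χ a + b a * χ (θ 0 1 a) + b (θ 0 (-1) a) * χ (θ 0 (-1) a)
    + (b a - b (θ 0 (-1) a))

theorem IsFlow.bddMeas_correctorOp (h : IsFlow θ P) (hb : IsRate b) {χ : Ω → ℝ}
    (hχ : IsBddMeas χ) : IsBddMeas (correctorOp θ b χ) := by
  have hb0 := hb.bddMeas
  have hb1 := h.bddMeas_comp hb0 0 (-1)
  exact ((((((IsBddMeas.const 2).sub hb0).sub hb1).mul hχ).add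
    (hb0.mul (h.bddMeas_comp hχ 0 1))).add (hb1.mul (h.bddMeas_comp hχ 0 (-1)))).add (hb0.sub hb1)

theorem IsFlow.bddMeas_stepOp (h : IsFlow θ P) (hb : IsRate b) {f : Ω → ℝ}
    (hf : IsBddMeas f) : IsBddMeas (stepOp θ b f) := by
  have hb0 := hb.bddMeas
  exact ((((IsBddMeas.const 2).mul ((IsBddMeas.const 1).sub hb0)).mul hf).add
    ((h.bddMeas_comp hb0 0 1).mul (h.bddMeas_comp hf 0 1))).add
    ((h.bddMeas_comp hb0 0 (-1)).mul (h.bddMeas_comp hf 0 (-1)))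

theorem abs_correctorOp_sub_le (hb : IsRate b) {f g : Ω → ℝ} {D : ℝ}
    (hD : ∀ a, |f a - g a| ≤ D) (a : Ω) :
    |correctorOp θ b f a - correctorOp θ b g a| ≤ 2 * D := by
  have e : correctorOp θ b f a - correctorOp θ b g a
      = (2 - b a - b (θ 0 (-1) a)) * (f a - g a) + b a * (f (θ 0 1 a) - g (θ 0 1 a))
        + b (θ 0 (-1) a) * (f (θ 0 (-1) a) - g (θ 0 (-1) a)) := by
    simp only [correctorOp]; ring
  have h0 := hb.nonneg a
  have h1 := hb.nonneg (θ 0 (-1) a)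
  have h2 : 0 ≤ 2 - b a - b (θ 0 (-1) a) := by linarith [hb.le_one a, hb.le_one (θ 0 (-1) a)]
  rw [e]
  refine (abs_add_three _ _ _).trans ?_
  rw [abs_mul, abs_mul, abs_mul, abs_of_nonneg h0, abs_of_nonneg h1, abs_of_nonneg h2]
  have := mul_le_mul_of_nonneg_left (hD a) h2
  have := mul_le_mul_of_nonneg_left (hD (θ 0 1 a)) h0
  have := mul_le_mul_of_nonneg_left (hD (θ 0 (-1) a)) h1
  linarith

/-- The massive corrector: the contraction `χ ↦ R_μ (2 χ + L χ + V)` has a fixed point. -/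
theorem IsFlow.exists_corrector (h : IsFlow θ P) (hb : IsRate b) {μ : ℝ} (hμ : 2 < μ) :
    ∃ χ : Ω → ℝ, IsBddMeas χ ∧ ∀ a, χ a = timeResolvent θ μ (correctorOp θ b χ) a := by
  have hμ0 : 0 < μ := by linarith
  set S : (Ω → ℝ) → Ω → ℝ := fun f => timeResolvent θ μ (correctorOp θ b f) with hS
  have hSb : ∀ f, IsBddMeas f → IsBddMeas (S f) := fun f hf =>
    h.bddMeas_resolvent hμ0 (h.bddMeas_correctorOp hb hf)
  have hSl : ∀ f g, IsBddMeas f → IsBddMeas g → ∀ D, (∀ a, |f a - g a| ≤ D) →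
      ∀ a, |S f a - S g a| ≤ 2 / μ * D := fun f g hf hg D hD a => by
    have := abs_resolvent_le (θ := θ) hμ0 (abs_correctorOp_sub_le (θ := θ) hb hD) a
    rw [h.resolvent_sub hμ0 (h.bddMeas_correctorOp hb hf) (h.bddMeas_correctorOp hb hg)] at this
    exact this.trans_eq (by ring)
  set c : ℕ → Ω → ℝ := fun n => S^[n] (fun _ => 0) with hc
  have hcs : ∀ n, c (n + 1) = S (c n) := fun n => Function.iterate_succ_apply' S n _
  have hcb : ∀ n, IsBddMeas (c n) := fun n => by
    induction n with
    | zero => exact IsBddMeas.const 0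
    | succ n ih => rw [hcs]; exact hSb _ ih
  obtain ⟨C, hC⟩ := (hcb 1).2
  set q := 2 / μ with hq
  have hq0 : 0 ≤ q := by positivity
  have hq1 : q < 1 := by rw [hq, div_lt_one hμ0]; exact hμ
  -- Picard iterates approach each other geometrically, with ratio `2 / μ < 1`
  have hstep : ∀ n a, |c n a - c (n + 1) a| ≤ C * q ^ n := fun n => by
    induction n with
    | zero => intro a; simpa [hc, abs_sub_comm] using hC a
    | succ n ih =>
      intro a
      have := hSl _ _ (hcb n) (hcb (n + 1)) _ ih a
      rw [hcs (n + 1), pow_succ]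
      nth_rewrite 1 [hcs n]
      linarith
  have hlim : ∀ a, ∃ l, Tendsto (fun n => c n a) atTop (𝓝 l) := fun a =>
    cauchySeq_tendsto_of_complete (cauchySeq_of_le_geometric q C hq1 fun n => hstep n a)
  choose χ hχ using hlim
  have hdist : ∀ n a, |c n a - χ a| ≤ C * q ^ n / (1 - q) := fun n a =>
    dist_le_of_le_geometric_of_tendsto q C hq1 (fun n => hstep n a) (hχ a) n
  have hχb : IsBddMeas χ := by
    refine ⟨measurable_of_tendsto_metrizable (fun n => (hcb n).1) (tendsto_pi_nhds.mpr hχ),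
      C / (1 - q), fun a => ?_⟩
    simpa [hc] using hdist 0 a
  refine ⟨χ, hχb, fun a => tendsto_nhds_unique ((tendsto_add_atTop_iff_nat 1).mpr (hχ a)) ?_⟩
  rw [tendsto_iff_dist_tendsto_zero]
  have h0 : Tendsto (fun n => q * (C * q ^ n / (1 - q))) atTop (𝓝 0) := by
    have := (((tendsto_pow_atTop_nhds_zero_of_lt_one hq0 hq1).const_mul C).div_const
      (1 - q)).const_mul q
    simpa using this
  refine squeeze_zero (fun _ => dist_nonneg) (fun n => ?_) h0
  rw [hcs]
  exact hSl _ _ (hcb n) hχb _ (hdist n) a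

theorem IsFlow.integral_setIntegral_path (h : IsFlow θ P) [IsFiniteMeasure P] {f : Ω → ℝ}
    (hf : IsBddMeas f) : ∫ a, (∫ s in (0 : ℝ)..1, f (θ s 0 a)) ∂P = ∫ a, f a ∂P := by
  simp only [intervalIntegral.integral_of_le zero_le_one]
  rw [integral_integral_swap]
  · simp [h.integral_comp hf.1]
  · obtain ⟨h1, C, hC⟩ := hf
    exact Integrable.of_bound (h1.comp
      ((h.measurable_joint 0).comp measurable_swap)).aestronglyMeasurable C (.of_forall fun _ => hC _)

/-- Stationarity makes the time derivative of `χ²` integrate to zero. -/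
theorem IsFlow.integral_resolvent_mul_deriv (h : IsFlow θ P) [IsFiniteMeasure P] {μ : ℝ}
    (hμ : 0 < μ) {f χ : Ω → ℝ} (hf : IsBddMeas f) (hχ : ∀ a, χ a = timeResolvent θ μ f a) :
    ∫ a, χ a * (μ * χ a - f a) ∂P = 0 := by
  obtain rfl : χ = timeResolvent θ μ f := funext hχ
  set χ := timeResolvent θ μ f
  have hχb : IsBddMeas χ := h.bddMeas_resolvent hμ hf
  set g : Ω → ℝ := fun a => χ a * (μ * χ a - f a) with hg
  have hgb : IsBddMeas g := hχb.mul (((IsBddMeas.const μ).mul hχb).sub hf)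
  have hpath : ∀ a, ∫ s in (0 : ℝ)..1, g (θ s 0 a)
      = (1 / 2) * (χ (θ 1 0 a) * χ (θ 1 0 a)) - (1 / 2) * (χ a * χ a) := fun a => by
    have hp := h.isPrimitive_resolvent_path hμ hf 0 a
    have h2 := (hp.mul hp).2 0 1
    simp only [h.zero] at h2
    rw [← mul_sub, ← h2, ← intervalIntegral.integral_const_mul]
    congr 1; ext s; simp only [hg, χ]; ring
  have h3 := h.integral_setIntegral_path hgb
  have hsq : IsBddMeas (fun a => (1 / 2) * (χ a * χ a)) := (IsBddMeas.const _).mul (hχb.mul hχb)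
  simp only [hpath] at h3
  rw [(h.bddMeas_comp hsq 1 0).integral_sub hsq,
    h.integral_comp hsq.1 1 0, sub_self] at h3
  exact h3.symm

/-- The approximating densities `φ = 1 + χ ∘ θ_{0,1} - χ`, with `χ` the massive corrector. They solve
the forward equation with killing at rate `l` and immigration at rate `l`. -/
theorem IsFlow.exists_approxDensity (h : IsFlow θ P) [IsProbabilityMeasure P] (hb : IsRate b)
    {l : ℝ} (hl : 0 < l) :
    ∃ φ : Ω → ℝ, IsBddMeas φ ∧
      (∀ a, φ a = l / (2 + l) + timeResolvent θ (2 + l) (stepOp θ b φ) a) ∧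
      ∫ a, φ a ∂P = 1 ∧ (∀ᵐ a ∂P, 0 ≤ φ a) ∧
      ∫ a, b a * φ a ^ 2 ∂P ≤ ∫ a, b a ∂P ∧ ∫ a, φ a ^ 2 ∂P ≤ 2 + 2 / l := by
  have hμ : (0 : ℝ) < 2 + l := by linarith
  obtain ⟨χ, hχb, hχ⟩ := h.exists_corrector hb (μ := 2 + l) (by linarith)
  have hχ1 := h.bddMeas_comp hχb 0 1
  set φ : Ω → ℝ := fun a => 1 + (χ (θ 0 1 a) - χ a) with hφ
  have hφb : IsBddMeas φ := (IsBddMeas.const 1).add (hχ1.sub hχb)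
  have hGb := h.bddMeas_correctorOp hb hχb
  have hAb := h.bddMeas_stepOp hb hφb
  have hcomp : ∀ x y a, θ 0 x (θ 0 y a) = θ 0 (x + y) a := fun x y a => by
    rw [h.comp, add_zero]
  -- the gradient of `2 χ + L χ + V` is `A φ - 2`
  have hG : ∀ a, correctorOp θ b χ (θ 0 1 a) - correctorOp θ b χ a = stepOp θ b φ a - 2 :=
    fun a => by
    simp only [correctorOp, stepOp, hφ, hcomp]
    norm_num [h.zero]
    ring
  have hfix : ∀ a, φ a = l / (2 + l) + timeResolvent θ (2 + l) (stepOp θ b φ) a := fun a => by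
    have h1 : χ (θ 0 1 a) - χ a = timeResolvent θ (2 + l) (stepOp θ b φ) a - 2 / (2 + l) := by
      rw [hχ a, hχ (θ 0 1 a), h.resolvent_comp, ← h.resolvent_sub hμ (h.bddMeas_comp hGb 0 1) hGb]
      simp only [hG]
      rw [h.resolvent_sub hμ hAb (IsBddMeas.const 2), IsFlow.resolvent_const hμ]
    simp only [hφ] at h1 ⊢
    rw [h1]; field_simp; ring
  have hone : ∫ a, φ a ∂P = 1 := by
    simp only [hφ]
    rw [(IsBddMeas.const 1).integral_add (hχ1.sub hχb), hχ1.integral_sub hχb, h.integral_comp hχb.1]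
    simp
  have hpos : ∀ᵐ a ∂P, 0 ≤ φ a := by
    -- the negative part `ψ` of `φ` satisfies `ψ ≤ R A ψ`, hence `E ψ ≤ 2 / (2 + l) * E ψ`
    set ψ : Ω → ℝ := fun a => max (-φ a) 0 with hψ
    have hψb : IsBddMeas ψ := hφb.neg.max (IsBddMeas.const 0)
    have hψ0 : ∀ a, 0 ≤ ψ a := fun a => le_max_right _ _
    have hAψ := h.bddMeas_stepOp hb hψb
    have hAnn : ∀ a, 0 ≤ stepOp θ b ψ a := fun a => by
      have := hb.le_one a
      exact add_nonneg (add_nonneg (mul_nonneg (mul_nonneg zero_le_two (by linarith)) (hψ0 _))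
        (mul_nonneg (hb.nonneg _) (hψ0 _))) (mul_nonneg (hb.nonneg _) (hψ0 _))
    have h1 : ∀ a, ψ a ≤ timeResolvent θ (2 + l) (stepOp θ b ψ) a := fun a => by
      refine max_le ?_ (integral_nonneg fun r => mul_nonneg (Real.exp_nonneg _) (hAnn _))
      have h2 := h.resolvent_mono hμ hAb.neg hAψ (fun a => ?_) a
      · have h3 : timeResolvent θ (2 + l) (fun a => -stepOp θ b φ a) a
            = - timeResolvent θ (2 + l) (stepOp θ b φ) a := by
          simp only [timeResolvent, mul_neg, integral_neg]
        have : 0 ≤ l / (2 + l) := by positivity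
        rw [hfix a]; linarith
      · have k : ∀ a, -φ a ≤ ψ a := fun a => le_max_left _ _
        have := mul_le_mul_of_nonneg_left (k a) (show 0 ≤ 2 * (1 - b a) by linarith [hb.le_one a])
        have := mul_le_mul_of_nonneg_left (k (θ 0 1 a)) (hb.nonneg (θ 0 1 a))
        have := mul_le_mul_of_nonneg_left (k (θ 0 (-1) a)) (hb.nonneg (θ 0 (-1) a))
        simp only [stepOp]; linarith
    have h2 : ∫ a, stepOp θ b ψ a ∂P = 2 * ∫ a, ψ a ∂P := by
      have hbψ := hb.bddMeas.mul hψb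
      have e : stepOp θ b ψ = fun a => 2 * ψ a - 2 * (b a * ψ a)
          + (b (θ 0 1 a) * ψ (θ 0 1 a) + b (θ 0 (-1) a) * ψ (θ 0 (-1) a)) := by
        ext a; simp only [stepOp]; ring
      have i1 := h.bddMeas_comp hbψ 0 1
      have i2 := h.bddMeas_comp hbψ 0 (-1)
      have j1 := h.integral_comp hbψ.1 0 1
      have j2 := h.integral_comp hbψ.1 0 (-1)
      rw [e, ((hψb.const_mul 2).sub (hbψ.const_mul 2)).integral_add (i1.add i2),
        (hψb.const_mul 2).integral_sub (hbψ.const_mul 2), i1.integral_add i2, j1, j2,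
        integral_const_mul, integral_const_mul]
      ring
    have h3 := integral_mono (hψb.integrable (P := P))
      (h.bddMeas_resolvent hμ hAψ).integrable h1
    rw [h.integral_resolvent hμ hAψ, h2, le_div_iff₀ hμ] at h3
    have h4 : ∫ a, ψ a ∂P = 0 :=
      le_antisymm (by nlinarith) (integral_nonneg hψ0)
    rw [integral_eq_zero_iff_of_nonneg hψ0 hψb.integrable] at h4
    filter_upwards [h4] with a ha
    have : -φ a ≤ ψ a := le_max_left _ _
    rw [ha] at this
    simpa using this
  have hbφ := hb.bddMeas.mul hφb
  have hbφφ := hbφ.mul hφb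
  have hχχ := hχb.mul hχb
  -- the energy identity `E[b φ (φ - 1)] = - l E[χ²]`
  have hen : ∫ a, b a * φ a * φ a ∂P - ∫ a, b a * φ a ∂P = -(l * ∫ a, χ a * χ a ∂P) := by
    have h1 := h.integral_resolvent_mul_deriv hμ hGb hχ
    have e1 : ∀ a, χ a * ((2 + l) * χ a - correctorOp θ b χ a)
        = l * (χ a * χ a) - χ a * (b a * φ a)
          + χ a * (b (θ 0 (-1) a) * φ (θ 0 (-1) a)) := fun a => by
      simp only [correctorOp, hφ, hcomp]
      norm_num [h.zero]
      ring
    have hm := hχb.mul (h.bddMeas_comp hbφ 0 (-1))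
    have h2 : ∫ a, χ a * (b (θ 0 (-1) a) * φ (θ 0 (-1) a)) ∂P
        = ∫ a, χ (θ 0 1 a) * (b a * φ a) ∂P := by
      rw [← h.integral_comp hm.1 0 1]
      simp only [hcomp]
      norm_num [h.zero]
    have e2 : ∫ a, b a * φ a * φ a ∂P = ∫ a, (b a * φ a
        + χ (θ 0 1 a) * (b a * φ a) - χ a * (b a * φ a)) ∂P := by
      congr 1; ext a; simp only [hφ]; ring
    have hc1 := hχ1.mul hbφ
    have hc2 := hχb.mul hbφ
    rw [e2, (hbφ.add hc1).integral_sub hc2, hbφ.integral_add hc1]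
    simp only [e1] at h1
    rw [((hχχ.const_mul l).sub hc2).integral_add hm, (hχχ.const_mul l).integral_sub hc2, h2,
      integral_const_mul] at h1
    linarith
  have hχ0 : 0 ≤ ∫ a, χ a * χ a ∂P := integral_nonneg fun a => mul_self_nonneg _
  have hbi := hb.bddMeas.integrable (P := P)
  have hsq : ∀ a, b a * φ a ^ 2 = b a * φ a * φ a := fun a => by ring
  refine ⟨φ, hφb, hfix, hone, hpos, ?_, ?_⟩
  · -- `2 φ ≤ 1 + φ²`
    have h1 : ∫ a, 2 * (b a * φ a) ∂P ≤ ∫ a, (b a + b a * φ a * φ a) ∂P := by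
      refine integral_mono (hbφ.integrable.const_mul 2) (hbi.add hbφφ.integrable) fun a => ?_
      have := mul_nonneg (hb.nonneg a) (sq_nonneg (φ a - 1))
      simp only; nlinarith
    rw [integral_const_mul, hb.bddMeas.integral_add hbφφ] at h1
    simp only [hsq]
    have := mul_nonneg hl.le hχ0
    linarith
  -- the energy identity and `φ (1 - φ) ≤ 1 / 4` give `l E[χ²] ≤ 1 / 4`
  · have h1 : l * ∫ a, χ a * χ a ∂P ≤ 1 / 4 := by
      have : ∫ a, (b a * φ a - b a * φ a * φ a) ∂P ≤ ∫ _a, (1 / 4 : ℝ) ∂P := by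
        refine integral_mono (hbφ.integrable.sub hbφφ.integrable) (integrable_const _) fun a => ?_
        have := mul_nonneg (hb.nonneg a) (sq_nonneg (φ a - 1 / 2))
        have := hb.le_one a
        simp only; nlinarith
      rw [hbφ.integral_sub hbφφ] at this
      simp at this
      linarith
    have h2 : ∫ a, φ a ^ 2 ∂P
        ≤ ∫ a, (2 + 4 * (χ (θ 0 1 a) * χ (θ 0 1 a)) + 4 * (χ a * χ a)) ∂P := by
      refine integral_mono ?_ (((IsBddMeas.const 2).add ((hχ1.mul hχ1).const_mul 4)).add
        (hχχ.const_mul 4)).integrable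
        fun a => ?_
      · simpa only [sq] using (hφb.mul hφb).integrable (P := P)
      · simp only [hφ]
        nlinarith [sq_nonneg (1 - (χ (θ 0 1 a) - χ a)), sq_nonneg (χ (θ 0 1 a) + χ a)]
    rw [((IsBddMeas.const 2).add ((hχ1.mul hχ1).const_mul 4)).integral_add (hχχ.const_mul 4),
      (IsBddMeas.const 2).integral_add ((hχ1.mul hχ1).const_mul 4), integral_const_mul,
      integral_const_mul,
      h.integral_comp hχχ.1 0 1] at h2
    have h3 : ∫ a, χ a * χ a ∂P ≤ 1 / 4 / l := by rw [le_div_iff₀ hl]; linarith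
    simp only [integral_const, probReal_univ, smul_eq_mul] at h2
    have : (1 : ℝ) / 4 / l * 8 = 2 / l := by field_simp; norm_num
    linarith

end Corrector

/-! ### The weighted second moment bound -/

theorem IsPrimitive.const_add {u g : ℝ → ℝ} (hu : IsPrimitive u g) (c : ℝ) :
    IsPrimitive (fun t => c + u t) g :=
  ⟨hu.1, fun s t => by rw [hu.2]; ring⟩

theorem nonneg_of_ae_nonneg {u : ℝ → ℝ} (hu : Continuous u) (h : ∀ᵐ t, 0 ≤ u t) (t : ℝ) :
    0 ≤ u t := by
  have ho : IsOpen {t | u t < 0} := isOpen_lt hu continuous_const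
  have h0 : volume {t | u t < 0} = 0 := by
    rw [← nonpos_iff_eq_zero, ← ae_iff.mp h]; exact measure_mono fun t ht => not_le.mpr ht
  rw [ho.measure_eq_zero_iff volume] at h0
  by_contra hneg
  exact (h0 ▸ (not_le.mp hneg : t ∈ {t | u t < 0}) : t ∈ (∅ : Set ℝ))

/-- If `u' ≤ (l + 2 β) u` and `β` accumulates mass between `1` and `2` over `[-S, 0]`, then `u(0)`
is controlled by the energy of `u` over that interval. -/
theorem sq_le_integral_of_deriv_le {u u' β : ℝ → ℝ} {l S : ℝ} (hu : IsPrimitive u u')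
    (hu0 : ∀ t, 0 ≤ u t) (hβ : Measurable β) (hβ0 : ∀ t, 0 ≤ β t) (hβ1 : ∀ t, β t ≤ 1)
    (hl : 0 ≤ l) (hle : ∀ t, u' t ≤ (l + 2 * β t) * u t) (hS : 0 ≤ S)
    (hB1 : 1 ≤ ∫ s in (-S)..0, β s) (hB2 : ∫ s in (-S)..0, β s ≤ 2) :
    u 0 ^ 2 ≤ ∫ s in (-S)..0, (36 * (β s * u s ^ 2) + 2 * l ^ 2 * S * u s ^ 2) := by
  have hS' : -S ≤ 0 := by linarith
  have hβl : LocallyIntegrable β volume := locallyIntegrable_of_bounded hβ (C := 1)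
    fun t => abs_le.mpr ⟨by linarith [hβ0 t], hβ1 t⟩
  have hii : ∀ v : ℝ → ℝ, Continuous v → ∀ s t,
      IntervalIntegrable (fun r => β r * v r) volume s t := fun v hv s t => by
    have := (hβl.continuous_smul hv).intervalIntegrable_real s t
    simpa [mul_comm] using this
  have hci : ∀ v : ℝ → ℝ, Continuous v → ∀ s t, IntervalIntegrable v volume s t :=
    fun v hv s t => hv.intervalIntegrable s t
  have huc := hu.continuous
  set I := ∫ s in (-S)..0, β s * u s with hI
  set J := ∫ s in (-S)..0, u s with hJ
  set B := ∫ s in (-S)..0, β s with hB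
  have hSpos : 0 < S := by
    by_contra hcon
    have : S = 0 := le_antisymm (not_lt.mp hcon) hS
    rw [hB, this] at hB1; norm_num at hB1
  have hI0 : 0 ≤ I := intervalIntegral.integral_nonneg hS' fun s _ => mul_nonneg (hβ0 s) (hu0 s)
  have hJ0 : 0 ≤ J := intervalIntegral.integral_nonneg hS' fun s _ => hu0 s
  have hFi : ∀ s t, IntervalIntegrable (fun r => l * u r + 2 * (β r * u r)) volume s t :=
    fun s t => ((hci u huc s t).const_mul l).add ((hii u huc s t).const_mul 2)
  have hF : ∫ s in (-S)..0, (l * u s + 2 * (β s * u s)) = l * J + 2 * I := by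
    rw [intervalIntegral.integral_add ((hci u huc _ _).const_mul l) ((hii u huc _ _).const_mul 2),
      intervalIntegral.integral_const_mul, intervalIntegral.integral_const_mul]
  have hlow : ∀ s ∈ Icc (-S) 0, u 0 - (l * J + 2 * I) ≤ u s := fun s hs => by
    have h1 : u 0 - u s ≤ ∫ r in s..0, (l * u r + 2 * (β r * u r)) := by
      rw [← hu.2]
      refine intervalIntegral.integral_mono_on hs.2 (hu.intervalIntegrable _ _) (hFi _ _)
        fun r _ => (hle r).trans_eq (by ring)
    have h2 : ∫ r in s..0, (l * u r + 2 * (β r * u r)) ≤ l * J + 2 * I := by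
      rw [← hF]
      refine intervalIntegral.integral_mono_interval hs.1 hs.2 le_rfl (.of_forall fun r => ?_)
        (hFi _ _)
      exact add_nonneg (mul_nonneg hl (hu0 r)) (mul_nonneg zero_le_two (mul_nonneg (hβ0 r) (hu0 r)))
    linarith
  -- average the lower bound on `u s` with respect to `β`
  have hIB : B * (u 0 - (l * J + 2 * I)) ≤ I := by
    rw [hB, hI, ← intervalIntegral.integral_mul_const]
    exact intervalIntegral.integral_mono_on hS' ((hβl.intervalIntegrable_real _ _).mul_const _)
      (hii u huc _ _) fun s hs => mul_le_mul_of_nonneg_left (hlow s hs) (hβ0 s)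
  have hmain : u 0 ≤ 3 * I + l * J := by
    by_contra hcon
    nlinarith
  have hu2 : Continuous fun s => u s ^ 2 := huc.pow 2
  -- Cauchy-Schwarz, as nonnegativity of the variance of `u` under `β`, with `B ≤ 2`
  have hI2 : I ^ 2 ≤ 2 * ∫ s in (-S)..0, β s * u s ^ 2 := by
    have h1 : 0 ≤ ∫ s in (-S)..0, β s * (u s - I / B) ^ 2 :=
      intervalIntegral.integral_nonneg hS' fun s _ => mul_nonneg (hβ0 s) (sq_nonneg _)
    have h2 : ∫ s in (-S)..0, β s * (u s - I / B) ^ 2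
        = (∫ s in (-S)..0, β s * u s ^ 2) - 2 * (I / B) * I + (I / B) ^ 2 * B := by
      rw [hI, hB, ← intervalIntegral.integral_const_mul, ← intervalIntegral.integral_const_mul,
        ← intervalIntegral.integral_sub (hii _ hu2 _ _) ((hii u huc _ _).const_mul _),
        ← intervalIntegral.integral_add ((hii _ hu2 _ _).sub ((hii u huc _ _).const_mul _))
          ((hβl.intervalIntegrable_real _ _).const_mul _)]
      congr 1; ext s; ring
    have h3 : (I / B) * B = I := div_mul_cancel₀ _ (by linarith)
    have h4 : (I / B) * I * 2 ≥ I ^ 2 := by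
      rw [div_mul_eq_mul_div, div_mul_eq_mul_div, ge_iff_le, le_div_iff₀ (by linarith)]
      nlinarith [sq_nonneg I]
    nlinarith
  -- Cauchy-Schwarz on an interval of length `S`
  have hJ2 : J ^ 2 ≤ S * ∫ s in (-S)..0, u s ^ 2 := by
    have h1 : 0 ≤ ∫ s in (-S)..0, (u s - J / S) ^ 2 :=
      intervalIntegral.integral_nonneg hS' fun s _ => sq_nonneg _
    have h2 : ∫ s in (-S)..0, (u s - J / S) ^ 2
        = (∫ s in (-S)..0, u s ^ 2) - 2 * (J / S) * J + (J / S) ^ 2 * S := by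
      have h5 : ∫ s in (-S)..0, (J / S) ^ 2 = (J / S) ^ 2 * S := by
        simp [mul_comm]
      rw [← h5, hJ, ← intervalIntegral.integral_const_mul,
        ← intervalIntegral.integral_sub (hci _ hu2 _ _) ((hci u huc _ _).const_mul _),
        ← intervalIntegral.integral_add ((hci _ hu2 _ _).sub ((hci u huc _ _).const_mul _))
          (by simp)]
      congr 1; ext s; ring
    have h3 : (J / S) * S = J := div_mul_cancel₀ _ hSpos.ne'
    have h4 : (∫ s in (-S)..0, u s ^ 2) ≥ (J / S) * J := by nlinarith
    have h5 : S * ((J / S) * J) = J ^ 2 := by rw [← mul_assoc, mul_comm S, h3, sq]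
    rw [← h5]; exact mul_le_mul_of_nonneg_left h4 hS
  rw [intervalIntegral.integral_add ((hii _ hu2 _ _).const_mul _) ((hci _ hu2 _ _).const_mul _),
    intervalIntegral.integral_const_mul, intervalIntegral.integral_const_mul]
  have h6 : u 0 ^ 2 ≤ (3 * I + l * J) ^ 2 := pow_le_pow_left₀ (hu0 0) hmain 2
  nlinarith [sq_nonneg (3 * I - l * J), mul_le_mul_of_nonneg_left hJ2 (sq_nonneg l)]

section Weight

variable {Ω : Type*} [MeasurableSpace Ω] {θ : ℝ → ℤ → Ω → Ω} {P : Measure Ω} {b : Ω → ℝ}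

/-- Almost sure nonnegativity holds simultaneously along the whole orbit, by continuity in time. -/
theorem IsFlow.ae_nonneg_path (h : IsFlow θ P) [SFinite P] {φ : Ω → ℝ}
    (hc : ∀ a x, Continuous fun t => φ (θ t x a)) (hφ : ∀ᵐ a ∂P, 0 ≤ φ a) :
    ∀ᵐ a ∂P, ∀ t x, 0 ≤ φ (θ t x a) := by
  have : ∀ᵐ a ∂P, ∀ x, ∀ᵐ t, 0 ≤ φ (θ t x a) := ae_all_iff.mpr fun x => h.ae_ae_comp hφ x
  filter_upwards [this] with a ha t x
  exact nonneg_of_ae_nonneg (hc a x) (ha x) t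

/-- The weighted second moment bound, uniform in the mass `l`. The weight is a function of the time
`σ` that the past conductance at the origin needs to accumulate a unit of mass. -/
theorem IsFlow.integral_weight_mul_sq_le (h : IsFlow θ P) [IsProbabilityMeasure P] (hb : IsRate b)
    {σ : Ω → ℕ} (hσ : Measurable σ)
    (hσb : ∀ᵐ a ∂P, 1 ≤ ∫ s in (-(σ a : ℝ))..0, b (θ s 0 a) ∧
      ∫ s in (-(σ a : ℝ))..0, b (θ s 0 a) ≤ 2)
    {l : ℝ} (hl : 0 < l) (hl1 : l ≤ 1) {φ : Ω → ℝ} (hφb : IsBddMeas φ)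
    (hfix : ∀ a, φ a = l / (2 + l) + timeResolvent θ (2 + l) (stepOp θ b φ) a)
    (hpos : ∀ᵐ a ∂P, 0 ≤ φ a) (hen : ∫ a, b a * φ a ^ 2 ∂P ≤ ∫ a, b a ∂P)
    (hsq : ∫ a, φ a ^ 2 ∂P ≤ 2 + 2 / l) :
    ∫ a, ((1 + (σ a : ℝ)) ^ 3)⁻¹ * φ a ^ 2 ∂P ≤ Real.pi * 44 := by
  have hμ : (0 : ℝ) < 2 + l := by linarith
  have hAb := h.bddMeas_stepOp hb hφb
  have hprim : ∀ a x, IsPrimitive (fun s => φ (θ s x a))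
      (fun s => (2 + l) * φ (θ s x a) - l - stepOp θ b φ (θ s x a)) := fun a x => by
    have e : (fun s => φ (θ s x a)) = fun s => l / (2 + l)
      + timeResolvent θ (2 + l) (stepOp θ b φ) (θ s x a) := funext fun s => hfix _
    rw [e]
    refine ((h.isPrimitive_resolvent_path hμ hAb x a).const_add (l / (2 + l))).congr fun t => ?_
    rw [hfix (θ t x a), mul_add, mul_div_cancel₀ _ hμ.ne']; ring
  set D : Ω → ℝ := fun a => 36 * (b a * φ a ^ 2) + 2 * l ^ 2 * φ a ^ 2 with hD
  have hφφ : IsBddMeas (fun a => φ a ^ 2) := by simpa only [sq] using hφb.mul hφb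
  have hbφφ := hb.bddMeas.mul hφφ
  have hDb : IsBddMeas D := (hbφφ.const_mul 36).add (hφφ.const_mul (2 * l ^ 2))
  have hD0 : ∀ a, 0 ≤ D a := fun a => by
    have := hb.nonneg a
    positivity
  have hint : ∀ a, Integrable (fun s : ℝ => (1 + s ^ 2)⁻¹ * D (θ s 0 a)) := fun a => by
    obtain ⟨C, hC⟩ := hDb.2
    exact integrable_inv_one_add_sq.mul_bdd
      (hDb.1.comp (h.measurable_path 0 a)).aestronglyMeasurable (.of_forall fun _ => hC _)
  -- for `|s| ≤ σ`, both `(1 + σ)⁻³` and `σ (1 + σ)⁻³` are at most `(1 + s²)⁻¹`; this replaces the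
  -- random interval `[-σ, 0]` by a deterministic weight, to which stationarity applies
  have hpt : ∀ᵐ a ∂P, ((1 + (σ a : ℝ)) ^ 3)⁻¹ * φ a ^ 2
      ≤ ∫ s, (1 + s ^ 2)⁻¹ * D (θ s 0 a) := by
    filter_upwards [hσb, h.ae_nonneg_path (fun a x => (hprim a x).continuous) hpos]
      with a ⟨hB1, hB2⟩ hnn
    have hS : (0 : ℝ) ≤ σ a := Nat.cast_nonneg _
    have hcomp : ∀ s y, 0 ≤ φ (θ 0 y (θ s 0 a)) := fun s y => by rw [h.comp]; exact hnn _ _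
    have h1 := sq_le_integral_of_deriv_le (β := fun t => b (θ t 0 a)) (hprim a 0) (fun t => hnn t 0)
      (hb.meas.comp (h.measurable_path 0 a)) (fun t => hb.nonneg _) (fun t => hb.le_one _) hl.le
      (fun t => ?_) hS hB1 hB2
    · rw [h.zero] at h1
      refine (mul_le_mul_of_nonneg_left h1 (by positivity)).trans ?_
      rw [← intervalIntegral.integral_const_mul, intervalIntegral.integral_of_le (by linarith)]
      refine le_trans (setIntegral_mono_on ?_ (hint a).integrableOn measurableSet_Ioc
        fun s hs => ?_) (setIntegral_le_integral (hint a) (.of_forall fun s => ?_))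
      · refine (intervalIntegrable_iff_integrableOn_Ioc_of_le (by linarith)).mp ?_
        apply LocallyIntegrable.intervalIntegrable_real
        have hb2 := (((hbφφ.const_mul 36).add (hφφ.const_mul (2 * l ^ 2 * σ a)))).const_mul
          (((1 + (σ a : ℝ)) ^ 3)⁻¹)
        obtain ⟨C, hC⟩ := hb2.2
        exact locallyIntegrable_of_bounded (hb2.1.comp (h.measurable_path 0 a)) fun t => hC _
      · have hs2 : s ^ 2 ≤ (σ a : ℝ) ^ 2 := by
          nlinarith [hs.1, hs.2]
        have hw1 : ((1 + (σ a : ℝ)) ^ 3)⁻¹ ≤ (1 + s ^ 2)⁻¹ :=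
          inv_anti₀ (by positivity) (by nlinarith [mul_nonneg hS hS, mul_nonneg hS (mul_nonneg hS hS)])
        have hw2 : ((1 + (σ a : ℝ)) ^ 3)⁻¹ * (σ a : ℝ) ≤ (1 + s ^ 2)⁻¹ := by
          rw [inv_mul_eq_div, div_le_iff₀ (by positivity), inv_eq_one_div (1 + s ^ 2),
            one_div_mul_eq_div, le_div_iff₀ (by positivity)]
          nlinarith [mul_nonneg hS hS, mul_nonneg hS (mul_nonneg hS hS)]
        have p1 : 0 ≤ 36 * (b (θ s 0 a) * φ (θ s 0 a) ^ 2) := by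
          have := hb.nonneg (θ s 0 a)
          positivity
        have p2 : 0 ≤ 2 * l ^ 2 * φ (θ s 0 a) ^ 2 := by positivity
        have := mul_le_mul_of_nonneg_right hw1 p1
        have := mul_le_mul_of_nonneg_right hw2 p2
        simp only [hD]
        nlinarith
      · exact mul_nonneg (by positivity) (hD0 _)
    · have h2 := mul_nonneg (hb.nonneg (θ 0 1 (θ t 0 a))) (hcomp t 1)
      have h3 := mul_nonneg (hb.nonneg (θ 0 (-1) (θ t 0 a))) (hcomp t (-1))
      simp only [stepOp]
      nlinarith
  have hjoint : Integrable (fun q : Ω × ℝ => (1 + q.2 ^ 2)⁻¹ * D (θ q.2 0 q.1))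
      (P.prod volume) := by
    obtain ⟨C, hC⟩ := hDb.2
    exact (integrable_inv_one_add_sq.comp_snd P).mul_bdd
      (hDb.1.comp ((h.measurable_joint 0).comp measurable_swap)).aestronglyMeasurable
      (.of_forall fun q => hC _)
  have hw : IsBddMeas (fun a => ((1 + (σ a : ℝ)) ^ 3)⁻¹) := by
    refine ⟨by fun_prop, 1, fun a => ?_⟩
    have hS : (0 : ℝ) ≤ σ a := Nat.cast_nonneg _
    rw [abs_of_nonneg (by positivity)]
    exact inv_le_one_of_one_le₀ (one_le_pow₀ (by linarith))
  refine (integral_mono_ae (hw.mul hφφ).integrable hjoint.integral_prod_left hpt).trans ?_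
  rw [integral_integral_swap hjoint]
  simp only [integral_const_mul, h.integral_comp hDb.1]
  rw [integral_mul_const, integral_univ_inv_one_add_sq]
  refine mul_le_mul_of_nonneg_left ?_ Real.pi_pos.le
  simp only [hD]
  rw [(hbφφ.const_mul 36).integral_add (hφφ.const_mul _), integral_const_mul, integral_const_mul]
  have hb1 : ∫ a, b a ∂P ≤ 1 := by
    simpa using integral_mono (hb.bddMeas.integrable (P := P)) (integrable_const 1) hb.le_one
  have : 2 * l ^ 2 * ∫ a, φ a ^ 2 ∂P ≤ 2 * l ^ 2 * (2 + 2 / l) :=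
    mul_le_mul_of_nonneg_left hsq (by positivity)
  have h5 : 2 * l ^ 2 * (2 + 2 / l) = 4 * l ^ 2 + 4 * l := by field_simp; ring
  nlinarith

end Weight

/-! ### Accumulation times -/

section Accumulation

variable {Ω : Type*} [MeasurableSpace Ω] {θ : ℝ → ℤ → Ω → Ω} {P : Measure Ω} {b : Ω → ℝ}

/-- The event that the rate at the origin accumulates less than `1` over `[0, n]`. -/
def shortfall (θ : ℝ → ℤ → Ω → Ω) (b : Ω → ℝ) (n : ℕ) : Set Ω :=
  {a | ∫ s in (0 : ℝ)..n, b (θ s 0 a) < 1}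

/-- `E[(1 + N)³] < ∞` for the number `N` of integer times before the rate at the origin has
accumulated a unit of mass, in the form in which it is used. -/
def HasCubicAccumulation (θ : ℝ → ℤ → Ω → Ω) (b : Ω → ℝ) (P : Measure Ω) : Prop :=
  ∑' n : ℕ, ((n : ℝ≥0∞) + 1) ^ 2 * P (shortfall θ b n) < ⊤

theorem IsFlow.locallyIntegrable_path (h : IsFlow θ P) {f : Ω → ℝ} (hf : IsBddMeas f) (x : ℤ)
    (a : Ω) : LocallyIntegrable (fun s => f (θ s x a)) volume := by
  obtain ⟨C, hC⟩ := hf.2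
  exact locallyIntegrable_of_bounded (hf.1.comp (h.measurable_path x a)) fun _ => hC _

theorem IsFlow.measurable_integral_path (h : IsFlow θ P) {f : Ω → ℝ} (hf : Measurable f) (x : ℤ)
    (s t : ℝ) : Measurable fun a => ∫ r in s..t, f (θ r x a) := by
  have hm : StronglyMeasurable fun q : ℝ × Ω => f (θ q.1 x q.2) :=
    (hf.comp (h.measurable_joint x)).stronglyMeasurable
  simp only [intervalIntegral]
  exact (hm.integral_prod_left').measurable.sub (hm.integral_prod_left').measurable

theorem IsFlow.integral_path_comp (h : IsFlow θ P) (f : Ω → ℝ) (x : ℤ) (u s t : ℝ) (y : ℤ)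
    (a : Ω) : ∫ r in s..t, f (θ r x (θ u y a)) = ∫ r in (s + u)..(t + u), f (θ r (x + y) a) := by
  rw [← intervalIntegral.integral_comp_add_right]
  simp only [h.comp]

theorem IsFlow.measurableSet_shortfall (h : IsFlow θ P) (hb : IsRate b) (n : ℕ) :
    MeasurableSet (shortfall θ b n) :=
  measurableSet_lt (h.measurable_integral_path hb.meas 0 _ _) measurable_const

theorem IsFlow.measure_past_shortfall (h : IsFlow θ P) (hb : IsRate b) (n : ℕ) :
    P {a | ∫ s in (-(n : ℝ))..0, b (θ s 0 a) < 1} = P (shortfall θ b n) := by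
  rw [← (h.measurePreserving (-n) 0).measure_preimage
    (h.measurableSet_shortfall hb n).nullMeasurableSet]
  congr 1; ext a
  simp [shortfall, h.integral_path_comp b 0 (-n) 0 n 0 a]

theorem HasCubicAccumulation.tendsto (hT : HasCubicAccumulation θ b P) :
    Tendsto (fun n => P (shortfall θ b n)) atTop (𝓝 0) := by
  refine tendsto_of_tendsto_of_tendsto_of_le_of_le tendsto_const_nhds
    (ENNReal.tendsto_atTop_zero_of_tsum_ne_top hT.ne) (fun _ => zero_le) fun n => ?_
  have : (1 : ℝ≥0∞) ≤ ((n : ℝ≥0∞) + 1) ^ 2 := one_le_pow₀ (by simp)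
  simpa using mul_le_mul_left this (P (shortfall θ b n))

/-- The rate accumulates a unit of mass at every site, after every integer time. -/
theorem IsFlow.ae_exists_accumulation (h : IsFlow θ P)
    (hT : HasCubicAccumulation θ b P) :
    ∀ᵐ a ∂P, ∀ (m : ℤ) (x : ℤ), ∃ n : ℕ, 1 ≤ ∫ s in (m : ℝ)..(m + n), b (θ s x a) := by
  have h0 : ∀ᵐ a ∂P, ∃ n : ℕ, a ∉ shortfall θ b n := by
    have : P (⋂ n, shortfall θ b n) = 0 := by
      refine le_antisymm (ge_of_tendsto' hT.tendsto fun n => ?_) zero_le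
      exact measure_mono (iInter_subset _ n)
    filter_upwards [measure_eq_zero_iff_ae_notMem.mp this] with a ha
    simpa using ha
  have h1 : ∀ᵐ a ∂P, ∀ (m : ℤ) (x : ℤ), ∃ n : ℕ, θ m x a ∉ shortfall θ b n :=
    ae_all_iff.mpr fun m => ae_all_iff.mpr fun x => h.ae_comp h0 m x
  filter_upwards [h1] with a ha m x
  obtain ⟨n, hn⟩ := ha m x
  refine ⟨n, ?_⟩
  have := not_lt.mp (show ¬ (∫ s in (0 : ℝ)..n, b (θ s 0 (θ m x a)) < 1) from hn)
  rwa [h.integral_path_comp, zero_add, zero_add, add_comm] at this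

theorem one_add_pow_three_le (m : ℕ) :
    (1 + (m : ℝ≥0∞)) ^ 3 ≤ 1 + 7 * ∑ n ∈ Finset.range m, ((n : ℝ≥0∞) + 1) ^ 2 := by
  have : (1 + m) ^ 3 ≤ 1 + 7 * ∑ n ∈ Finset.range m, (n + 1) ^ 2 := by
    induction m with
    | zero => simp
    | succ m ih =>
      have e : (1 + (m + 1)) ^ 3 = (1 + m) ^ 3 + (3 * m ^ 2 + 9 * m + 7) := by ring
      rw [Finset.sum_range_succ, e]
      nlinarith [Nat.zero_le (m ^ 2)]
  exact_mod_cast this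

/-- The past accumulation time of the rate at the origin, and its third moment. -/
theorem IsFlow.exists_accumulationTime (h : IsFlow θ P) [IsProbabilityMeasure P] (hb : IsRate b)
    (hT : HasCubicAccumulation θ b P) :
    ∃ σ : Ω → ℕ, Measurable σ ∧
      (∀ᵐ a ∂P, 1 ≤ ∫ s in (-(σ a : ℝ))..0, b (θ s 0 a) ∧
        ∫ s in (-(σ a : ℝ))..0, b (θ s 0 a) ≤ 2) ∧
      Integrable (fun a => (1 + (σ a : ℝ)) ^ 3) P := by
  classical
  set c : ℕ → Ω → ℝ := fun n a => ∫ s in (-(n : ℝ))..0, b (θ s 0 a) with hc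
  have hcm : ∀ n, Measurable (c n) := fun n => h.measurable_integral_path hb.meas 0 _ _
  have hEm : ∀ n, MeasurableSet {a | c n a < 1} := fun n =>
    measurableSet_lt (hcm n) measurable_const
  -- where a unit of mass is never accumulated, which is a null set, `σ = 0`
  have hex : ∀ a, ∃ n, 1 ≤ c n a ∨ ∀ k, c k a < 1 := fun a => by
    by_cases hk : ∀ k, c k a < 1
    · exact ⟨0, Or.inr hk⟩
    · push Not at hk
      exact hk.imp fun n hn => Or.inl hn
  set σ : Ω → ℕ := fun a => Nat.find (hex a) with hσ
  have hσm : Measurable σ := by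
    refine measurable_find hex fun n => ?_
    have : {a | 1 ≤ c n a ∨ ∀ k, c k a < 1} = {a | c n a < 1}ᶜ ∪ ⋂ k, {a | c k a < 1} := by
      ext a; simp
    rw [this]
    exact (hEm n).compl.union (.iInter hEm)
  have hall : ∀ᵐ a ∂P, ¬ ∀ k, c k a < 1 := by
    have : P (⋂ n, {a | c n a < 1}) = 0 := by
      refine le_antisymm (ge_of_tendsto' hT.tendsto fun n => ?_) zero_le
      rw [← h.measure_past_shortfall hb n]
      exact measure_mono (iInter_subset _ n)
    filter_upwards [measure_eq_zero_iff_ae_notMem.mp this] with a ha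
    simpa using ha
  have hlt : ∀ a n, n < σ a → c n a < 1 := fun a n hn => by
    have := Nat.find_min (hex a) hn
    push Not at this
    exact this.1
  refine ⟨σ, hσm, ?_, ?_⟩
  · filter_upwards [hall] with a ha
    have h1 : 1 ≤ c (σ a) a := (Nat.find_spec (hex a)).resolve_right ha
    refine ⟨h1, ?_⟩
    rcases hm : σ a with _ | m
    · simp
    · have h2 := hlt a m (by omega)
      have hl := h.locallyIntegrable_path hb.bddMeas 0 a
      rw [← intervalIntegral.integral_add_adjacent_intervals (b := -(m : ℝ))
        (hl.intervalIntegrable_real _ _) (hl.intervalIntegrable_real _ _)]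
      -- one more unit of time adds at most one unit of mass
      have h3 : ∫ s in (-((m + 1 : ℕ) : ℝ))..(-(m : ℝ)), b (θ s 0 a) ≤ 1 := by
        have := intervalIntegral.integral_mono_on (μ := volume) (g := fun _ => (1 : ℝ))
          (a := -((m + 1 : ℕ) : ℝ)) (b := -(m : ℝ)) (by push_cast; linarith)
          (hl.intervalIntegrable_real _ _) (by simp) fun s _ => hb.le_one _
        simpa using this
      simp only [hc] at h2
      linarith
  · have hm : Measurable fun a => (1 + (σ a : ℝ)) ^ 3 := by fun_prop
    refine ⟨hm.aestronglyMeasurable, ?_⟩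
    have hle : ∀ a, ENNReal.ofReal ((1 + (σ a : ℝ)) ^ 3)
        ≤ 1 + 7 * ∑' n : ℕ, {a | c n a < 1}.indicator (fun _ => ((n : ℝ≥0∞) + 1) ^ 2) a := by
      intro a
      have e : ENNReal.ofReal ((1 + (σ a : ℝ)) ^ 3) = (1 + (σ a : ℝ≥0∞)) ^ 3 := by
        rw [ENNReal.ofReal_pow (by positivity), ENNReal.ofReal_add zero_le_one (by positivity)]
        simp
      rw [e]
      refine (one_add_pow_three_le _).trans ?_
      gcongr
      refine le_trans (Finset.sum_le_sum fun n hn => ?_) (ENNReal.sum_le_tsum (Finset.range (σ a)))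
      rw [indicator_of_mem]
      exact hlt a n (Finset.mem_range.mp hn)
    have : ∫⁻ a, ENNReal.ofReal ((1 + (σ a : ℝ)) ^ 3) ∂P < ⊤ := by
      refine (lintegral_mono hle).trans_lt ?_
      rw [lintegral_add_left measurable_const, lintegral_const_mul, lintegral_tsum]
      · have e : ∀ n : ℕ, ∫⁻ a, {a | c n a < 1}.indicator (fun _ => ((n : ℝ≥0∞) + 1) ^ 2) a ∂P
            = ((n : ℝ≥0∞) + 1) ^ 2 * P (shortfall θ b n) := fun n => by
          rw [lintegral_indicator_const (hEm n), ← h.measure_past_shortfall hb n]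
        simp only [e, lintegral_const, measure_univ, mul_one]
        exact ENNReal.add_lt_top.mpr ⟨ENNReal.one_lt_top, ENNReal.mul_lt_top (by simp) hT⟩
      · exact fun n => (measurable_const.indicator (hEm n)).aemeasurable
      · exact .tsum fun n => measurable_const.indicator (hEm n)
    rw [hasFiniteIntegral_iff_ofReal (.of_forall fun a => by positivity)]
    exact this

end Accumulation

/-! ### Almost minimal elements of nested convex sets -/

/-- In a decreasing sequence of nonempty convex sets of a Hilbert space that all meet a fixed ball,
elements of almost minimal norm form a Cauchy sequence. -/
theorem exists_cauchySeq_of_antitone_convex {H : Type*} [NormedAddCommGroup H]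
    [InnerProductSpace ℝ H] {C : ℕ → Set H} (hC : Antitone C) (hconv : ∀ n, Convex ℝ (C n))
    {M : ℝ} (hM : ∀ n, ∃ y ∈ C n, ‖y‖ ≤ M) :
    ∃ y : ℕ → H, (∀ n, y n ∈ C n) ∧ CauchySeq y := by
  set d : ℕ → ℝ := fun n => sInf ((fun y => ‖y‖ ^ 2) '' C n) with hd
  have hbdd : ∀ n, BddBelow ((fun y => ‖y‖ ^ 2) '' C n) := fun n =>
    ⟨0, by rintro _ ⟨y, _, rfl⟩; positivity⟩
  have hne : ∀ n, ((fun y => ‖y‖ ^ 2) '' C n).Nonempty := fun n =>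
    (hM n).elim fun y hy => ⟨_, mem_image_of_mem _ hy.1⟩
  have hdm : Monotone d := fun m n hmn => csInf_le_csInf (hbdd m) (hne n) (image_mono (hC hmn))
  have hdM : ∀ n, d n ≤ M ^ 2 := fun n => by
    obtain ⟨y, hy, hyM⟩ := hM n
    exact (csInf_le (hbdd n) (mem_image_of_mem _ hy)).trans
      (pow_le_pow_left₀ (norm_nonneg _) hyM 2)
  have hcv : ∃ L, Tendsto d atTop (𝓝 L) :=
    ⟨_, tendsto_atTop_ciSup hdm ⟨M ^ 2, by rintro _ ⟨n, rfl⟩; exact hdM n⟩⟩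
  obtain ⟨L, hL⟩ := hcv
  have hdL : ∀ n, d n ≤ L := fun n => hdm.ge_of_tendsto hL n
  have hch : ∀ n : ℕ, ∃ y ∈ C n, ‖y‖ ^ 2 < d n + 1 / (n + 1) := fun n => by
    obtain ⟨_, ⟨y, hy, rfl⟩, hlt⟩ := exists_lt_of_csInf_lt (hne n)
      (show d n < d n + 1 / ((n : ℝ) + 1) by linarith [Nat.one_div_pos_of_nat (α := ℝ) (n := n)])
    exact ⟨y, hy, hlt⟩
  choose y hyC hy using hch
  refine ⟨y, hyC, ?_⟩
  have key : ∀ N m, N ≤ m → ‖y N - y m‖ ^ 2 ≤ 4 * (L - d N) + 4 * (1 / ((N : ℝ) + 1)) := by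
    intro N m hNm
    -- the parallelogram law, with the midpoint in the larger set `C N`
    have hmid : (1 / 2 : ℝ) • y N + (1 / 2 : ℝ) • y m ∈ C N :=
      hconv N (hyC N) (hC hNm (hyC m)) (by norm_num) (by norm_num) (by norm_num)
    have h1 : d N ≤ ‖(1 / 2 : ℝ) • y N + (1 / 2 : ℝ) • y m‖ ^ 2 :=
      csInf_le (hbdd N) (mem_image_of_mem _ hmid)
    rw [← smul_add, norm_smul, mul_pow] at h1
    have h2 := parallelogram_law_with_norm ℝ (y N) (y m)
    have h3 : (1 : ℝ) / (m + 1) ≤ 1 / (N + 1) := by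
      apply one_div_le_one_div_of_le <;> norm_cast <;> omega
    have h4 := hy N
    have h5 := hy m
    have h6 := hdL m
    have h7 := hdL N
    norm_num at h1
    nlinarith
  refine Metric.cauchySeq_iff'.mpr fun ε hε => ?_
  have hlim : Tendsto (fun N : ℕ => 4 * (L - d N) + 4 * (1 / ((N : ℝ) + 1))) atTop (𝓝 0) := by
    have := ((hL.const_sub L).const_mul 4).add
      ((tendsto_one_div_add_atTop_nhds_zero_nat (𝕜 := ℝ)).const_mul 4)
    simpa using this
  obtain ⟨N, hN⟩ := (hlim.eventually (gt_mem_nhds (show 0 < ε ^ 2 by positivity))).exists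
  refine ⟨N, fun n hn => ?_⟩
  rw [dist_eq_norm, norm_sub_rev]
  exact lt_of_pow_lt_pow_left₀ 2 hε.le ((key N n hn).trans_lt hN)

/-! ### Passing to the limit: the invariant density -/

section InvariantDensity

variable {Ω : Type*} [MeasurableSpace Ω] {θ : ℝ → ℤ → Ω → Ω} {P : Measure Ω} {b : Ω → ℝ}

/-- The operator `stepOp` on functions with values in `[0, ∞]`. -/
def estepOp (θ : ℝ → ℤ → Ω → Ω) (b : Ω → ℝ) (f : Ω → ℝ≥0∞) (a : Ω) : ℝ≥0∞ :=
  2 * ENNReal.ofReal (1 - b a) * f a + ENNReal.ofReal (b (θ 0 1 a)) * f (θ 0 1 a)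
    + ENNReal.ofReal (b (θ 0 (-1) a)) * f (θ 0 (-1) a)

/-- The resolvent `timeResolvent` on functions with values in `[0, ∞]`. -/
def etimeResolvent (θ : ℝ → ℤ → Ω → Ω) (μ : ℝ) (f : Ω → ℝ≥0∞) (a : Ω) : ℝ≥0∞ :=
  ∫⁻ r in Ioi (0 : ℝ), ENNReal.ofReal (Real.exp (-(μ * r))) * f (θ r 0 a)

theorem lintegral_exp_Ioi {μ : ℝ} (hμ : 0 < μ) :
    ∫⁻ r in Ioi (0 : ℝ), ENNReal.ofReal (Real.exp (-(μ * r))) = ENNReal.ofReal (1 / μ) := by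
  have he : IntegrableOn (fun r => Real.exp (-(μ * r))) (Ioi 0) := by
    simpa using integrableOn_exp_mul_Ioi (neg_neg_of_pos hμ) 0
  rw [← IsFlow.integral_exp_Ioi hμ,
    ofReal_integral_eq_lintegral_ofReal he (.of_forall fun _ => Real.exp_nonneg _)]

variable {f g : Ω → ℝ≥0∞} {μ : ℝ}

theorem IsFlow.measurable_estepOp (h : IsFlow θ P) (hb : IsRate b) (hf : Measurable f) :
    Measurable (estepOp θ b f) := by
  have hb0 := hb.meas
  have h1 := h.measurable_map 0 1
  have h2 := h.measurable_map 0 (-1)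
  unfold estepOp
  fun_prop

theorem IsFlow.measurable_etimeResolvent (h : IsFlow θ P) (hf : Measurable f) :
    Measurable (etimeResolvent θ μ f) := by
  have : Measurable (fun q : Ω × ℝ => ENNReal.ofReal (Real.exp (-(μ * q.2))) * f (θ q.2 0 q.1)) :=
    Measurable.mul (by fun_prop) (hf.comp ((h.measurable_joint 0).comp measurable_swap))
  exact this.lintegral_prod_right'

theorem IsFlow.lintegral_estepOp (h : IsFlow θ P) (hb : IsRate b) (hf : Measurable f) :
    ∫⁻ a, estepOp θ b f a ∂P = 2 * ∫⁻ a, f a ∂P := by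
  have hb0 := hb.meas
  have h1 := h.measurable_map 0 1
  have h2 := h.measurable_map 0 (-1)
  have hbf : Measurable fun a => ENNReal.ofReal (b a) * f a := by fun_prop
  simp only [estepOp, mul_assoc]
  rw [lintegral_add_left (by fun_prop), lintegral_add_left (by fun_prop),
    h.lintegral_comp hbf 0 1, h.lintegral_comp hbf 0 (-1),
    lintegral_const_mul _ (by fun_prop), add_assoc, ← two_mul, ← mul_add,
    ← lintegral_add_left (by fun_prop)]
  congr 2; ext a
  rw [← add_mul, ← ENNReal.ofReal_add (by linarith [hb.le_one a]) (hb.nonneg a)]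
  simp

theorem IsFlow.lintegral_etimeResolvent (h : IsFlow θ P) [SFinite P] (hμ : 0 < μ)
    (hf : Measurable f) :
    ∫⁻ a, etimeResolvent θ μ f a ∂P = ENNReal.ofReal (1 / μ) * ∫⁻ a, f a ∂P := by
  have : Measurable (fun q : Ω × ℝ => ENNReal.ofReal (Real.exp (-(μ * q.2))) * f (θ q.2 0 q.1)) :=
    Measurable.mul (by fun_prop) (hf.comp ((h.measurable_joint 0).comp measurable_swap))
  simp only [etimeResolvent]
  rw [lintegral_lintegral_swap this.aemeasurable]
  have e : ∀ r : ℝ, ∫⁻ a, ENNReal.ofReal (Real.exp (-(μ * r))) * f (θ r 0 a) ∂P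
      = ENNReal.ofReal (Real.exp (-(μ * r))) * ∫⁻ a, f a ∂P := fun r => by
    have hm : Measurable fun a => f (θ r 0 a) := hf.comp (h.measurable_map r 0)
    rw [lintegral_const_mul _ hm, h.lintegral_comp hf]
  simp only [e]
  rw [lintegral_mul_const _ (by fun_prop), lintegral_exp_Ioi hμ]

omit [MeasurableSpace Ω] in
theorem estepOp_add_smul (c d : ℝ≥0∞) (a : Ω) :
    estepOp θ b (fun a => c * f a + d * g a) a = c * estepOp θ b f a + d * estepOp θ b g a := by
  simp only [estepOp]; ring

theorem IsFlow.etimeResolvent_add_smul (h : IsFlow θ P) (hf : Measurable f) (hg : Measurable g)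
    (c d : ℝ≥0∞) (a : Ω) : etimeResolvent θ μ (fun a => c * f a + d * g a) a
      = c * etimeResolvent θ μ f a + d * etimeResolvent θ μ g a := by
  have hθ := h.measurable_path 0 a
  simp only [etimeResolvent]
  rw [← lintegral_const_mul _ (by fun_prop), ← lintegral_const_mul _ (by fun_prop),
    ← lintegral_add_left (by fun_prop)]
  congr 1; ext r; ring

omit [MeasurableSpace Ω] in
theorem etimeResolvent_anti {μ μ' : ℝ} (hμ : μ ≤ μ') (f : Ω → ℝ≥0∞) (a : Ω) :
    etimeResolvent θ μ' f a ≤ etimeResolvent θ μ f a := by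
  refine setLIntegral_mono' measurableSet_Ioi fun r hr => ?_
  gcongr
  exact (mem_Ioi.mp hr).le

/-- The constraints defining the approximate invariant densities. They are convex, and are
satisfied by the gradients of the massive correctors. -/
structure IsAlmostInvariant (θ : ℝ → ℤ → Ω → Ω) (P : Measure Ω) (b : Ω → ℝ) (μ : ℝ)
    (f : Ω → ℝ≥0) : Prop where
  meas : Measurable f
  mass : ∫⁻ a, f a ∂P = 1
  energy : ∫⁻ a, ENNReal.ofReal (b a) * (f a : ℝ≥0∞) ^ 2 ∂P ≤ ∫⁻ a, ENNReal.ofReal (b a) ∂P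
  excessive : ∀ᵐ a ∂P, etimeResolvent θ μ (estepOp θ b fun a => f a) a ≤ f a

theorem ennreal_convex_sq {c d : ℝ≥0} (hcd : c + d = 1) (x y : ℝ≥0) :
    ((c * x + d * y : ℝ≥0) : ℝ≥0∞) ^ 2 ≤ c * (x : ℝ≥0∞) ^ 2 + d * (y : ℝ≥0∞) ^ 2 := by
  have h : (c * x + d * y) ^ 2 ≤ c * x ^ 2 + d * y ^ 2 := by
    have h1 : (c : ℝ) + d = 1 := by exact_mod_cast hcd
    have h2 : (d : ℝ) = 1 - c := by linarith
    have h3 : (0 : ℝ) ≤ 1 - c := h2 ▸ NNReal.coe_nonneg d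
    rw [← NNReal.coe_le_coe]
    push_cast
    rw [h2]
    nlinarith [mul_nonneg (mul_nonneg (NNReal.coe_nonneg c) h3) (sq_nonneg ((x : ℝ) - y))]
  exact_mod_cast h

theorem IsFlow.isAlmostInvariant_convex (h : IsFlow θ P) (hb : IsRate b) {f g : Ω → ℝ≥0}
    (hf : IsAlmostInvariant θ P b μ f) (hg : IsAlmostInvariant θ P b μ g) {c d : ℝ≥0}
    (hcd : c + d = 1) : IsAlmostInvariant θ P b μ (fun a => c * f a + d * g a) := by
  have hfm := hf.meas
  have hgm := hg.meas
  have hbm := hb.meas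
  have hcd' : (c : ℝ≥0∞) + d = 1 := by exact_mod_cast hcd
  refine ⟨by fun_prop, ?_, ?_, ?_⟩
  · push_cast
    rw [lintegral_add_left (by fun_prop), lintegral_const_mul _ (by fun_prop),
      lintegral_const_mul _ (by fun_prop), hf.mass, hg.mass, mul_one, mul_one, hcd']
  · calc ∫⁻ a, ENNReal.ofReal (b a) * ((c * f a + d * g a : ℝ≥0) : ℝ≥0∞) ^ 2 ∂P
        ≤ ∫⁻ a, (c * (ENNReal.ofReal (b a) * (f a : ℝ≥0∞) ^ 2)
            + d * (ENNReal.ofReal (b a) * (g a : ℝ≥0∞) ^ 2)) ∂P := by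
          refine lintegral_mono fun a => ?_
          refine (mul_le_mul_right (ennreal_convex_sq hcd _ _) _).trans_eq ?_
          ring
      _ ≤ c * ∫⁻ a, ENNReal.ofReal (b a) ∂P + d * ∫⁻ a, ENNReal.ofReal (b a) ∂P := by
          rw [lintegral_add_left (by fun_prop), lintegral_const_mul _ (by fun_prop),
            lintegral_const_mul _ (by fun_prop)]
          exact add_le_add (mul_le_mul' le_rfl hf.energy) (mul_le_mul' le_rfl hg.energy)
      _ = _ := by rw [← add_mul, hcd', one_mul]
  · filter_upwards [hf.excessive, hg.excessive] with a h1 h2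
    have e1 : (fun a => ((c * f a + d * g a : ℝ≥0) : ℝ≥0∞))
        = fun a => (c : ℝ≥0∞) * (f a : ℝ≥0∞) + d * (g a : ℝ≥0∞) := by ext a; push_cast; rfl
    have e2 := funext (estepOp_add_smul (θ := θ) (b := b) (f := fun a => (f a : ℝ≥0∞))
      (g := fun a => (g a : ℝ≥0∞)) c d)
    rw [e1, e2, h.etimeResolvent_add_smul (h.measurable_estepOp hb (by fun_prop))
      (h.measurable_estepOp hb (by fun_prop))]
    push_cast
    gcongr

theorem IsAlmostInvariant.mono {μ μ' : ℝ} (hμ : μ ≤ μ') {f : Ω → ℝ≥0}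
    (hf : IsAlmostInvariant θ P b μ f) : IsAlmostInvariant θ P b μ' f :=
  ⟨hf.meas, hf.mass, hf.energy,
    hf.excessive.mono fun a ha => (etimeResolvent_anti hμ _ a).trans ha⟩

/-- For functions that are nonnegative on the orbit, `stepOp` and `estepOp` agree. -/
theorem ofReal_stepOp {φ : Ω → ℝ} (hb : IsRate b) {a : Ω}
    (h0 : 0 ≤ φ a) (h1 : 0 ≤ φ (θ 0 1 a)) (h2 : 0 ≤ φ (θ 0 (-1) a)) :
    ENNReal.ofReal (stepOp θ b φ a) = estepOp θ b (fun a => ENNReal.ofReal (φ a)) a := by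
  have hb0 := hb.nonneg (θ 0 1 a)
  have hb1 := hb.nonneg (θ 0 (-1) a)
  have hb2 : 0 ≤ 1 - b a := by linarith [hb.le_one a]
  rw [stepOp, estepOp, ENNReal.ofReal_add (by positivity) (by positivity),
    ENNReal.ofReal_add (by positivity) (by positivity), ENNReal.ofReal_mul (by positivity),
    ENNReal.ofReal_mul zero_le_two, ENNReal.ofReal_mul hb0, ENNReal.ofReal_mul hb1]
  simp

theorem stepOp_nonneg {φ : Ω → ℝ} (hb : IsRate b) {a : Ω}
    (h0 : 0 ≤ φ a) (h1 : 0 ≤ φ (θ 0 1 a)) (h2 : 0 ≤ φ (θ 0 (-1) a)) : 0 ≤ stepOp θ b φ a := by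
  have hb0 := hb.nonneg (θ 0 1 a)
  have hb1 := hb.nonneg (θ 0 (-1) a)
  have hb2 : 0 ≤ 1 - b a := by linarith [hb.le_one a]
  unfold stepOp
  positivity

theorem IsFlow.exists_isAlmostInvariant (h : IsFlow θ P) [IsProbabilityMeasure P] (hb : IsRate b)
    {σ : Ω → ℕ} (hσ : Measurable σ)
    (hσb : ∀ᵐ a ∂P, 1 ≤ ∫ s in (-(σ a : ℝ))..0, b (θ s 0 a) ∧
      ∫ s in (-(σ a : ℝ))..0, b (θ s 0 a) ≤ 2)
    {l : ℝ} (hl : 0 < l) (hl1 : l ≤ 1) :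
    ∃ f : Ω → ℝ≥0, IsAlmostInvariant θ P b (2 + l) f ∧
      Integrable (fun a => ((1 + (σ a : ℝ)) ^ 3)⁻¹ * (f a : ℝ) ^ 2) P ∧
      ∫ a, ((1 + (σ a : ℝ)) ^ 3)⁻¹ * (f a : ℝ) ^ 2 ∂P ≤ Real.pi * 44 := by
  obtain ⟨φ, hφb, hfix, hone, hpos, hen, hsq⟩ := h.exists_approxDensity (P := P) hb hl
  have hμ : (0 : ℝ) < 2 + l := by linarith
  have hAb := h.bddMeas_stepOp hb hφb
  have hcoe : ∀ᵐ a ∂P, ((φ a).toNNReal : ℝ) = φ a :=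
    hpos.mono fun a ha => Real.coe_toNNReal _ ha
  have hc : ∀ a x, Continuous fun t => φ (θ t x a) := fun a x => by
    have := ((h.isPrimitive_resolvent_path hμ hAb x a).const_add (l / (2 + l))).continuous
    simpa only [← hfix] using this
  have hφφ : IsBddMeas (fun a => φ a ^ 2) := by simpa only [sq] using hφb.mul hφb
  refine ⟨fun a => (φ a).toNNReal, ⟨hφb.1.real_toNNReal, ?_, ?_, ?_⟩, ?_, ?_⟩
  · change ∫⁻ a, ENNReal.ofReal (φ a) ∂P = 1
    rw [← ofReal_integral_eq_lintegral_ofReal hφb.integrable hpos, hone, ENNReal.ofReal_one]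
  · have e : ∀ᵐ a ∂P, ENNReal.ofReal (b a) * ((φ a).toNNReal : ℝ≥0∞) ^ 2
        = ENNReal.ofReal (b a * φ a ^ 2) := by
      filter_upwards [hpos] with a ha
      rw [ENNReal.ofReal_mul (hb.nonneg a), ENNReal.ofReal_pow ha]; rfl
    rw [lintegral_congr_ae e, ← ofReal_integral_eq_lintegral_ofReal
      (hb.bddMeas.mul hφφ).integrable (.of_forall fun a => mul_nonneg (hb.nonneg a) (sq_nonneg _)),
      ← ofReal_integral_eq_lintegral_ofReal hb.bddMeas.integrable (.of_forall hb.nonneg)]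
    exact ENNReal.ofReal_le_ofReal hen
  · filter_upwards [h.ae_nonneg_path hc hpos] with a ha
    have hcomp : ∀ s y, 0 ≤ φ (θ 0 y (θ s 0 a)) := fun s y => by rw [h.comp]; exact ha _ _
    have hst : ∀ r, 0 ≤ stepOp θ b φ (θ r 0 a) := fun r =>
      stepOp_nonneg hb (ha r 0) (hcomp r 1) (hcomp r (-1))
    have e : etimeResolvent θ (2 + l) (estepOp θ b fun a => ((φ a).toNNReal : ℝ≥0∞)) a
        = ENNReal.ofReal (timeResolvent θ (2 + l) (stepOp θ b φ) a) := by
      rw [timeResolvent, ofReal_integral_eq_lintegral_ofReal (h.integrableOn_path hμ hAb 0 a 0)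
        (.of_forall fun r => mul_nonneg (Real.exp_nonneg _) (hst r))]
      refine lintegral_congr fun r => ?_
      rw [ENNReal.ofReal_mul (Real.exp_nonneg _),
        ofReal_stepOp hb (ha r 0) (hcomp r 1) (hcomp r (-1))]
      rfl
    rw [e]
    refine ENNReal.ofReal_le_ofReal ?_
    rw [hfix a]
    have : 0 ≤ l / (2 + l) := by positivity
    linarith
  · have hw : IsBddMeas (fun a => ((1 + (σ a : ℝ)) ^ 3)⁻¹) := by
      refine ⟨by fun_prop, 1, fun a => ?_⟩
      have hS : (0 : ℝ) ≤ σ a := Nat.cast_nonneg _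
      rw [abs_of_nonneg (by positivity)]
      exact inv_le_one_of_one_le₀ (one_le_pow₀ (by linarith))
    refine (hw.mul hφφ).integrable.congr ?_
    filter_upwards [hcoe] with a ha
    rw [ha]
  · refine le_trans (le_of_eq (integral_congr_ae ?_))
      (h.integral_weight_mul_sq_le hb hσ hσb hl hl1 hφb hfix hpos hen hsq)
    filter_upwards [hcoe] with a ha
    rw [ha]

/-- Almost invariance passes to almost everywhere limits (Fatou), once no mass is lost. -/
theorem IsFlow.isAlmostInvariant_of_tendsto (h : IsFlow θ P) [SFinite P] (hb : IsRate b)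
    {μ : ℕ → ℝ} {μ₀ : ℝ} (hμ : Tendsto μ atTop (𝓝 μ₀)) {f : ℕ → Ω → ℝ≥0}
    (hf : ∀ n, IsAlmostInvariant θ P b (μ n) (f n)) {F : Ω → ℝ≥0} (hFm : Measurable F)
    (hF : ∫⁻ a, F a ∂P = 1) (hlim : ∀ᵐ a ∂P, Tendsto (fun n => f n a) atTop (𝓝 (F a))) :
    IsAlmostInvariant θ P b μ₀ F := by
  have hbm := hb.meas
  have hfm := fun n => (hf n).meas
  refine ⟨hFm, hF, ?_, ?_⟩
  · have e : ∀ᵐ a ∂P, ENNReal.ofReal (b a) * (F a : ℝ≥0∞) ^ 2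
        = liminf (fun n => ENNReal.ofReal (b a) * (f n a : ℝ≥0∞) ^ 2) atTop := by
      filter_upwards [hlim] with a ha
      refine (Tendsto.liminf_eq ?_).symm
      refine ENNReal.Tendsto.const_mul ?_ (Or.inr ENNReal.ofReal_ne_top)
      exact_mod_cast (ENNReal.tendsto_coe.mpr (ha.pow 2))
    rw [lintegral_congr_ae e]
    refine (lintegral_liminf_le fun n => ?_).trans ?_
    · have := hfm n
      fun_prop
    · exact liminf_le_of_le ⟨0, .of_forall fun _ => zero_le⟩ fun c hc =>
        let ⟨n, hn⟩ := hc.exists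
        hn.trans (hf n).energy
  · have h1 : ∀ᵐ a ∂P, ∀ x, ∀ᵐ r : ℝ, Tendsto (fun n => f n (θ r x a)) atTop (𝓝 (F (θ r x a))) :=
      ae_all_iff.mpr fun x => h.ae_ae_comp hlim x
    filter_upwards [h1, hlim, ae_all_iff.mpr fun n => (hf n).excessive] with a h1 h2 h3
    have e : ∀ᵐ r ∂(volume.restrict (Ioi (0 : ℝ))),
        ENNReal.ofReal (Real.exp (-(μ₀ * r))) * estepOp θ b (fun a => (F a : ℝ≥0∞)) (θ r 0 a)
        = liminf (fun n => ENNReal.ofReal (Real.exp (-(μ n * r)))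
          * estepOp θ b (fun a => (f n a : ℝ≥0∞)) (θ r 0 a)) atTop := by
      refine ae_restrict_of_ae ?_
      filter_upwards [h1 0, h1 1, h1 (-1)] with r k0 k1 k2
      refine (Tendsto.liminf_eq ?_).symm
      have hexp : Tendsto (fun n => ENNReal.ofReal (Real.exp (-(μ n * r)))) atTop
          (𝓝 (ENNReal.ofReal (Real.exp (-(μ₀ * r))))) :=
        ENNReal.tendsto_ofReal ((Real.continuous_exp.tendsto _).comp (hμ.mul_const r).neg)
      have hco : ∀ (c : ℝ≥0∞), c ≠ ⊤ → ∀ x, Tendsto (fun n => f n (θ r x a)) atTop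
          (𝓝 (F (θ r x a))) → Tendsto (fun n => c * (f n (θ r x a) : ℝ≥0∞)) atTop
          (𝓝 (c * (F (θ r x a) : ℝ≥0∞))) := fun c hc x hx =>
        ENNReal.Tendsto.const_mul (ENNReal.tendsto_coe.mpr hx) (Or.inr hc)
      have e : ∀ G : Ω → ℝ≥0, estepOp θ b (fun a => (G a : ℝ≥0∞)) (θ r 0 a)
          = 2 * ENNReal.ofReal (1 - b (θ r 0 a)) * G (θ r 0 a)
            + ENNReal.ofReal (b (θ r 1 a)) * G (θ r 1 a)
            + ENNReal.ofReal (b (θ r (-1) a)) * G (θ r (-1) a) := fun G => by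
        simp [estepOp, h.comp]
      simp only [e]
      refine ENNReal.Tendsto.mul hexp (Or.inr ?_) (((hco _ ?_ 0 k0).add
        (hco _ ENNReal.ofReal_ne_top 1 k1)).add (hco _ ENNReal.ofReal_ne_top (-1) k2))
        (Or.inr ENNReal.ofReal_ne_top)
      · finiteness
      · finiteness
    have hF2 : Tendsto (fun n => (f n a : ℝ≥0∞)) atTop (𝓝 (F a)) := ENNReal.tendsto_coe.mpr h2
    rw [etimeResolvent, lintegral_congr_ae e, ← hF2.liminf_eq]
    refine (lintegral_liminf_le fun n => ?_).trans (liminf_le_liminf (.of_forall fun n => h3 n))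
    refine Measurable.mul (by fun_prop) ((h.measurable_estepOp hb ?_).comp (h.measurable_path 0 a))
    exact (hfm n).coe_nnreal_ennreal

/-- Existence of the invariant density: a fixed point of `R₂ A` with mass one and bounded energy. It
is a strong limit of almost invariant densities in the `L²` space with weight `(1 + σ)⁻³`. -/
theorem IsFlow.exists_invariantDensity (h : IsFlow θ P) [IsProbabilityMeasure P] (hb : IsRate b)
    (hT : HasCubicAccumulation θ b P) :
    ∃ F : Ω → ℝ≥0, IsAlmostInvariant θ P b 2 F ∧
      ∀ᵐ a ∂P, etimeResolvent θ 2 (estepOp θ b fun a => F a) a = F a := by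
  obtain ⟨σ, hσ, hσb, hσi⟩ := h.exists_accumulationTime hb hT
  -- dividing by `k` turns the weighted bound into a bound in `L²(P)`; as `k` itself is in `L²(P)`,
  -- the mass `E f = ⟪k, f / k⟫` is continuous there
  set k : Ω → ℝ := fun a => √((1 + (σ a : ℝ)) ^ 3) with hk
  have hkpos : ∀ a, 0 < k a := fun a => by
    have : (0 : ℝ) ≤ σ a := Nat.cast_nonneg _
    exact Real.sqrt_pos.mpr (by positivity)
  have hksq : ∀ a, k a ^ 2 = (1 + (σ a : ℝ)) ^ 3 := fun a => by
    have : (0 : ℝ) ≤ σ a := Nat.cast_nonneg _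
    exact Real.sq_sqrt (by positivity)
  have hkm : Measurable k := by fun_prop
  have hk2 : MemLp k 2 P := by
    rw [memLp_two_iff_integrable_sq hkm.aestronglyMeasurable]
    simpa only [hksq] using hσi
  set μ : ℕ → ℝ := fun n => 2 + 1 / ((n : ℝ) + 1) with hμ
  have hμlim : Tendsto μ atTop (𝓝 2) := by
    simpa [hμ] using (tendsto_one_div_add_atTop_nhds_zero_nat (𝕜 := ℝ)).const_add 2
  have hμanti : Antitone μ := fun n m hnm => by
    have : (1 : ℝ) / (m + 1) ≤ 1 / (n + 1) := by
      apply one_div_le_one_div_of_le <;> norm_cast <;> omega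
    simp only [hμ]; linarith
  set C : ℕ → Set (Lp ℝ 2 P) := fun n =>
    {y | ∃ f : Ω → ℝ≥0, IsAlmostInvariant θ P b (μ n) f ∧ y =ᵐ[P] fun a => (f a : ℝ) / k a} with hC
  have hCanti : Antitone C := fun n m hnm y ⟨f, hf, hy⟩ => ⟨f, hf.mono (hμanti hnm), hy⟩
  have hCconv : ∀ n, Convex ℝ (C n) := by
    rintro n y ⟨f, hf, hy⟩ z ⟨g, hg, hz⟩ c d hc hd hcd
    refine ⟨fun a => c.toNNReal * f a + d.toNNReal * g a,
      h.isAlmostInvariant_convex hb hf hg ?_, ?_⟩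
    · rw [← Real.toNNReal_add hc hd, hcd, Real.toNNReal_one]
    · filter_upwards [hy, hz, Lp.coeFn_add (c • y) (d • z), Lp.coeFn_smul c y,
        Lp.coeFn_smul d z] with a h1 h2 h3 h4 h5
      rw [h3, Pi.add_apply, h4, h5, Pi.smul_apply, Pi.smul_apply, h1, h2]
      push_cast
      rw [Real.coe_toNNReal _ hc, Real.coe_toNNReal _ hd]
      simp only [smul_eq_mul]; ring
  have hCbd : ∀ n, ∃ y ∈ C n, ‖y‖ ≤ √(Real.pi * 44) := fun n => by
    obtain ⟨f, hf, hfi, hfle⟩ := h.exists_isAlmostInvariant hb hσ hσb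
      (l := 1 / ((n : ℝ) + 1)) (by positivity) (by
        rw [div_le_one (by positivity)]; linarith [Nat.cast_nonneg (α := ℝ) n])
    have e : ∀ a, ((f a : ℝ) / k a) ^ 2 = ((1 + (σ a : ℝ)) ^ 3)⁻¹ * (f a : ℝ) ^ 2 := fun a => by
      rw [div_pow, hksq]; field_simp
    have hfm := hf.meas
    have hm : MemLp (fun a => (f a : ℝ) / k a) 2 P := by
      have hd : Measurable fun a => (f a : ℝ) / k a := hfm.coe_nnreal_real.div hkm
      rw [memLp_two_iff_integrable_sq hd.aestronglyMeasurable]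
      simpa only [e] using hfi
    refine ⟨hm.toLp _, ⟨f, hf, hm.coeFn_toLp⟩, ?_⟩
    rw [← Real.sqrt_sq (norm_nonneg _)]
    refine Real.sqrt_le_sqrt ?_
    rw [← real_inner_self_eq_norm_sq, L2.inner_def]
    refine le_trans (le_of_eq (integral_congr_ae ?_)) hfle
    filter_upwards [hm.coeFn_toLp] with a ha
    rw [ha, ← e a, real_inner_self_eq_norm_sq, Real.norm_eq_abs, sq_abs]
  obtain ⟨y, hyC, hyc⟩ := exists_cauchySeq_of_antitone_convex hCanti hCconv hCbd
  obtain ⟨ψ, hψ⟩ := cauchySeq_tendsto_of_complete hyc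
  choose f hf hfy using hyC
  have hmassf : ∀ n, inner ℝ (hk2.toLp k) (y n) = 1 := fun n => by
    rw [L2.inner_def]
    have e : ∀ᵐ a ∂P, inner ℝ (hk2.toLp k a) (y n a) = ((f n a : ℝ≥0) : ℝ) := by
      filter_upwards [hk2.coeFn_toLp, hfy n] with a h1 h2
      rw [h1, h2]
      have := (hkpos a).ne'
      simp [inner, div_mul_cancel₀ _ this]
    rw [integral_congr_ae e, integral_eq_lintegral_of_nonneg_ae (.of_forall fun a => NNReal.coe_nonneg _)
      (hf n).meas.coe_nnreal_real.aestronglyMeasurable]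
    simp [(hf n).mass]
  have hmassψ : inner ℝ (hk2.toLp k) ψ = 1 := by
    refine tendsto_nhds_unique ((tendsto_const_nhds (x := hk2.toLp k)).inner hψ) ?_
    simp only [hmassf]
    exact tendsto_const_nhds
  obtain ⟨ns, hns, hae⟩ := (tendstoInMeasure_of_tendsto_Lp hψ).exists_seq_tendsto_ae
  set F : Ω → ℝ≥0 := fun a => (k a * ψ a).toNNReal with hF
  have hψm : Measurable ψ := (Lp.stronglyMeasurable ψ).measurable
  have hFm : Measurable F := by fun_prop
  have hlim : ∀ᵐ a ∂P, Tendsto (fun i => (f (ns i) a : ℝ)) atTop (𝓝 (k a * ψ a)) := by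
    filter_upwards [hae, ae_all_iff.mpr fun n => hfy n] with a h1 h2
    have h3 := h1.const_mul (k a)
    have e : ∀ i, k a * y (ns i) a = f (ns i) a := fun i => by
      rw [h2]; exact mul_div_cancel₀ _ (hkpos a).ne'
    simpa only [e] using h3
  have hψ0 : ∀ᵐ a ∂P, 0 ≤ k a * ψ a := by
    filter_upwards [hlim] with a ha
    exact ge_of_tendsto' ha fun i => NNReal.coe_nonneg _
  have hFmass : ∫⁻ a, F a ∂P = 1 := by
    rw [L2.inner_def] at hmassψ
    have e : ∀ᵐ a ∂P, inner ℝ (hk2.toLp k a) (ψ a) = k a * ψ a := by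
      filter_upwards [hk2.coeFn_toLp] with a h1
      rw [h1]; simp [inner, mul_comm]
    rw [integral_congr_ae e] at hmassψ
    change ∫⁻ a, ENNReal.ofReal (k a * ψ a) ∂P = 1
    rw [← ofReal_integral_eq_lintegral_ofReal _ hψ0, hmassψ, ENNReal.ofReal_one]
    by_contra hcon
    rw [integral_undef hcon] at hmassψ
    norm_num at hmassψ
  have hlimF : ∀ᵐ a ∂P, Tendsto (fun i => f (ns i) a) atTop (𝓝 (F a)) := by
    filter_upwards [hlim, hψ0] with a h1 h2
    rw [← NNReal.tendsto_coe]
    simpa only [hF, Real.coe_toNNReal _ h2] using h1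
  have hinv := h.isAlmostInvariant_of_tendsto hb (hμlim.comp hns.tendsto_atTop)
    (fun i => hf (ns i)) hFm hFmass hlimF
  refine ⟨F, hinv, ?_⟩
  have hAm := h.measurable_estepOp hb hFm.coe_nnreal_ennreal
  -- both sides have the same finite integral
  refine ae_eq_of_ae_le_of_lintegral_le hinv.excessive ?_ hFm.coe_nnreal_ennreal.aemeasurable ?_
  · rw [h.lintegral_etimeResolvent two_pos hAm, h.lintegral_estepOp hb hFm.coe_nnreal_ennreal,
      hFmass]
    finiteness
  · rw [h.lintegral_etimeResolvent two_pos hAm, h.lintegral_estepOp hb hFm.coe_nnreal_ennreal,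
      hFmass, one_div, ENNReal.ofReal_inv_of_pos two_pos]
    simp [ENNReal.inv_mul_cancel]

end InvariantDensity

/-! ### The density along every orbit -/

/-- A density `φ` of mass one and bounded energy that solves the stationary forward equation
`φ = R₂ A φ` along every orbit of the flow, without exceptional set. -/
structure IsStationaryDensity {Ω : Type*} [MeasurableSpace Ω] (θ : ℝ → ℤ → Ω → Ω) (P : Measure Ω)
    (b φ : Ω → ℝ) : Prop where
  meas : Measurable φ
  nonneg : ∀ a, 0 ≤ φ a
  mass : ∫⁻ a, ENNReal.ofReal (φ a) ∂P = 1
  energy : ∫⁻ a, ENNReal.ofReal (b a * φ a ^ 2) ∂P ≤ ∫⁻ a, ENNReal.ofReal (b a) ∂P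
  fixed : ∀ a, ENNReal.ofReal (φ a)
    = etimeResolvent θ 2 (estepOp θ b fun a => ENNReal.ofReal (φ a)) a

section StationaryDensity

variable {Ω : Type*} [MeasurableSpace Ω] {θ : ℝ → ℤ → Ω → Ω} {P : Measure Ω} {b : Ω → ℝ}

theorem IsFlow.etimeResolvent_path (h : IsFlow θ P) (μ : ℝ) (f : Ω → ℝ≥0∞) (s : ℝ) (x : ℤ)
    (a : Ω) : etimeResolvent θ μ f (θ s x a)
      = ∫⁻ r in Ioi s, ENNReal.ofReal (Real.exp (-(μ * (r - s)))) * f (θ r x a) := by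
  have := (measurePreserving_add_right (volume : Measure ℝ) s).setLIntegral_comp_preimage_emb
    (measurableEmbedding_addRight s)
    (fun r => ENNReal.ofReal (Real.exp (-(μ * (r - s)))) * f (θ r x a)) (Ioi s)
  rw [← this, etimeResolvent]
  simp [h.comp]

/-- On nonnegative functions the resolvent grows at most like `e^{μ t}` along orbits. In particular,
if it is finite at one time, then it is finite at all later times. -/
theorem IsFlow.etimeResolvent_path_le (h : IsFlow θ P) {μ : ℝ} (f : Ω → ℝ≥0∞)
    {s t : ℝ} (hst : s ≤ t) (x : ℤ) (a : Ω) : etimeResolvent θ μ f (θ t x a)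
      ≤ ENNReal.ofReal (Real.exp (μ * (t - s))) * etimeResolvent θ μ f (θ s x a) := by
  rw [h.etimeResolvent_path, h.etimeResolvent_path, ← lintegral_const_mul' _ _ (by finiteness)]
  refine (lintegral_mono_set (Ioi_subset_Ioi hst)).trans (le_of_eq (lintegral_congr fun r => ?_))
  rw [← mul_assoc, ← ENNReal.ofReal_mul (Real.exp_nonneg _), ← Real.exp_add]
  ring_nf

omit [MeasurableSpace Ω] in
theorem estepOp_congr {f g : Ω → ℝ≥0∞} {a : Ω} (h0 : f a = g a) (h1 : f (θ 0 1 a) = g (θ 0 1 a))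
    (h2 : f (θ 0 (-1) a) = g (θ 0 (-1) a)) : estepOp θ b f a = estepOp θ b g a := by
  simp only [estepOp, h0, h1, h2]

/-- The version of the invariant density that solves the equation on every orbit: it is set to
zero on the shift-invariant null set of the environments on whose orbit the equation fails. -/
theorem IsFlow.exists_isStationaryDensity (h : IsFlow θ P) [IsProbabilityMeasure P] (hb : IsRate b)
    (hT : HasCubicAccumulation θ b P) : ∃ φ, IsStationaryDensity θ P b φ := by
  classical
  obtain ⟨F, hF, hFfix⟩ := h.exists_invariantDensity hb hT
  have hFm : Measurable fun a => (F a : ℝ≥0∞) := hF.meas.coe_nnreal_ennreal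
  set H := estepOp θ b fun a => (F a : ℝ≥0∞) with hH
  have hHm : Measurable H := h.measurable_estepOp hb hFm
  set Ψ := etimeResolvent θ 2 H with hΨ
  have hΨm : Measurable Ψ := h.measurable_etimeResolvent hHm
  set H' := estepOp θ b Ψ with hH'
  have hH'm : Measurable H' := h.measurable_estepOp hb hΨm
  have hHH : ∀ᵐ a ∂P, H' a = H a := by
    filter_upwards [hFfix, h.ae_comp hFfix 0 1, h.ae_comp hFfix 0 (-1)] with a h0 h1 h2
    exact estepOp_congr h0 h1 h2
  -- on orbits in `G`, `A Ψ = A F` at almost all times, so that `Ψ = R₂ A F` solves `Ψ = R₂ A Ψ`;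
  -- finiteness at integer times entails finiteness at all times
  set G : Set Ω := {a | ∀ x : ℤ, (∀ᵐ t : ℝ, H' (θ t x a) = H (θ t x a)) ∧
    ∀ n : ℤ, Ψ (θ n x a) ≠ ⊤} with hG
  have hGm : MeasurableSet G := by
    have e : G = ⋂ x : ℤ, ({a | volume {t : ℝ | H' (θ t x a) ≠ H (θ t x a)} = 0} ∩
        ⋂ n : ℤ, {a | Ψ (θ n x a) ≠ ⊤}) := by
      ext a; simp only [hG, mem_ofPred_eq, mem_iInter, mem_inter_iff, ae_iff, ne_eq]
    rw [e]
    refine .iInter fun x => .inter ?_ (.iInter fun n => ?_)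
    · have hset : MeasurableSet {q : Ω × ℝ | H' (θ q.2 x q.1) ≠ H (θ q.2 x q.1)} := by
        have hj := (h.measurable_joint x).comp (measurable_swap (α := Ω) (β := ℝ))
        exact (measurableSet_eq_fun (hH'm.comp hj) (hHm.comp hj)).compl
      exact (measurable_measure_prodMk_left hset) (measurableSet_singleton 0)
    · exact (hΨm.comp (h.measurable_map n x)) (measurableSet_singleton ⊤).compl
  have hGinv : ∀ a ∈ G, ∀ s y, θ s y a ∈ G := fun a ha s y x => by
    refine ⟨?_, fun n => ?_⟩
    · have := (ha (x + y)).1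
      simp only [h.comp]
      exact (measurePreserving_add_right volume s).quasiMeasurePreserving.ae this
    · rw [h.comp]
      refine ne_top_of_le_ne_top (ENNReal.mul_ne_top ENNReal.ofReal_ne_top
        ((ha (x + y)).2 (n + ⌊s⌋))) (h.etimeResolvent_path_le H (μ := 2) ?_ _ a)
      push_cast
      linarith [Int.floor_le s]
  have hGinv' : ∀ a, a ∉ G → ∀ s y, θ s y a ∉ G := fun a ha s y hs => by
    have := hGinv _ hs (-s) (-y)
    rw [h.comp, neg_add_cancel, neg_add_cancel, h.zero] at this
    exact ha this
  have hGfull : ∀ᵐ a ∂P, a ∈ G := by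
    refine ae_all_iff.mpr fun x => (h.ae_ae_comp hHH x).and (ae_all_iff.mpr fun n => ?_)
    refine h.ae_comp (p := fun a => Ψ a ≠ ⊤) ?_ n x
    filter_upwards [hFfix] with a ha
    rw [ha]; exact ENNReal.coe_ne_top
  have hfin : ∀ a ∈ G, Ψ a ≠ ⊤ := fun a ha => by
    have := (ha 0).2 0
    rwa [Int.cast_zero, h.zero] at this
  set φ : Ω → ℝ := G.indicator fun a => (Ψ a).toReal with hφ
  have hφG : ∀ a ∈ G, ENNReal.ofReal (φ a) = Ψ a := fun a ha => by
    rw [hφ, indicator_of_mem ha, ENNReal.ofReal_toReal (hfin a ha)]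
  have hφG' : ∀ a, a ∉ G → φ a = 0 := fun a ha => indicator_of_notMem ha _
  have hφF : ∀ᵐ a ∂P, φ a = F a := by
    filter_upwards [hGfull, hFfix] with a ha h1
    rw [hφ, indicator_of_mem ha, h1]; rfl
  refine ⟨φ, hΨm.ennreal_toReal.indicator hGm,
    fun a => indicator_nonneg (fun _ _ => ENNReal.toReal_nonneg) a, ?_, ?_, fun a => ?_⟩
  · rw [← hF.mass]
    refine lintegral_congr_ae ?_
    filter_upwards [hφF] with a ha
    rw [ha]; simp
  · refine le_trans (le_of_eq (lintegral_congr_ae ?_)) hF.energy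
    filter_upwards [hφF] with a ha
    rw [ha, ENNReal.ofReal_mul (hb.nonneg a), ENNReal.ofReal_pow (NNReal.coe_nonneg _)]; simp
  · by_cases ha : a ∈ G
    · rw [hφG a ha, hΨ]
      refine lintegral_congr_ae (ae_restrict_of_ae ?_)
      filter_upwards [(ha 0).1] with t ht
      rw [← ht, hH']
      have h0 := hGinv a ha t 0
      congr 1
      exact estepOp_congr (hφG _ h0).symm (hφG _ (hGinv _ h0 _ _)).symm
        (hφG _ (hGinv _ h0 _ _)).symm
    · have h0 : ∀ t x, φ (θ t x a) = 0 := fun t x => hφG' _ (hGinv' a ha t x)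
      simp [hφG' a ha, etimeResolvent, estepOp, h.comp, h0]

namespace IsStationaryDensity

variable {φ : Ω → ℝ}

theorem path_eq (hφ : IsStationaryDensity θ P b φ) (h : IsFlow θ P) (hb : IsRate b) (s : ℝ) (x : ℤ)
    (a : Ω) : ENNReal.ofReal (φ (θ s x a)) = ∫⁻ r in Ioi s,
      ENNReal.ofReal (Real.exp (-(2 * (r - s))) * stepOp θ b φ (θ r x a)) := by
  rw [hφ.fixed, h.etimeResolvent_path]
  refine lintegral_congr fun r => ?_
  rw [ENNReal.ofReal_mul (Real.exp_nonneg _),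
    ofReal_stepOp hb (hφ.nonneg _) (hφ.nonneg _) (hφ.nonneg _)]

theorem measurable_stepOp (hφ : IsStationaryDensity θ P b φ) (h : IsFlow θ P) (hb : IsRate b) :
    Measurable (stepOp θ b φ) := by
  have hb0 := hb.meas
  have hφ0 := hφ.meas
  have h1 := h.measurable_map 0 1
  have h2 := h.measurable_map 0 (-1)
  unfold stepOp
  fun_prop

/-- Along every orbit, `φ` is an indefinite integral of `2 φ - A φ = - L⁺ φ`. -/
theorem isPrimitive (hφ : IsStationaryDensity θ P b φ) (h : IsFlow θ P) (hb : IsRate b) (x : ℤ)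
    (a : Ω) : IsPrimitive (fun t => φ (θ t x a))
      (fun t => 2 * φ (θ t x a) - stepOp θ b φ (θ t x a)) := by
  have hm := (hφ.measurable_stepOp h hb).comp (h.measurable_path x a)
  have hst : ∀ r, 0 ≤ stepOp θ b φ (θ r x a) := fun r =>
    stepOp_nonneg hb (hφ.nonneg _) (hφ.nonneg _) (hφ.nonneg _)
  have hnn : ∀ s r, 0 ≤ Real.exp (-(2 * (r - s))) * stepOp θ b φ (θ r x a) := fun s r =>
    mul_nonneg (Real.exp_nonneg _) (hst r)
  have hint : ∀ s, IntegrableOn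
      (fun r => Real.exp (-(2 * (r - s))) * stepOp θ b φ (θ r x a)) (Ioi s) := fun s => by
    refine ⟨(Measurable.mul (by fun_prop) hm).aestronglyMeasurable, ?_⟩
    rw [hasFiniteIntegral_iff_ofReal (.of_forall (hnn s)), ← hφ.path_eq h hb]
    exact ENNReal.ofReal_lt_top
  have hpe : ∀ s, φ (θ s x a)
      = ∫ r in Ioi s, Real.exp (-(2 * (r - s))) * stepOp θ b φ (θ r x a) := fun s => by
    rw [← ENNReal.ofReal_eq_ofReal_iff (hφ.nonneg _) (integral_nonneg (hnn s)), hφ.path_eq h hb,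
      ofReal_integral_eq_lintegral_ofReal (hint s) (.of_forall (hnn s))]
  simp only [hpe]
  refine isPrimitive_resolvent fun s => ?_
  refine ((hint s).const_mul (Real.exp (-(2 * s)))).congr (.of_forall fun r => ?_)
  simp only
  rw [← mul_assoc, ← Real.exp_add]; ring_nf

theorem continuous_path (hφ : IsStationaryDensity θ P b φ) (h : IsFlow θ P) (hb : IsRate b) (x : ℤ)
    (a : Ω) : Continuous fun t => φ (θ t x a) :=
  (hφ.isPrimitive h hb x a).continuous

/-- Mass leaves a site at rate at most `2`. -/
theorem path_le (hφ : IsStationaryDensity θ P b φ) (h : IsFlow θ P) {s t : ℝ}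
    (hst : s ≤ t) (x : ℤ) (a : Ω) : φ (θ t x a) ≤ Real.exp (2 * (t - s)) * φ (θ s x a) := by
  have := h.etimeResolvent_path_le (μ := 2) (estepOp θ b fun a => ENNReal.ofReal (φ a)) hst x a
  rw [← hφ.fixed, ← hφ.fixed, ← ENNReal.ofReal_mul (Real.exp_nonneg _)] at this
  exact (ENNReal.ofReal_le_ofReal_iff (mul_nonneg (Real.exp_nonneg _) (hφ.nonneg _))).mp this

theorem integrable [IsProbabilityMeasure P] (hφ : IsStationaryDensity θ P b φ) :
    Integrable φ P := by
  refine ⟨hφ.meas.aestronglyMeasurable, ?_⟩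
  rw [hasFiniteIntegral_iff_ofReal (.of_forall hφ.nonneg), hφ.mass]
  exact ENNReal.one_lt_top

theorem integral_eq_one (hφ : IsStationaryDensity θ P b φ) : ∫ a, φ a ∂P = 1 := by
  rw [integral_eq_lintegral_of_nonneg_ae (.of_forall hφ.nonneg) hφ.meas.aestronglyMeasurable,
    hφ.mass, ENNReal.toReal_one]

theorem integrable_energy [IsProbabilityMeasure P] (hφ : IsStationaryDensity θ P b φ)
    (hb : IsRate b) : Integrable (fun a => b a * φ a ^ 2) P := by
  refine ⟨(hb.meas.mul (hφ.meas.pow_const 2)).aestronglyMeasurable, ?_⟩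
  rw [hasFiniteIntegral_iff_ofReal (.of_forall fun a => mul_nonneg (hb.nonneg a) (sq_nonneg _))]
  refine hφ.energy.trans_lt ?_
  rw [← ofReal_integral_eq_lintegral_ofReal hb.bddMeas.integrable (.of_forall hb.nonneg)]
  exact ENNReal.ofReal_lt_top

theorem integral_energy_le [IsProbabilityMeasure P] (hφ : IsStationaryDensity θ P b φ)
    (hb : IsRate b) : ∫ a, b a * φ a ^ 2 ∂P ≤ ∫ a, b a ∂P := by
  have h1 := hφ.energy
  rw [← ofReal_integral_eq_lintegral_ofReal hb.bddMeas.integrable (.of_forall hb.nonneg),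
    ← ofReal_integral_eq_lintegral_ofReal (hφ.integrable_energy hb)
      (.of_forall fun a => mul_nonneg (hb.nonneg a) (sq_nonneg _))] at h1
  exact (ENNReal.ofReal_le_ofReal_iff (integral_nonneg hb.nonneg)).mp h1

end IsStationaryDensity

end StationaryDensity

/-! ### Positivity -/

/-- Ergodicity of a flow: strictly invariant measurable sets are trivial. -/
def IsFlowErgodic {Ω : Type*} [MeasurableSpace Ω] (θ : ℝ → ℤ → Ω → Ω) (P : Measure Ω) : Prop :=
  ∀ A : Set Ω, MeasurableSet A → (∀ (t : ℝ) (x : ℤ), θ t x ⁻¹' A = A) → P A = 0 ∨ P A = 1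

section Positivity

variable {Ω : Type*} [MeasurableSpace Ω] {θ : ℝ → ℤ → Ω → Ω} {P : Measure Ω} {b φ : Ω → ℝ}

theorem IsFlow.preimage_eq_of_subset (h : IsFlow θ P) {A : Set Ω}
    (hA : ∀ a ∈ A, ∀ t x, θ t x a ∈ A) (t : ℝ) (x : ℤ) : θ t x ⁻¹' A = A := by
  ext a
  refine ⟨fun ha => ?_, fun ha => hA a ha t x⟩
  have := hA _ ha (-t) (-x)
  rwa [h.comp, neg_add_cancel, neg_add_cancel, h.zero] at this

namespace IsStationaryDensity

theorem path_eq_zero_of_le (hφ : IsStationaryDensity θ P b φ) (h : IsFlow θ P) {s t : ℝ}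
    (hst : s ≤ t) {x : ℤ} {a : Ω} (h0 : φ (θ s x a) = 0) : φ (θ t x a) = 0 := by
  have := hφ.path_le h hst x a
  rw [h0, mul_zero] at this
  exact le_antisymm this (hφ.nonneg _)

/-- If the density vanishes at a site from some time on, no mass flows in from the neighbours; as
these are not frozen forever, the density vanishes there too from some time on. -/
theorem exists_eq_zero_of_neighbour (hφ : IsStationaryDensity θ P b φ) (h : IsFlow θ P)
    (hb : IsRate b) {a : Ω}
    (hacc : ∀ (m : ℤ) (x : ℤ), ∃ n : ℕ, 1 ≤ ∫ s in (m : ℝ)..(m + n), b (θ s x a))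
    {t : ℝ} {x y : ℤ} (hxy : y = x + 1 ∨ y = x - 1) (h0 : φ (θ t x a) = 0) :
    ∃ s, φ (θ s y a) = 0 := by
  by_contra! hne
  obtain ⟨n, hn⟩ := hacc ⌈t⌉ y
  set m : ℝ := (⌈t⌉ : ℝ) with hm
  have htm : t ≤ m := Int.le_ceil t
  have hmn : m ≤ m + n := by linarith [Nat.cast_nonneg (α := ℝ) n]
  -- a lower bound for the density at `y` while a unit of rate is accumulated there
  set c := Real.exp (-(2 * (n : ℝ))) * φ (θ (m + n) y a) with hc
  have hcpos : 0 < c := mul_pos (Real.exp_pos _) (lt_of_le_of_ne (hφ.nonneg _) (hne _).symm)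
  have hlow : ∀ s ∈ Icc m (m + n), c ≤ φ (θ s y a) := fun s hs => by
    have h1 := hφ.path_le h hs.2 y a
    have h2 : Real.exp (-(2 * (n : ℝ))) * Real.exp (2 * (m + n - s)) ≤ 1 := by
      rw [← Real.exp_add, Real.exp_le_one_iff]; linarith [hs.1]
    calc c ≤ Real.exp (-(2 * (n : ℝ))) * (Real.exp (2 * (m + n - s)) * φ (θ s y a)) :=
          mul_le_mul_of_nonneg_left h1 (Real.exp_nonneg _)
      _ ≤ 1 * φ (θ s y a) := by
          rw [← mul_assoc]; exact mul_le_mul_of_nonneg_right h2 (hφ.nonneg _)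
      _ = _ := one_mul _
  have hbl := h.locallyIntegrable_path hb.bddMeas y a
  have hbφ : IntervalIntegrable (fun s => b (θ s y a) * φ (θ s y a)) volume m (m + n) := by
    have := (hbl.continuous_smul (hφ.continuous_path h hb y a)).intervalIntegrable_real m (m + n)
    simpa [mul_comm] using this
  have hge : c ≤ ∫ s in m..(m + n), b (θ s y a) * φ (θ s y a) := by
    calc c ≤ (∫ s in m..(m + n), b (θ s y a)) * c := by nlinarith
      _ = ∫ s in m..(m + n), b (θ s y a) * c := (intervalIntegral.integral_mul_const _ _).symm
      _ ≤ _ := intervalIntegral.integral_mono_on hmn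
          ((hbl.intervalIntegrable_real _ _).mul_const c) hbφ
          fun s hs => mul_le_mul_of_nonneg_left (hlow s hs) (hb.nonneg _)
  have hz : ∀ s, m ≤ s → φ (θ s x a) = 0 := fun s hs => hφ.path_eq_zero_of_le h (htm.trans hs) h0
  have hp := hφ.isPrimitive h hb x a
  have h3 := hp.2 m (m + n)
  simp only [hz m le_rfl, hz _ hmn, sub_zero] at h3
  have h4 : ∫ s in m..(m + n), b (θ s y a) * φ (θ s y a)
      ≤ ∫ s in m..(m + n), -(2 * φ (θ s x a) - stepOp θ b φ (θ s x a)) := by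
    refine intervalIntegral.integral_mono_on hmn hbφ (hp.intervalIntegrable _ _).neg fun s hs => ?_
    rw [hz s hs.1]
    have k1 := mul_nonneg (hb.nonneg (θ s (1 + x) a)) (hφ.nonneg (θ s (1 + x) a))
    have k2 := mul_nonneg (hb.nonneg (θ s (-1 + x) a)) (hφ.nonneg (θ s (-1 + x) a))
    simp only [stepOp, h.comp, zero_add, hz s hs.1]
    rcases hxy with rfl | rfl
    · rw [add_comm x 1]; linarith
    · rw [sub_eq_neg_add]; linarith
  rw [intervalIntegral.integral_neg, h3] at h4
  linarith

/-- Almost surely the density is positive on the whole orbit. Otherwise it vanishes at all sites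
eventually; this event is shift invariant, and if it had probability one, then `φ ∘ θ_{n,0} → 0`,
which contradicts stationarity. -/
theorem ae_pos (hφ : IsStationaryDensity θ P b φ) (h : IsFlow θ P) [IsProbabilityMeasure P]
    (hb : IsRate b) (hT : HasCubicAccumulation θ b P) (herg : IsFlowErgodic θ P) :
    ∀ᵐ a ∂P, ∀ t x, 0 < φ (θ t x a) := by
  set Z : Set Ω := {a | ∀ x : ℤ, ∃ n : ℕ, φ (θ n x a) = 0} with hZ
  have hZm : MeasurableSet Z := by
    have e : Z = ⋂ x : ℤ, ⋃ n : ℕ, {a | φ (θ n x a) = 0} := by ext a; simp [hZ]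
    rw [e]
    exact .iInter fun x => .iUnion fun n =>
      (hφ.meas.comp (h.measurable_map n x)) (measurableSet_singleton 0)
  have hnat : ∀ {t : ℝ} {x : ℤ} {a : Ω}, φ (θ t x a) = 0 → ∃ n : ℕ, φ (θ n x a) = 0 :=
    fun {t x a} h0 => ⟨⌈t⌉₊, hφ.path_eq_zero_of_le h (Nat.le_ceil t) h0⟩
  have hZinv : ∀ a ∈ Z, ∀ t x, θ t x a ∈ Z := fun a ha t x y => by
    obtain ⟨n, hn⟩ := ha (y + x)
    refine hnat (t := n - t) ?_
    rwa [h.comp, sub_add_cancel]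
  have hZ0 : P Z = 0 := by
    refine (herg Z hZm (h.preimage_eq_of_subset hZinv)).resolve_right fun h1 => ?_
    have hae : ∀ᵐ a ∂P, a ∈ Z := by
      rw [← prob_compl_eq_zero_iff hZm] at h1
      exact h1
    have hm : Measurable fun a => min (ENNReal.ofReal (φ a)) 1 := by
      have := hφ.meas
      fun_prop
    have hlim : Tendsto (fun n : ℕ => ∫⁻ a, min (ENNReal.ofReal (φ (θ n 0 a))) 1 ∂P) atTop
        (𝓝 (∫⁻ _, 0 ∂P)) := by
      refine tendsto_lintegral_of_dominated_convergence (fun _ => 1)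
        (fun n => hm.comp (h.measurable_map n 0)) (fun n => .of_forall fun a => min_le_right _ _)
        (by simp) ?_
      filter_upwards [hae] with a ha
      obtain ⟨n, hn⟩ := ha 0
      refine tendsto_atTop_of_eventually_const (i₀ := n) fun k hk => ?_
      rw [hφ.path_eq_zero_of_le h (Nat.cast_le.mpr hk) hn]; simp
    have hconst : ∀ n : ℕ, ∫⁻ a, min (ENNReal.ofReal (φ (θ n 0 a))) 1 ∂P
        = ∫⁻ a, min (ENNReal.ofReal (φ a)) 1 ∂P := fun n => h.lintegral_comp hm n 0
    simp only [hconst, lintegral_zero] at hlim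
    have h2 := tendsto_nhds_unique tendsto_const_nhds hlim
    rw [lintegral_eq_zero_iff hm] at h2
    have h3 : ∫⁻ a, ENNReal.ofReal (φ a) ∂P = 0 := by
      rw [← lintegral_zero (μ := P)]
      refine lintegral_congr_ae ?_
      filter_upwards [h2] with a ha
      simpa using ha
    rw [hφ.mass] at h3
    exact one_ne_zero h3
  filter_upwards [measure_eq_zero_iff_ae_notMem.mp hZ0, h.ae_exists_accumulation hT]
    with a ha hacc t x
  refine lt_of_le_of_ne (hφ.nonneg _) fun h0 => ha fun y => ?_
  have : ∃ s, φ (θ s y a) = 0 := by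
    induction y using Int.inductionOn' (b := x) with
    | zero => exact ⟨t, h0.symm⟩
    | succ k _ ih => exact ih.elim fun s hs =>
        hφ.exists_eq_zero_of_neighbour h hb hacc (Or.inl rfl) hs
    | pred k _ ih => exact ih.elim fun s hs =>
        hφ.exists_eq_zero_of_neighbour h hb hacc (Or.inr rfl) hs
  exact this.elim fun s hs => hnat hs

end IsStationaryDensity

end Positivity

/-! ### Jump kernels of the dual walk -/

section JumpKernel

variable {Ω : Type*} [MeasurableSpace Ω] {θ : ℝ → ℤ → Ω → Ω} {P : Measure Ω} {b φ : Ω → ℝ}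

/-- The probability that the dual walk sitting at `x` at time `s` does not jump before it reaches
the earlier time `t`. -/
def stayProb (θ : ℝ → ℤ → Ω → Ω) (b : Ω → ℝ) (a : Ω) (x : ℤ) (t s : ℝ) : ℝ≥0∞ :=
  ENNReal.ofReal (Real.exp (-∫ u in t..s, 2 * b (θ u x a)))

/-- The probability that the dual walk started from `x` at time `s` is at `y` at the earlier time
`t` after exactly `k` jumps, by decomposition at the first jump. -/
def jumpKernel (θ : ℝ → ℤ → Ω → Ω) (b : Ω → ℝ) (a : Ω) : ℕ → ℝ → ℤ → ℝ → ℤ → ℝ≥0∞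
  | 0, s, x, t, y => stayProb θ b a x t s * (if x = y then 1 else 0)
  | k + 1, s, x, t, y => ∫⁻ r in Ioc t s, stayProb θ b a x r s * ENNReal.ofReal (b (θ r x a))
      * (jumpKernel θ b a k r (x + 1) t y + jumpKernel θ b a k r (x - 1) t y)

/-- Joint measurability, from continuity in the time variables. -/
theorem IsFlow.measurable_stayProb (h : IsFlow θ P) (hb : IsRate b) (x : ℤ) :
    Measurable fun q : Ω × ℝ × ℝ => stayProb θ b q.1 x q.2.1 q.2.2 := by
  have h2b : IsBddMeas fun a => 2 * b a := hb.bddMeas.const_mul 2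
  have hI : Measurable (Function.uncurry fun (s : ℝ) (a : Ω) => ∫ u in (0 : ℝ)..s,
      2 * b (θ u x a)) :=
    measurable_uncurry_of_continuous_of_measurable
      (fun a => (isPrimitive_integral (h.locallyIntegrable_path h2b x a) 0).continuous)
      (fun s => h.measurable_integral_path h2b.1 x 0 s)
  have e : ∀ q : Ω × ℝ × ℝ, stayProb θ b q.1 x q.2.1 q.2.2
      = ENNReal.ofReal (Real.exp (-(Function.uncurry (fun (s : ℝ) (a : Ω) => ∫ u in (0 : ℝ)..s,
        2 * b (θ u x a)) (q.2.2, q.1) - Function.uncurry (fun (s : ℝ) (a : Ω) => ∫ u in (0 : ℝ)..s,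
        2 * b (θ u x a)) (q.2.1, q.1)))) := fun q => by
    have hl := h.locallyIntegrable_path h2b x q.1
    simp only [Function.uncurry, stayProb]
    rw [intervalIntegral.integral_interval_sub_left (hl.intervalIntegrable_real _ _)
      (hl.intervalIntegrable_real _ _)]
  simp only [e]
  have h1 := hI.comp (g := Function.uncurry _) (f := fun q : Ω × ℝ × ℝ => (q.2.2, q.1)) (by fun_prop)
  have h2 := hI.comp (g := Function.uncurry _) (f := fun q : Ω × ℝ × ℝ => (q.2.1, q.1)) (by fun_prop)
  exact ((h1.sub h2).neg.exp).ennreal_ofReal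

theorem measurable_setLIntegral_Ioc {α : Type*} [MeasurableSpace α] {f : α × ℝ → ℝ≥0∞}
    (hf : Measurable f) {t s : α → ℝ} (ht : Measurable t) (hs : Measurable s) :
    Measurable fun q => ∫⁻ r in Ioc (t q) (s q), f (q, r) := by
  have e : (fun q => ∫⁻ r in Ioc (t q) (s q), f (q, r))
      = fun q => ∫⁻ r, {p : α × ℝ | t p.1 < p.2 ∧ p.2 ≤ s p.1}.indicator f (q, r) := by
    ext q
    rw [← lintegral_indicator measurableSet_Ioc]
    rfl
  rw [e]
  refine Measurable.lintegral_prod_right' (hf.indicator ?_)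
  exact (measurableSet_lt (ht.comp measurable_fst) measurable_snd).inter
    (measurableSet_le measurable_snd (hs.comp measurable_fst))

theorem IsFlow.measurable_jumpKernel (h : IsFlow θ P) (hb : IsRate b) (k : ℕ) (x y : ℤ) :
    Measurable fun q : Ω × ℝ × ℝ => jumpKernel θ b q.1 k q.2.1 x q.2.2 y := by
  induction k generalizing x with
  | zero =>
    refine Measurable.mul_const ?_ _
    exact (h.measurable_stayProb hb x).comp
      (f := fun q : Ω × ℝ × ℝ => (q.1, q.2.2, q.2.1)) (by fun_prop)
  | succ k ih =>
    refine measurable_setLIntegral_Ioc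
      (f := fun p : (Ω × ℝ × ℝ) × ℝ => stayProb θ b p.1.1 x p.2 p.1.2.1
        * ENNReal.ofReal (b (θ p.2 x p.1.1))
        * (jumpKernel θ b p.1.1 k p.2 (x + 1) p.1.2.2 y
          + jumpKernel θ b p.1.1 k p.2 (x - 1) p.1.2.2 y)) ?_ (by fun_prop) (by fun_prop)
    have h1 := (h.measurable_stayProb hb x).comp
      (f := fun p : (Ω × ℝ × ℝ) × ℝ => (p.1.1, p.2, p.1.2.1)) (by fun_prop)
    have h2 := (hb.meas.comp (h.measurable_joint x)).comp
      (f := fun p : (Ω × ℝ × ℝ) × ℝ => (p.2, p.1.1)) (by fun_prop)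
    have h3 := fun z => (ih z).comp
      (f := fun p : (Ω × ℝ × ℝ) × ℝ => (p.1.1, p.2, p.1.2.2)) (by fun_prop)
    exact (h1.mul h2.ennreal_ofReal).mul ((h3 (x + 1)).add (h3 (x - 1)))

theorem IsFlow.stayProb_comp (h : IsFlow θ P) (a : Ω) (u : ℝ) (z x : ℤ) (t s : ℝ) :
    stayProb θ b (θ u z a) x t s = stayProb θ b a (x + z) (t + u) (s + u) := by
  simp only [stayProb]
  rw [h.integral_path_comp (fun a => 2 * b a)]

/-- Covariance of the jump kernels under space-time shifts. -/
theorem IsFlow.jumpKernel_comp (h : IsFlow θ P) (a : Ω) (u : ℝ) (z : ℤ) (k : ℕ) (s : ℝ) (x : ℤ)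
    (t : ℝ) (y : ℤ) : jumpKernel θ b (θ u z a) k s x t y
      = jumpKernel θ b a k (s + u) (x + z) (t + u) (y + z) := by
  induction k generalizing s x with
  | zero => simp only [jumpKernel, h.stayProb_comp, add_left_inj]
  | succ k ih =>
    have := (measurePreserving_add_right (volume : Measure ℝ) u).setLIntegral_comp_preimage_emb
      (measurableEmbedding_addRight u)
      (fun r => stayProb θ b a (x + z) r (s + u) * ENNReal.ofReal (b (θ r (x + z) a))
        * (jumpKernel θ b a k r (x + z + 1) (t + u) (y + z)
          + jumpKernel θ b a k r (x + z - 1) (t + u) (y + z))) (Ioc (t + u) (s + u))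
    simp only [jumpKernel]
    rw [← this]
    simp only [preimage_add_const_Ioc, add_sub_cancel_right]
    refine lintegral_congr fun r => ?_
    rw [h.stayProb_comp, h.comp, ih, ih]
    ring_nf

theorem lintegral_Ioc_swap {f : ℝ → ℝ → ℝ≥0∞} (hf : Measurable (Function.uncurry f)) (t s : ℝ) :
    ∫⁻ r in Ioc t s, ∫⁻ q in Ioc t r, f r q = ∫⁻ q in Ioc t s, ∫⁻ r in Ioc q s, f r q := by
  have e1 : ∫⁻ r in Ioc t s, ∫⁻ q in Ioc t r, f r q
      = ∫⁻ r, ∫⁻ q, {p : ℝ × ℝ | t < p.2 ∧ p.2 ≤ p.1 ∧ p.1 ≤ s}.indicator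
        (Function.uncurry f) (r, q) := by
    rw [← lintegral_indicator measurableSet_Ioc]
    refine lintegral_congr fun r => ?_
    by_cases hr : r ∈ Ioc t s
    · rw [indicator_of_mem hr, ← lintegral_indicator measurableSet_Ioc]
      refine lintegral_congr fun q => ?_
      by_cases hq : q ∈ Ioc t r
      · rw [indicator_of_mem hq, indicator_of_mem]
        · rfl
        · exact ⟨hq.1, hq.2, hr.2⟩
      · rw [indicator_of_notMem hq, indicator_of_notMem]
        exact fun hc => hq ⟨hc.1, hc.2.1⟩
    · rw [indicator_of_notMem hr]
      symm
      rw [lintegral_eq_zero_of_ae_eq_zero]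
      refine .of_forall fun q => indicator_of_notMem (fun hc => hr ?_) _
      exact ⟨hc.1.trans_le hc.2.1, hc.2.2⟩
  have e2 : ∫⁻ q in Ioc t s, ∫⁻ r in Ioc q s, f r q
      = ∫⁻ q, ∫⁻ r, {p : ℝ × ℝ | t < p.2 ∧ p.2 ≤ p.1 ∧ p.1 ≤ s}.indicator
        (Function.uncurry f) (r, q) := by
    rw [← lintegral_indicator measurableSet_Ioc]
    refine lintegral_congr fun q => ?_
    by_cases hq : q ∈ Ioc t s
    · rw [indicator_of_mem hq, setLIntegral_congr Ioc_ae_eq_Icc,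
        ← lintegral_indicator measurableSet_Icc]
      refine lintegral_congr fun r => ?_
      by_cases hr : r ∈ Icc q s
      · rw [indicator_of_mem hr, indicator_of_mem]
        · rfl
        · exact ⟨hq.1, hr.1, hr.2⟩
      · rw [indicator_of_notMem hr, indicator_of_notMem]
        exact fun hc => hr ⟨hc.2.1, hc.2.2⟩
    · rw [indicator_of_notMem hq]
      symm
      rw [lintegral_eq_zero_of_ae_eq_zero]
      refine .of_forall fun r => indicator_of_notMem (fun hc => hq ?_) _
      exact ⟨hc.1, hc.2.1.trans hc.2.2⟩
  rw [e1, e2]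
  refine lintegral_lintegral_swap (Measurable.aemeasurable ?_)
  refine Measurable.indicator hf ?_
  exact (measurableSet_lt measurable_const measurable_snd).inter
    ((measurableSet_le measurable_snd measurable_fst).inter
      (measurableSet_le measurable_fst measurable_const))

theorem IsFlow.measurable_rate_path (h : IsFlow θ P) (hb : IsRate b) (x : ℤ) (a : Ω) :
    Measurable fun r => ENNReal.ofReal (b (θ r x a)) :=
  (hb.meas.comp (h.measurable_path x a)).ennreal_ofReal

theorem IsFlow.measurable_stayProb_path (h : IsFlow θ P) (hb : IsRate b) (x : ℤ) (a : Ω)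
    {α : Type*} [MeasurableSpace α] {f g : α → ℝ} (hf : Measurable f) (hg : Measurable g) :
    Measurable fun q => stayProb θ b a x (f q) (g q) :=
  (h.measurable_stayProb hb x).comp (f := fun q => (a, f q, g q)) (by fun_prop)

theorem IsFlow.measurable_jumpKernel_path (h : IsFlow θ P) (hb : IsRate b) (k : ℕ) (x y : ℤ)
    (a : Ω) {α : Type*} [MeasurableSpace α] {f g : α → ℝ} (hf : Measurable f) (hg : Measurable g) :
    Measurable fun q => jumpKernel θ b a k (f q) x (g q) y :=
  (h.measurable_jumpKernel hb k x y).comp (f := fun q => (a, f q, g q)) (by fun_prop)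

/-- Decomposition of the jump kernels at the last jump. -/
theorem IsFlow.jumpKernel_succ_last (h : IsFlow θ P) (hb : IsRate b) (a : Ω) (k : ℕ) (s : ℝ)
    (x : ℤ) (t : ℝ) (y : ℤ) : jumpKernel θ b a (k + 1) s x t y
      = ∫⁻ q in Ioc t s, (jumpKernel θ b a k s x q (y + 1) * ENNReal.ofReal (b (θ q (y + 1) a))
        + jumpKernel θ b a k s x q (y - 1) * ENNReal.ofReal (b (θ q (y - 1) a)))
        * stayProb θ b a y t q := by
  induction k generalizing s x with
  | zero =>
    refine lintegral_congr fun r => ?_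
    simp only [jumpKernel]
    by_cases h1 : x = y + 1
    · subst h1
      have : ¬ (y + 1 + 1 = y) := by omega
      have : ¬ (y + 1 = y - 1) := by omega
      simp [*, mul_assoc]
    · by_cases h2 : x = y - 1
      · subst h2
        have : ¬ (y - 1 - 1 = y) := by omega
        simp [*, mul_assoc]
      · have : ¬ (x + 1 = y) := by omega
        have : ¬ (x - 1 = y) := by omega
        simp [*]
  | succ k ih =>
    rw [jumpKernel]
    set f : ℝ → ℝ → ℝ≥0∞ := fun r q => stayProb θ b a x r s * ENNReal.ofReal (b (θ r x a))
      * (((jumpKernel θ b a k r (x + 1) q (y + 1) + jumpKernel θ b a k r (x - 1) q (y + 1))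
          * ENNReal.ofReal (b (θ q (y + 1) a))
        + (jumpKernel θ b a k r (x + 1) q (y - 1) + jumpKernel θ b a k r (x - 1) q (y - 1))
          * ENNReal.ofReal (b (θ q (y - 1) a))) * stayProb θ b a y t q) with hf
    have mb := fun z => h.measurable_rate_path hb z a
    have mJ : ∀ z w, Measurable fun p : ℝ × ℝ => jumpKernel θ b a k p.1 z p.2 w := fun z w =>
      h.measurable_jumpKernel_path hb k z w a measurable_fst measurable_snd
    have mJ1 : ∀ r z w, Measurable fun q : ℝ => jumpKernel θ b a k r z q w := fun r z w =>
      h.measurable_jumpKernel_path hb k z w a measurable_const measurable_id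
    have mJ2 : ∀ q z w, Measurable fun r : ℝ => jumpKernel θ b a k r z q w := fun r z w =>
      h.measurable_jumpKernel_path hb k z w a measurable_id measurable_const
    have mS : Measurable fun r => stayProb θ b a x r s :=
      h.measurable_stayProb_path hb x a measurable_id measurable_const
    have mS' : Measurable fun q => stayProb θ b a y t q :=
      h.measurable_stayProb_path hb y a measurable_const measurable_id
    have hfm : Measurable (Function.uncurry f) := by
      refine Measurable.mul ((mS.comp measurable_fst).mul ((mb x).comp measurable_fst)) ?_
      refine Measurable.mul (Measurable.add ?_ ?_) (mS'.comp measurable_snd)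
      · exact ((mJ _ _).add (mJ _ _)).mul ((mb _).comp measurable_snd)
      · exact ((mJ _ _).add (mJ _ _)).mul ((mb _).comp measurable_snd)
    have e1 : ∀ r, stayProb θ b a x r s * ENNReal.ofReal (b (θ r x a))
        * (jumpKernel θ b a (k + 1) r (x + 1) t y + jumpKernel θ b a (k + 1) r (x - 1) t y)
        = ∫⁻ q in Ioc t r, f r q := fun r => by
      have m1 : ∀ z, Measurable fun q => (jumpKernel θ b a k r z q (y + 1)
          * ENNReal.ofReal (b (θ q (y + 1) a)) + jumpKernel θ b a k r z q (y - 1)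
          * ENNReal.ofReal (b (θ q (y - 1) a))) * stayProb θ b a y t q := fun z =>
        (((mJ1 r z _).mul (mb _)).add ((mJ1 r z _).mul (mb _))).mul mS'
      rw [ih, ih, ← lintegral_add_left (m1 _), ← lintegral_const_mul _ ((m1 _).fun_add (m1 _))]
      refine lintegral_congr fun q => ?_
      simp only [hf]; ring
    have e2 : ∀ q, (jumpKernel θ b a (k + 1) s x q (y + 1) * ENNReal.ofReal (b (θ q (y + 1) a))
        + jumpKernel θ b a (k + 1) s x q (y - 1) * ENNReal.ofReal (b (θ q (y - 1) a)))
        * stayProb θ b a y t q = ∫⁻ r in Ioc q s, f r q := fun q => by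
      have m1 : ∀ w, Measurable fun r => stayProb θ b a x r s * ENNReal.ofReal (b (θ r x a))
          * (jumpKernel θ b a k r (x + 1) q w + jumpKernel θ b a k r (x - 1) q w) := fun w =>
        (mS.mul (mb x)).mul ((mJ2 q _ _).add (mJ2 q _ _))
      simp only [jumpKernel]
      rw [← lintegral_mul_const _ (m1 _), ← lintegral_mul_const _ (m1 _),
        ← lintegral_add_left ((m1 _).mul_const _),
        ← lintegral_mul_const _ (((m1 _).mul_const _).fun_add ((m1 _).mul_const _))]
      refine lintegral_congr fun r => ?_
      simp only [hf]; ring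
    simp only [e1, e2]
    exact lintegral_Ioc_swap hfm t s

end JumpKernel

/-! ### Conservation of mass, stationarity and ergodicity -/

section DualKernel

variable {Ω : Type*} [MeasurableSpace Ω] {θ : ℝ → ℤ → Ω → Ω} {P : Measure Ω} {b φ : Ω → ℝ}

theorem lintegral_Ioc_ofReal {f : ℝ → ℝ} {t s : ℝ} (hts : t ≤ s)
    (hf : IntervalIntegrable f volume t s) (h0 : ∀ r ∈ Ioc t s, 0 ≤ f r) :
    ∫⁻ r in Ioc t s, ENNReal.ofReal (f r) = ENNReal.ofReal (∫ r in t..s, f r) := by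
  rw [intervalIntegral.integral_of_le hts, ofReal_integral_eq_lintegral_ofReal
    ((intervalIntegrable_iff_integrableOn_Ioc_of_le hts).mp hf)]
  exact (ae_restrict_iff' measurableSet_Ioc).mpr (.of_forall h0)

theorem IsRate.two_mul_path (hb : IsRate b) (h : IsFlow θ P) (x : ℤ) (a : Ω) :
    Measurable (fun r => 2 * b (θ r x a)) ∧ ∀ r, |2 * b (θ r x a)| ≤ (2 : ℝ≥0) := by
  refine ⟨(hb.meas.comp (h.measurable_path x a)).const_mul 2, fun r => ?_⟩
  have := hb.nonneg (θ r x a)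
  have := hb.le_one (θ r x a)
  rw [abs_of_nonneg (by positivity)]
  push_cast; linarith

/-- The walk either stays put or has a first jump. -/
theorem IsFlow.stayProb_add_lintegral (h : IsFlow θ P) (hb : IsRate b) (a : Ω) (x : ℤ) {t s : ℝ}
    (hts : t ≤ s) : stayProb θ b a x t s
      + ∫⁻ r in Ioc t s, stayProb θ b a x r s * ENNReal.ofReal (b (θ r x a)) * 2 = 1 := by
  obtain ⟨hm, hC⟩ := hb.two_mul_path h x a
  have hp := isPrimitive_exp_integral (β := fun r => -(2 * b (θ r x a))) hm.neg (C := 2)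
    (fun r => by rw [abs_neg]; exact hC r) s
  have hE : ∀ r, Real.exp (-∫ u in s..r, -(2 * b (θ u x a)))
      = Real.exp (-∫ u in r..s, 2 * b (θ u x a)) := fun r => by
    rw [intervalIntegral.integral_neg, neg_neg, intervalIntegral.integral_symm]
  simp only [hE, mul_neg, neg_neg] at hp
  have h2 := hp.2 t s
  simp only [intervalIntegral.integral_same, neg_zero, Real.exp_zero] at h2
  have e : ∀ r, stayProb θ b a x r s * ENNReal.ofReal (b (θ r x a)) * 2
      = ENNReal.ofReal (Real.exp (-∫ u in r..s, 2 * b (θ u x a)) * (2 * b (θ r x a))) := fun r => by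
    rw [stayProb, ENNReal.ofReal_mul (Real.exp_nonneg _), ENNReal.ofReal_mul zero_le_two,
      ENNReal.ofReal_ofNat]
    ring
  simp only [e]
  have hnn : ∀ r, 0 ≤ Real.exp (-∫ u in r..s, 2 * b (θ u x a)) * (2 * b (θ r x a)) := fun r =>
    mul_nonneg (Real.exp_nonneg _) (mul_nonneg zero_le_two (hb.nonneg _))
  rw [lintegral_Ioc_ofReal hts (hp.intervalIntegrable t s) (fun r _ => hnn r), h2, stayProb,
    ← ENNReal.ofReal_add (Real.exp_nonneg _)]
  · simp
  · rw [← h2]; exact intervalIntegral.integral_nonneg hts fun r _ => hnn r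

theorem IsFlow.stayProb_le_one (h : IsFlow θ P) (hb : IsRate b) (a : Ω) (x : ℤ) {t s : ℝ}
    (hts : t ≤ s) : stayProb θ b a x t s ≤ 1 :=
  le_self_add.trans_eq (h.stayProb_add_lintegral hb a x hts)

omit [MeasurableSpace Ω] in
theorem stayProb_pos (a : Ω) (x : ℤ) (t s : ℝ) : 0 < stayProb θ b a x t s :=
  ENNReal.ofReal_pos.mpr (Real.exp_pos _)

/-- The probability of fewer than `n` jumps of the dual walk. -/
def jumpMass (θ : ℝ → ℤ → Ω → Ω) (b : Ω → ℝ) (a : Ω) (n : ℕ) (s : ℝ) (x : ℤ) (t : ℝ) : ℝ≥0∞ :=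
  ∑ k ∈ Finset.range n, ∑' y, jumpKernel θ b a k s x t y

theorem IsFlow.measurable_jumpMass_path (h : IsFlow θ P) (hb : IsRate b) (a : Ω) (n : ℕ) (x : ℤ)
    (t : ℝ) : Measurable fun r => jumpMass θ b a n r x t :=
  Finset.measurable_fun_sum _ fun k _ => Measurable.tsum fun y =>
    h.measurable_jumpKernel_path hb k x y a measurable_id measurable_const

theorem IsFlow.jumpMass_succ (h : IsFlow θ P) (hb : IsRate b) (a : Ω) (n : ℕ) (s : ℝ) (x : ℤ)
    (t : ℝ) : jumpMass θ b a (n + 1) s x t = stayProb θ b a x t s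
      + ∫⁻ r in Ioc t s, stayProb θ b a x r s * ENNReal.ofReal (b (θ r x a))
        * (jumpMass θ b a n r (x + 1) t + jumpMass θ b a n r (x - 1) t) := by
  have mS : Measurable fun r => stayProb θ b a x r s * ENNReal.ofReal (b (θ r x a)) :=
    (h.measurable_stayProb_path hb x a measurable_id measurable_const).mul
      (h.measurable_rate_path hb x a)
  have mJ : ∀ k z y, Measurable fun r : ℝ => jumpKernel θ b a k r z t y := fun k z y =>
    h.measurable_jumpKernel_path hb k z y a measurable_id measurable_const
  rw [jumpMass, Finset.sum_range_succ', add_comm]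
  congr 1
  · simp [jumpKernel]
  · have e : ∀ k, ∑' y, jumpKernel θ b a (k + 1) s x t y
        = ∫⁻ r in Ioc t s, stayProb θ b a x r s * ENNReal.ofReal (b (θ r x a))
          * (∑' y, jumpKernel θ b a k r (x + 1) t y + ∑' y, jumpKernel θ b a k r (x - 1) t y) :=
      fun k => by
      simp only [jumpKernel]
      rw [← lintegral_tsum fun y => (mS.fun_mul ((mJ k _ y).fun_add (mJ k _ y))).aemeasurable]
      refine lintegral_congr fun r => ?_
      rw [ENNReal.tsum_mul_left, ENNReal.tsum_add]
    simp only [e]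
    have mT : ∀ k z, Measurable fun r : ℝ => ∑' y, jumpKernel θ b a k r z t y := fun k z =>
      Measurable.tsum fun y => mJ k z y
    rw [← lintegral_finsetSum _ fun k _ => mS.fun_mul ((mT k _).fun_add (mT k _))]
    refine lintegral_congr fun r => ?_
    rw [← Finset.mul_sum, Finset.sum_add_distrib]; rfl

theorem IsFlow.jumpMass_le_one (h : IsFlow θ P) (hb : IsRate b) (a : Ω) (n : ℕ) {s : ℝ} (x : ℤ)
    {t : ℝ} (hts : t ≤ s) : jumpMass θ b a n s x t ≤ 1 := by
  induction n generalizing s x with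
  | zero => simp [jumpMass]
  | succ n ih =>
    rw [h.jumpMass_succ hb, ← h.stayProb_add_lintegral hb a x hts]
    refine add_le_add le_rfl (setLIntegral_mono' measurableSet_Ioc fun r hr => ?_)
    refine mul_le_mul' le_rfl ((add_le_add (ih _ hr.1.le) (ih _ hr.1.le)).trans_eq ?_)
    exact one_add_one_eq_two

/-- The number of jumps is dominated by a Poisson variable, so the walk does not explode. -/
theorem IsFlow.one_le_jumpMass_add (h : IsFlow θ P) (hb : IsRate b) (a : Ω) (n : ℕ) {s : ℝ}
    (x : ℤ) {t : ℝ} (hts : t ≤ s) :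
    1 ≤ jumpMass θ b a n s x t + ENNReal.ofReal ((2 * (s - t)) ^ n / n.factorial) := by
  induction n generalizing s x with
  | zero => simp [jumpMass]
  | succ n ih =>
    have mS : Measurable fun r => stayProb θ b a x r s * ENNReal.ofReal (b (θ r x a)) :=
      (h.measurable_stayProb_path hb x a measurable_id measurable_const).mul
        (h.measurable_rate_path hb x a)
    have mM := fun z => h.measurable_jumpMass_path hb a n z t
    have hpow : ∫⁻ r in Ioc t s, ENNReal.ofReal (2 * ((2 * (r - t)) ^ n / n.factorial))
        = ENNReal.ofReal ((2 * (s - t)) ^ (n + 1) / (n + 1).factorial) := by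
      rw [lintegral_Ioc_ofReal hts (Continuous.intervalIntegrable (by fun_prop) _ _)]
      · congr 1
        have hd : ∀ r ∈ uIcc t s, HasDerivAt
            (fun r => (2 * (r - t)) ^ (n + 1) / ((n + 1).factorial : ℝ))
            (2 * ((2 * (r - t)) ^ n / n.factorial)) r := fun r _ => by
          have h1 := (((((hasDerivAt_id r).sub_const t).const_mul 2).pow (n + 1))).div_const
            ((n + 1).factorial : ℝ)
          refine h1.congr_deriv ?_
          rw [Nat.factorial_succ]
          have : (n.factorial : ℝ) ≠ 0 := by positivity
          have : ((n : ℝ) + 1) ≠ 0 := by positivity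
          push_cast
          simp only [id]
          field_simp
        rw [intervalIntegral.integral_eq_sub_of_hasDerivAt hd
          (Continuous.intervalIntegrable (by fun_prop) _ _)]
        simp
      · intro r hr
        have : 0 ≤ r - t := by linarith [hr.1]
        positivity
    rw [h.jumpMass_succ hb, ← hpow, add_assoc, ← lintegral_add_left (mS.fun_mul ((mM _).fun_add (mM _)))]
    nth_rewrite 1 [← h.stayProb_add_lintegral hb a x hts]
    refine add_le_add le_rfl (setLIntegral_mono' measurableSet_Ioc fun r hr => ?_)
    set c := ENNReal.ofReal ((2 * (r - t)) ^ n / n.factorial) with hc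
    have h1 : stayProb θ b a x r s * ENNReal.ofReal (b (θ r x a)) ≤ 1 :=
      mul_le_one' (h.stayProb_le_one hb a x hr.2) (ENNReal.ofReal_le_one.mpr (hb.le_one _))
    have h2 : ENNReal.ofReal (2 * ((2 * (r - t)) ^ n / n.factorial)) = 2 * c := by
      rw [ENNReal.ofReal_mul zero_le_two, ENNReal.ofReal_ofNat]
    rw [h2]
    calc stayProb θ b a x r s * ENNReal.ofReal (b (θ r x a)) * 2
        ≤ stayProb θ b a x r s * ENNReal.ofReal (b (θ r x a))
          * ((jumpMass θ b a n r (x + 1) t + c) + (jumpMass θ b a n r (x - 1) t + c)) := by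
          refine mul_le_mul' le_rfl ?_
          rw [← one_add_one_eq_two]
          exact add_le_add (ih _ hr.1.le) (ih _ hr.1.le)
      _ = stayProb θ b a x r s * ENNReal.ofReal (b (θ r x a))
          * (jumpMass θ b a n r (x + 1) t + jumpMass θ b a n r (x - 1) t)
          + stayProb θ b a x r s * ENNReal.ofReal (b (θ r x a)) * (2 * c) := by ring
      _ ≤ _ := add_le_add le_rfl (mul_le_of_le_one_left zero_le h1)

/-- Transition probabilities of the dual walk, summed over the number of jumps. -/
def walkKernel (θ : ℝ → ℤ → Ω → Ω) (b : Ω → ℝ) (a : Ω) (s : ℝ) (x : ℤ) (t : ℝ) (y : ℤ) : ℝ≥0∞ :=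
  ∑' k, jumpKernel θ b a k s x t y

/-- The walk is conservative. -/
theorem IsFlow.tsum_walkKernel (h : IsFlow θ P) (hb : IsRate b) (a : Ω) {s : ℝ} (x : ℤ) {t : ℝ}
    (hts : t ≤ s) : ∑' y, walkKernel θ b a s x t y = 1 := by
  simp only [walkKernel]
  rw [ENNReal.tsum_comm]
  refine le_antisymm (ENNReal.tsum_le_of_sum_range_le fun n => h.jumpMass_le_one hb a n x hts) ?_
  have hlim : Tendsto (fun n : ℕ => (∑' k, ∑' y, jumpKernel θ b a k s x t y)
      + ENNReal.ofReal ((2 * (s - t)) ^ n / n.factorial)) atTop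
      (𝓝 ((∑' k, ∑' y, jumpKernel θ b a k s x t y) + ENNReal.ofReal 0)) :=
    tendsto_const_nhds.add
      (ENNReal.tendsto_ofReal (FloorSemiring.tendsto_pow_div_factorial_atTop _))
  rw [ENNReal.ofReal_zero, add_zero] at hlim
  exact ge_of_tendsto' hlim fun n => (h.one_le_jumpMass_add hb a n x hts).trans
    (add_le_add (ENNReal.sum_le_tsum _) le_rfl)

theorem IsFlow.walkKernel_comp (h : IsFlow θ P) (a : Ω) (u : ℝ) (z : ℤ) (s : ℝ) (x : ℤ)
    (t : ℝ) (y : ℤ) : walkKernel θ b (θ u z a) s x t y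
      = walkKernel θ b a (s + u) (x + z) (t + u) (y + z) := by
  simp only [walkKernel, h.jumpKernel_comp]

theorem IsFlow.measurable_walkKernel (h : IsFlow θ P) (hb : IsRate b) (s : ℝ) (x : ℤ) (t : ℝ)
    (y : ℤ) : Measurable fun a => walkKernel θ b a s x t y :=
  Measurable.tsum fun k => (h.measurable_jumpKernel hb k x y).comp
    (f := fun a : Ω => (a, s, t)) (by fun_prop)

namespace IsStationaryDensity

/-- Variation of constants for the stationary forward equation. -/
theorem path_eq_forward (hφ : IsStationaryDensity θ P b φ) (h : IsFlow θ P) (hb : IsRate b)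
    (a : Ω) (y : ℤ) {t s : ℝ} (hts : t ≤ s) :
    ENNReal.ofReal (φ (θ s y a)) * stayProb θ b a y t s
      + ∫⁻ q in Ioc t s, (ENNReal.ofReal (φ (θ q (y + 1) a)) * ENNReal.ofReal (b (θ q (y + 1) a))
        + ENNReal.ofReal (φ (θ q (y - 1) a)) * ENNReal.ofReal (b (θ q (y - 1) a)))
        * stayProb θ b a y t q = ENNReal.ofReal (φ (θ t y a)) := by
  obtain ⟨hm, hC⟩ := hb.two_mul_path h y a
  have hp := ((hφ.isPrimitive h hb y a).mul (isPrimitive_exp_integral hm hC t)).congr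
    (g' := fun q => -((φ (θ q (y + 1) a) * b (θ q (y + 1) a)
      + φ (θ q (y - 1) a) * b (θ q (y - 1) a)) * Real.exp (-∫ u in t..q, 2 * b (θ u y a))))
    fun q => by
      simp only [stepOp, h.comp, zero_add]
      rw [add_comm 1 y, neg_add_eq_sub]
      ring
  have h2 := hp.2 t s
  simp only [intervalIntegral.integral_neg, intervalIntegral.integral_same, neg_zero,
    Real.exp_zero, mul_one] at h2
  have hnn : ∀ q, 0 ≤ (φ (θ q (y + 1) a) * b (θ q (y + 1) a)
      + φ (θ q (y - 1) a) * b (θ q (y - 1) a)) * Real.exp (-∫ u in t..q, 2 * b (θ u y a)) :=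
    fun q => mul_nonneg (add_nonneg (mul_nonneg (hφ.nonneg _) (hb.nonneg _))
      (mul_nonneg (hφ.nonneg _) (hb.nonneg _))) (Real.exp_nonneg _)
  have e : ∀ q, (ENNReal.ofReal (φ (θ q (y + 1) a)) * ENNReal.ofReal (b (θ q (y + 1) a))
        + ENNReal.ofReal (φ (θ q (y - 1) a)) * ENNReal.ofReal (b (θ q (y - 1) a)))
        * stayProb θ b a y t q = ENNReal.ofReal ((φ (θ q (y + 1) a) * b (θ q (y + 1) a)
      + φ (θ q (y - 1) a) * b (θ q (y - 1) a)) * Real.exp (-∫ u in t..q, 2 * b (θ u y a))) :=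
    fun q => by
    rw [stayProb, ENNReal.ofReal_mul (add_nonneg (mul_nonneg (hφ.nonneg _) (hb.nonneg _))
      (mul_nonneg (hφ.nonneg _) (hb.nonneg _))), ENNReal.ofReal_add
      (mul_nonneg (hφ.nonneg _) (hb.nonneg _)) (mul_nonneg (hφ.nonneg _) (hb.nonneg _)),
      ENNReal.ofReal_mul (hφ.nonneg _), ENNReal.ofReal_mul (hφ.nonneg _)]
  simp only [e]
  have hi := (hp.intervalIntegrable t s).neg
  simp only [Pi.neg_def, neg_neg] at hi
  rw [lintegral_Ioc_ofReal hts hi (fun q _ => hnn q), stayProb,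
    ← ENNReal.ofReal_mul (hφ.nonneg _), ← ENNReal.ofReal_add
    (mul_nonneg (hφ.nonneg _) (Real.exp_nonneg _))
    (intervalIntegral.integral_nonneg hts fun q _ => hnn q)]
  congr 1
  linarith

/-- The mass transported by the walk never exceeds the density: by decomposition at the last jump,
the mass transported in fewer than `n` jumps is the `n`-th Picard iterate of the forward equation
started from zero. -/
theorem tsum_mul_walkKernel_le (hφ : IsStationaryDensity θ P b φ) (h : IsFlow θ P) (hb : IsRate b)
    (a : Ω) (y : ℤ) {t s : ℝ} (hts : t ≤ s) :
    ∑' z, ENNReal.ofReal (φ (θ s z a)) * walkKernel θ b a s z t y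
      ≤ ENNReal.ofReal (φ (θ t y a)) := by
  set W : ℕ → ℝ → ℤ → ℝ≥0∞ := fun n q w =>
    ∑ k ∈ Finset.range n, ∑' z, ENNReal.ofReal (φ (θ s z a)) * jumpKernel θ b a k s z q w with hW
  have hWs : ∀ n t y, W (n + 1) t y = ENNReal.ofReal (φ (θ s y a)) * stayProb θ b a y t s
      + ∫⁻ q in Ioc t s, (W n q (y + 1) * ENNReal.ofReal (b (θ q (y + 1) a))
        + W n q (y - 1) * ENNReal.ofReal (b (θ q (y - 1) a))) * stayProb θ b a y t q := by
    intro n t y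
    have mb := fun z => h.measurable_rate_path hb z a
    have mS : Measurable fun q => stayProb θ b a y t q :=
      h.measurable_stayProb_path hb y a measurable_const measurable_id
    have mJ : ∀ k z w, Measurable fun q : ℝ => jumpKernel θ b a k s z q w := fun k z w =>
      h.measurable_jumpKernel_path hb k z w a measurable_const measurable_id
    have m1 : ∀ k z, Measurable fun q =>
        (jumpKernel θ b a k s z q (y + 1) * ENNReal.ofReal (b (θ q (y + 1) a))
        + jumpKernel θ b a k s z q (y - 1) * ENNReal.ofReal (b (θ q (y - 1) a)))
        * stayProb θ b a y t q := fun k z =>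
      (((mJ k z _).fun_mul (mb _)).fun_add ((mJ k z _).fun_mul (mb _))).fun_mul mS
    simp only [hW]
    rw [Finset.sum_range_succ', add_comm]
    congr 1
    · simp [jumpKernel]
    · have e : ∀ k, ∑' z, ENNReal.ofReal (φ (θ s z a)) * jumpKernel θ b a (k + 1) s z t y
          = ∫⁻ q in Ioc t s, ∑' z, ENNReal.ofReal (φ (θ s z a))
            * ((jumpKernel θ b a k s z q (y + 1) * ENNReal.ofReal (b (θ q (y + 1) a))
            + jumpKernel θ b a k s z q (y - 1) * ENNReal.ofReal (b (θ q (y - 1) a)))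
            * stayProb θ b a y t q) := fun k => by
        rw [lintegral_tsum fun z => ((m1 k z).const_mul _).aemeasurable]
        refine tsum_congr fun z => ?_
        rw [lintegral_const_mul _ (m1 k z), h.jumpKernel_succ_last hb]
      simp only [e]
      rw [← lintegral_finsetSum _ fun k _ => Measurable.tsum fun z => (m1 k z).const_mul _]
      refine lintegral_congr fun q => ?_
      rw [Finset.sum_mul, Finset.sum_mul, ← Finset.sum_add_distrib, Finset.sum_mul]
      refine Finset.sum_congr rfl fun k _ => ?_
      rw [← ENNReal.tsum_mul_right, ← ENNReal.tsum_mul_right, ← ENNReal.tsum_add,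
        ← ENNReal.tsum_mul_right]
      exact tsum_congr fun z => by ring
  have hWle : ∀ n t y, t ≤ s → W n t y ≤ ENNReal.ofReal (φ (θ t y a)) := by
    intro n
    induction n with
    | zero => intro t y _; simp [hW]
    | succ n ih =>
      intro t y hts
      rw [hWs, ← hφ.path_eq_forward h hb a y hts]
      refine add_le_add le_rfl (setLIntegral_mono' measurableSet_Ioc fun q hq => ?_)
      exact mul_le_mul' (add_le_add (mul_le_mul' (ih _ _ hq.2) le_rfl)
        (mul_le_mul' (ih _ _ hq.2) le_rfl)) le_rfl
  simp only [walkKernel, ← ENNReal.tsum_mul_left]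
  rw [ENNReal.tsum_comm]
  exact ENNReal.tsum_le_of_sum_range_le fun n => hWle n t y hts

/-- Mass transport: moving the mass of the density by the walk and shifting the environment. -/
theorem lintegral_tsum_walkKernel (hφ : IsStationaryDensity θ P b φ) (h : IsFlow θ P)
    (hb : IsRate b) (T : ℝ) {g : Ω → ℝ≥0∞} (hg : Measurable g) :
    ∫⁻ a, ENNReal.ofReal (φ a) * ∑' y, walkKernel θ b a 0 0 (-T) y * g (θ (-T) y a) ∂P
      = ∫⁻ a, (∑' z, ENNReal.ofReal (φ (θ T z a)) * walkKernel θ b a T z 0 0) * g a ∂P := by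
  have mφ := hφ.meas.ennreal_ofReal
  have m1 : ∀ y, Measurable fun a => ENNReal.ofReal (φ a)
      * (walkKernel θ b a 0 0 (-T) y * g (θ (-T) y a)) := fun y =>
    mφ.mul ((h.measurable_walkKernel hb _ _ _ _).mul (hg.comp (h.measurable_map _ _)))
  have m2 : ∀ z, Measurable fun a => ENNReal.ofReal (φ (θ T z a)) * walkKernel θ b a T z 0 0
      * g a := fun z =>
    ((mφ.comp (h.measurable_map T z)).mul (h.measurable_walkKernel hb _ _ _ _)).mul hg
  simp only [← ENNReal.tsum_mul_left, ← ENNReal.tsum_mul_right]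
  rw [lintegral_tsum fun y => (m1 y).aemeasurable, lintegral_tsum fun z => (m2 z).aemeasurable,
    ← (Equiv.neg ℤ).tsum_eq]
  refine tsum_congr fun z => ?_
  rw [← h.lintegral_comp (m1 _) T z]
  refine lintegral_congr fun a => ?_
  simp only [Equiv.neg_apply, h.walkKernel_comp, h.comp, zero_add, neg_add_cancel, h.zero]
  ring

/-- The density is carried to itself by the walk. -/
theorem ae_tsum_mul_walkKernel_eq (hφ : IsStationaryDensity θ P b φ) (h : IsFlow θ P)
    [IsProbabilityMeasure P] (hb : IsRate b) {T : ℝ} (hT : 0 ≤ T) :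
    ∀ᵐ a ∂P, ∑' z, ENNReal.ofReal (φ (θ T z a)) * walkKernel θ b a T z 0 0
      = ENNReal.ofReal (φ a) := by
  have hle : ∀ a, ∑' z, ENNReal.ofReal (φ (θ T z a)) * walkKernel θ b a T z 0 0
      ≤ ENNReal.ofReal (φ a) := fun a => by
    have := hφ.tsum_mul_walkKernel_le h hb a 0 hT
    rwa [h.zero] at this
  -- by conservation of mass, both sides have the same finite integral
  have hint := hφ.lintegral_tsum_walkKernel h hb T (g := fun _ => 1) measurable_const
  simp only [mul_one, h.tsum_walkKernel hb _ 0 (neg_nonpos.mpr hT)] at hint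
  refine ae_eq_of_ae_le_of_lintegral_le (.of_forall hle) ?_ hφ.meas.ennreal_ofReal.aemeasurable
    hint.le
  rw [← hint, hφ.mass]
  exact ENNReal.one_ne_top

/-- The law with density `φ` is stationary for the environment seen from the walk. -/
theorem lintegral_walkKernel_eq (hφ : IsStationaryDensity θ P b φ) (h : IsFlow θ P)
    [IsProbabilityMeasure P] (hb : IsRate b) {T : ℝ} (hT : 0 ≤ T) {g : Ω → ℝ≥0∞}
    (hg : Measurable g) :
    ∫⁻ a, ENNReal.ofReal (φ a) * ∑' y, walkKernel θ b a 0 0 (-T) y * g (θ (-T) y a) ∂P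
      = ∫⁻ a, ENNReal.ofReal (φ a) * g a ∂P := by
  rw [hφ.lintegral_tsum_walkKernel h hb T hg]
  refine lintegral_congr_ae ?_
  filter_upwards [hφ.ae_tsum_mul_walkKernel_eq h hb hT] with a ha
  rw [ha]

end IsStationaryDensity

omit [MeasurableSpace Ω] in
theorem walkKernel_self_ne_zero (a : Ω) (s : ℝ) (x : ℤ) (t : ℝ) :
    walkKernel θ b a s x t x ≠ 0 := by
  refine (lt_of_lt_of_le ?_ (ENNReal.le_tsum 0)).ne'
  simpa [jumpKernel] using stayProb_pos a x t s

theorem IsFlow.walkKernel_succ_ne_zero (h : IsFlow θ P) (hb : IsRate b) (a : Ω) {s : ℝ} (x : ℤ)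
    {t : ℝ} (hts : t ≤ s) (hpos : 0 < ∫ r in t..s, b (θ r x a)) :
    walkKernel θ b a s x t (x + 1) ≠ 0 := by
  refine (lt_of_lt_of_le ?_ (ENNReal.le_tsum 1)).ne'
  rw [pos_iff_ne_zero]
  intro h0
  rw [jumpKernel, lintegral_eq_zero_iff] at h0
  · have h1 : ∀ᵐ r ∂volume.restrict (Ioc t s), b (θ r x a) = 0 := by
      filter_upwards [h0] with r hr
      by_contra hne
      have hbp : 0 < b (θ r x a) := lt_of_le_of_ne (hb.nonneg _) (Ne.symm hne)
      refine (?_ : (0 : ℝ≥0∞) < _).ne' hr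
      refine ENNReal.mul_pos (ENNReal.mul_pos (stayProb_pos _ _ _ _).ne'
        (ENNReal.ofReal_pos.mpr hbp).ne').ne' ?_
      simp [jumpKernel, (stayProb_pos a (x + 1) t r).ne']
    rw [intervalIntegral.integral_of_le hts, integral_congr_ae h1] at hpos
    simp at hpos
  · exact ((h.measurable_stayProb_path hb x a measurable_id measurable_const).mul
      (h.measurable_rate_path hb x a)).mul
      ((h.measurable_jumpKernel_path hb 0 _ _ a measurable_id measurable_const).add
        (h.measurable_jumpKernel_path hb 0 _ _ a measurable_id measurable_const))

/-- Under an ergodic flow, sets that are almost surely invariant under each shift are trivial. -/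
theorem IsFlow.measure_eq_zero_or_one (h : IsFlow θ P) [IsProbabilityMeasure P]
    (herg : IsFlowErgodic θ P) {A : Set Ω} (hA : MeasurableSet A)
    (hinv : ∀ t x, ∀ᵐ a ∂P, (θ t x a ∈ A ↔ a ∈ A)) : P A = 0 ∨ P A = 1 := by
  -- a strictly invariant version of `A`
  set A' : Set Ω := {a | ∀ x : ℤ, ∀ᵐ t : ℝ, θ t x a ∈ A} with hA'
  have hjoint : ∀ x : ℤ, MeasurableSet {q : Ω × ℝ | θ q.2 x q.1 ∈ A} := fun x =>
    ((h.measurable_joint x).comp (measurable_swap (α := Ω) (β := ℝ))) hA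
  have hA'm : MeasurableSet A' := by
    have e : A' = ⋂ x : ℤ, {a | volume {t : ℝ | θ t x a ∈ A}ᶜ = 0} := by
      ext a
      simp only [hA', mem_ofPred_eq, mem_iInter, ae_iff]
      rfl
    rw [e]
    exact .iInter fun x =>
      (measurable_measure_prodMk_left (hjoint x).compl) (measurableSet_singleton 0)
  have hA'inv : ∀ a ∈ A', ∀ t x, θ t x a ∈ A' := fun a ha t x y => by
    simp only [h.comp]
    exact (measurePreserving_add_right volume t).quasiMeasurePreserving.ae (ha (y + x))
  have hae : ∀ᵐ a ∂P, a ∈ A' ↔ a ∈ A := by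
    have h1 : ∀ᵐ a ∂P, ∀ x : ℤ, ∀ᵐ t : ℝ, (θ t x a ∈ A ↔ a ∈ A) := by
      refine ae_all_iff.mpr fun x => ?_
      have hm : MeasurableSet {q : ℝ × Ω | θ q.1 x q.2 ∈ A ↔ q.2 ∈ A} := by
        have m1 : MeasurableSet {q : ℝ × Ω | θ q.1 x q.2 ∈ A} := (h.measurable_joint x) hA
        have m2 : MeasurableSet {q : ℝ × Ω | q.2 ∈ A} := measurable_snd hA
        exact m1.iff m2
      exact (Measure.ae_ae_comm (p := fun (t : ℝ) a => θ t x a ∈ A ↔ a ∈ A) (μ := volume)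
        (ν := P) hm).mp (.of_forall fun t => hinv t x)
    filter_upwards [h1] with a ha
    refine ⟨fun hA => ?_, fun hA x => (ha x).mono fun t ht => ht.mpr hA⟩
    obtain ⟨t, ht1, ht2⟩ := ((ha 0).and (hA 0)).exists
    exact ht1.mp ht2
  have hP : P A = P A' := measure_congr (by filter_upwards [hae] with a ha; exact propext ha.symm)
  rw [hP]
  exact herg A' hA'm (h.preimage_eq_of_subset hA'inv)

/-- A set that is invariant for the environment seen from the walk is invariant under the flow,
because the walk charges its starting point and, after a long time, the neighbouring site. -/
theorem IsFlow.ae_mem_iff_of_walk_invariant (h : IsFlow θ P) [IsProbabilityMeasure P]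
    (hb : IsRate b) (hT : HasCubicAccumulation θ b P) {A : Set Ω}
    (hinv : ∀ t : ℝ, 0 ≤ t → ∀ᵐ a ∂P,
      ∑' y, walkKernel θ b a 0 0 (-t) y * A.indicator 1 (θ (-t) y a) = A.indicator 1 a) (t : ℝ)
    (x : ℤ) : ∀ᵐ a ∂P, (θ t x a ∈ A ↔ a ∈ A) := by
  have hstep : ∀ t : ℝ, 0 ≤ t → ∀ᵐ a ∂P, ∀ y, walkKernel θ b a 0 0 (-t) y ≠ 0 →
      (θ (-t) y a ∈ A ↔ a ∈ A) := fun t ht => by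
    filter_upwards [hinv t ht] with a ha y hy
    by_cases haA : a ∈ A
    · refine iff_of_true (by_contra fun hn => hy ?_) haA
      have h1 := h.tsum_walkKernel hb a 0 (neg_nonpos.mpr ht)
      rw [indicator_of_mem haA, Pi.one_apply] at ha
      have h2 : ∑' y', (walkKernel θ b a 0 0 (-t) y' * A.indicator 1 (θ (-t) y' a)
          + if y' = y then walkKernel θ b a 0 0 (-t) y' else 0) ≤ 1 := by
        rw [← h1]
        refine ENNReal.tsum_le_tsum fun y' => ?_
        by_cases hyy : y' = y
        · subst hyy; simp [indicator_of_notMem hn]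
        · simp only [hyy, if_false, add_zero]
          refine mul_le_of_le_one_right zero_le (indicator_apply_le' (fun _ => le_rfl) fun _ => zero_le)
      rw [ENNReal.tsum_add, ha, tsum_ite_eq] at h2
      have h3 : (1 : ℝ≥0∞) + walkKernel θ b a 0 0 (-t) y ≤ 1 + 0 := by simpa using h2
      simpa using (ENNReal.add_le_add_iff_left ENNReal.one_ne_top).mp h3
    · refine iff_of_false (fun hn => hy ?_) haA
      rw [indicator_of_notMem haA, ENNReal.tsum_eq_zero] at ha
      simpa [indicator_of_mem hn] using ha y
  have hneg : ∀ t : ℝ, 0 ≤ t → ∀ᵐ a ∂P, (θ (-t) 0 a ∈ A ↔ a ∈ A) := fun t ht =>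
    (hstep t ht).mono fun a ha => ha 0 (walkKernel_self_ne_zero a 0 0 (-t))
  have htime : ∀ t : ℝ, ∀ᵐ a ∂P, (θ t 0 a ∈ A ↔ a ∈ A) := fun t => by
    rcases le_total 0 t with ht | ht
    · filter_upwards [h.ae_comp (hneg t ht) t 0] with a ha
      rw [h.comp, neg_add_cancel, add_zero, h.zero] at ha
      exact ha.symm
    · simpa using hneg (-t) (neg_nonneg.mpr ht)
  -- `θ_{-σ,1} a` is reached from `a` by the walk and from `θ_{0,1} a` by a time shift
  have hone : ∀ᵐ a ∂P, (θ 0 1 a ∈ A ↔ a ∈ A) := by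
    obtain ⟨σ, -, hσ, -⟩ := h.exists_accumulationTime hb hT
    filter_upwards [hσ, ae_all_iff.mpr fun n : ℕ => hstep n (Nat.cast_nonneg n),
      ae_all_iff.mpr fun n : ℕ => h.ae_comp (htime (-(n : ℝ))) 0 1] with a h1 h2 h3
    have h4 := h2 (σ a) 1 (by
      have := h.walkKernel_succ_ne_zero hb a 0 (s := 0) (t := -(σ a : ℝ)) (by simp)
        (by linarith [h1.1])
      simpa using this)
    have h5 := h3 (σ a)
    rw [h.comp, add_zero, zero_add] at h5
    exact h5.symm.trans h4
  have hspace : ∀ᵐ a ∂P, (θ 0 x a ∈ A ↔ a ∈ A) := by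
    induction x using Int.induction_on with
    | zero => exact .of_forall fun a => by rw [h.zero]
    | succ k ih =>
      filter_upwards [ih, h.ae_comp hone 0 k] with a h1 h2
      rw [h.comp, add_zero, add_comm] at h2
      exact h2.trans h1
    | pred k ih =>
      filter_upwards [ih, h.ae_comp hone 0 (-(k : ℤ) - 1)] with a h1 h2
      rw [h.comp, add_zero, add_sub_cancel] at h2
      exact h2.symm.trans h1
  filter_upwards [hspace, h.ae_comp (htime t) 0 x] with a h1 h2
  rw [h.comp, add_zero, zero_add] at h2
  exact h2.trans h1

end DualKernel

/-! ### Random environments -/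

section Environment

open DynCond

variable {Ω : Set Env} {hΩ : ShiftStable Ω} [MeasurableSpace Ω] {P : Measure Ω}

theorem isFlow_tau (hP : IsErgodicEnvironment hΩ P) : IsFlow (tau hΩ) P where
  comp t s x y a := by
    refine Subtype.ext (Env.ext ?_)
    funext r z
    simp only [tau, Env.shift]
    congr 1 <;> ring
  zero a := by
    refine Subtype.ext (Env.ext ?_)
    funext r z
    simp [tau, Env.shift]
  measurable_joint := hP.shift_measurable
  map_eq := hP.stationary

omit [MeasurableSpace Ω] in
theorem cond_tau (t : ℝ) (x : ℤ) (a : Ω) :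
    ((tau hΩ t x a : Ω) : Env).cond 0 0 = (a : Env).cond t x := by
  simp [tau, Env.shift]

theorem isRate_cond (hP : IsErgodicEnvironment hΩ P)
    (hbdd : ∀ (a : Ω) (t : ℝ) (x : ℤ), (a : Env).cond t x ≤ 1) :
    IsRate fun a : Ω => ((a : Env).cond 0 0 : ℝ) where
  meas := (hP.cond_measurable 0 0).coe_nnreal_real
  nonneg _ := NNReal.coe_nonneg _
  le_one a := by exact_mod_cast hbdd a 0 0

/-- No unit of mass is accumulated before time `n` on the event `shortfall n`. -/
theorem natCast_le_accumTime (hP : IsErgodicEnvironment hΩ P) {n : ℕ} {a : Ω}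
    (ha : a ∈ shortfall (tau hΩ) (fun a : Ω => ((a : Env).cond 0 0 : ℝ)) n) :
    (n : ℝ≥0∞) ≤ accumTime a := by
  refine le_iInf₂ fun t ⟨ht0, ht1⟩ => ?_
  rw [← ENNReal.ofReal_natCast]
  refine ENNReal.ofReal_le_ofReal (not_lt.mp fun htn => ?_)
  simp only [shortfall, mem_ofPred_eq, cond_tau] at ha
  have hl := hP.path_locallyIntegrable a 0
  have := intervalIntegral.integral_mono_interval (μ := volume) le_rfl ht0 htn.le
    (.of_forall fun s => NNReal.coe_nonneg ((a : Env).cond s 0))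
    (hl.intervalIntegrable_real 0 n)
  linarith

/-- With `T` the accumulation time, `∑ (n + 1)² 1_{n ≤ T} ≤ (T + 1)³ ≤ 8 (1 + T ^ (3 + ε))`. -/
theorem hasCubicAccumulation_tau (hP : IsErgodicEnvironment hΩ P) [IsProbabilityMeasure P]
    (hb : IsRate fun a : Ω => ((a : Env).cond 0 0 : ℝ))
    (hT : ∃ ε : ℝ, 0 < ε ∧ ∫⁻ a : Ω, accumTime (a : Env) ^ (3 + ε) ∂P < ⊤) :
    HasCubicAccumulation (tau hΩ) (fun a : Ω => ((a : Env).cond 0 0 : ℝ)) P := by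
  obtain ⟨ε, hε, hT⟩ := hT
  set E := shortfall (tau hΩ) (fun a : Ω => ((a : Env).cond 0 0 : ℝ)) with hE
  have hEm := (isFlow_tau hP).measurableSet_shortfall hb
  have e : ∀ n : ℕ, ((n : ℝ≥0∞) + 1) ^ 2 * P (E n)
      = ∫⁻ a, (E n).indicator (fun _ => ((n : ℝ≥0∞) + 1) ^ 2) a ∂P := fun n =>
    (lintegral_indicator_const (hEm n) _).symm
  have hpt : ∀ a : Ω, ∑' n, (E n).indicator (fun _ => ((n : ℝ≥0∞) + 1) ^ 2) a
      ≤ 8 * (1 + accumTime (a : Env) ^ (3 + ε)) := fun a => by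
    set T := accumTime (a : Env) with hTdef
    by_cases hTtop : T = ⊤
    · rw [hTtop, ENNReal.top_rpow_of_pos (by linarith), add_top, ENNReal.mul_top (by simp)]
      exact le_top
    set N := ⌊T.toReal⌋₊ + 1 with hN
    have hNT : (N : ℝ≥0∞) ≤ T + 1 := by
      rw [hN, Nat.cast_add, Nat.cast_one]
      gcongr
      rw [← ENNReal.ofReal_natCast, ← ENNReal.ofReal_toReal hTtop]
      exact ENNReal.ofReal_le_ofReal (by
        rw [ENNReal.toReal_ofReal ENNReal.toReal_nonneg]
        exact Nat.floor_le ENNReal.toReal_nonneg)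
    have h0 : ∀ n ∉ Finset.range N,
        (E n).indicator (fun _ => ((n : ℝ≥0∞) + 1) ^ 2) a = 0 := fun n hn => by
      refine indicator_of_notMem (fun hmem => hn ?_) _
      have h1 := natCast_le_accumTime hP hmem
      rw [Finset.mem_range, hN, Nat.lt_succ_iff]
      refine Nat.le_floor ?_
      rw [← ENNReal.toReal_natCast]
      exact ENNReal.toReal_mono hTtop h1
    rw [tsum_eq_sum h0]
    have h1 : ∀ n ∈ Finset.range N,
        (E n).indicator (fun _ => ((n : ℝ≥0∞) + 1) ^ 2) a ≤ (N : ℝ≥0∞) ^ 2 := fun n hn => by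
      refine indicator_apply_le' (fun _ => ?_) fun _ => zero_le
      refine pow_le_pow_left' ?_ 2
      exact_mod_cast Finset.mem_range.mp hn
    refine (Finset.sum_le_card_nsmul _ _ _ h1).trans ?_
    rw [Finset.card_range, nsmul_eq_mul, ← pow_succ']
    refine (pow_le_pow_left' hNT 3).trans ?_
    rcases le_total T 1 with h2 | h2
    · calc (T + 1) ^ 3 ≤ (1 + 1) ^ 3 := pow_le_pow_left' (add_le_add h2 le_rfl) 3
        _ = 8 * 1 := by norm_num
        _ ≤ _ := mul_le_mul' le_rfl le_self_add
    · calc (T + 1) ^ 3 ≤ (T + T) ^ 3 := pow_le_pow_left' (add_le_add le_rfl h2) 3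
        _ = 8 * T ^ 3 := by rw [← two_mul, mul_pow]; norm_num
        _ ≤ 8 * T ^ (3 + ε) := by
          rw [← ENNReal.rpow_natCast]
          exact mul_le_mul' le_rfl (ENNReal.rpow_le_rpow_of_exponent_le h2 (by push_cast; linarith))
        _ ≤ _ := mul_le_mul' le_rfl le_add_self
  unfold HasCubicAccumulation
  simp only [← hE, e]
  rw [← lintegral_tsum fun n => (measurable_const.indicator (hEm n)).aemeasurable]
  refine (lintegral_mono hpt).trans_lt ?_
  rw [lintegral_const_mul' _ _ (by finiteness), lintegral_add_left measurable_const]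
  refine ENNReal.mul_lt_top (by finiteness) (ENNReal.add_lt_top.mpr ⟨by simp, hT⟩)

/-- The iterates `K_n` are the partial sums of the series over the number of jumps. -/
theorem dualKernel_eq_walkKernel (hP : IsErgodicEnvironment hΩ P)
    (hb : IsRate fun a : Ω => ((a : Env).cond 0 0 : ℝ)) (a : Ω) (s : ℝ) (x : ℤ) (t : ℝ) (y : ℤ) :
    dualKernel (a : Env) s x t y
      = walkKernel (tau hΩ) (fun a : Ω => ((a : Env).cond 0 0 : ℝ)) a s x t y := by
  have h := isFlow_tau hP
  set J := jumpKernel (tau hΩ) (fun a : Ω => ((a : Env).cond 0 0 : ℝ)) a with hJ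
  have hiter : ∀ n s x, dualKernelIter (a : Env) n s x t y = ∑ k ∈ Finset.range n, J k s x t y := by
    intro n
    induction n with
    | zero => intro s x; simp [dualKernelIter]
    | succ n ih =>
      intro s x
      rw [Finset.sum_range_succ', dualKernelIter, add_comm (∑ k ∈ _, _)]
      congr 1
      · simp only [hJ, jumpKernel, stayProb, cond_tau]
      · simp only [hJ, jumpKernel]
        rw [← lintegral_finsetSum]
        · refine lintegral_congr fun r => ?_
          rw [ih, ih, ← Finset.mul_sum, Finset.sum_add_distrib]
          simp only [hJ, stayProb, cond_tau, ENNReal.ofReal_coe_nnreal]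
        · intro k _
          exact ((h.measurable_stayProb_path hb x a measurable_id measurable_const).mul
            (h.measurable_rate_path hb x a)).mul
            ((h.measurable_jumpKernel_path hb k _ _ a measurable_id measurable_const).add
              (h.measurable_jumpKernel_path hb k _ _ a measurable_id measurable_const))
  simp only [dualKernel, hiter, walkKernel]
  exact ENNReal.tsum_eq_iSup_nat.symm

theorem envKernel_apply (hP : IsErgodicEnvironment hΩ P)
    (hb : IsRate fun a : Ω => ((a : Env).cond 0 0 : ℝ)) (t : ℝ) (a : Ω) {A : Set Ω}
    (hA : MeasurableSet A) : envKernel hΩ t a A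
      = ∑' y, walkKernel (tau hΩ) (fun a : Ω => ((a : Env).cond 0 0 : ℝ)) a 0 0 (-t) y
        * A.indicator 1 (tau hΩ (-t) y a) := by
  rw [envKernel, Measure.sum_apply _ hA]
  refine tsum_congr fun y => ?_
  rw [Measure.smul_apply, Measure.dirac_apply' _ hA, dualKernel_eq_walkKernel hP hb, smul_eq_mul]

end Environment

theorem theorem2p2 {Ω : Set DynCond.Env} (hΩ : DynCond.ShiftStable Ω) [MeasurableSpace Ω]
    (P : Measure Ω) [IsProbabilityMeasure P]
    (hP : DynCond.IsErgodicEnvironment hΩ P)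
    (hbdd : ∀ (a : Ω) (t : ℝ) (x : ℤ), (a : DynCond.Env).cond t x ≤ 1)
    (hT : ∃ ε : ℝ, 0 < ε ∧ ∫⁻ a : Ω, DynCond.accumTime (a : DynCond.Env) ^ (3 + ε) ∂P < ⊤) :
    ∃ φ : Ω → ℝ, Measurable φ ∧ Integrable φ P ∧
      -- (1)
      (∀ᵐ a ∂P, 0 < φ a) ∧ ∫ a, φ a ∂P = 1 ∧
      -- (2)
      Integrable (fun a : Ω => ((a : DynCond.Env).cond 0 0 : ℝ) * φ a ^ 2) P ∧
      ∫ a : Ω, ((a : DynCond.Env).cond 0 0 : ℝ) * φ a ^ 2 ∂P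
        ≤ ∫ a : Ω, ((a : DynCond.Env).cond 0 0 : ℝ) ∂P ∧
      -- (3)
      (∀ (a : Ω) (x : ℤ),
        Continuous (fun t : ℝ => φ (DynCond.tau hΩ t x a)) ∧
        DynCond.HasWeakDeriv (fun t : ℝ => φ (DynCond.tau hΩ t x a))
          (fun t : ℝ => -(a : DynCond.Env).adjGen t (fun y : ℤ => φ (DynCond.tau hΩ t y a)) x)) ∧
      -- the law of the environment seen from the dual walk
      IsProbabilityMeasure (DynCond.densityLaw P φ) ∧
      DynCond.IsStationaryForDual hΩ (DynCond.densityLaw P φ) ∧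
      DynCond.IsErgodicForDual hΩ (DynCond.densityLaw P φ) := by
  have h := isFlow_tau hP
  have hb := isRate_cond hP hbdd
  have hcub := hasCubicAccumulation_tau hP hb hT
  have herg : IsFlowErgodic (DynCond.tau hΩ) P := hP.ergodic
  obtain ⟨φ, hφ⟩ := h.exists_isStationaryDensity hb hcub
  have hpos : ∀ᵐ a ∂P, 0 < φ a := by
    filter_upwards [hφ.ae_pos h hb hcub herg] with a ha
    simpa only [h.zero] using ha 0 0
  have hprob : IsProbabilityMeasure (DynCond.densityLaw P φ) :=
    ⟨by rw [DynCond.densityLaw, withDensity_apply _ MeasurableSet.univ, setLIntegral_univ, hφ.mass]⟩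
  have hac : P ≪ DynCond.densityLaw P φ :=
    withDensity_absolutelyContinuous' hφ.meas.ennreal_ofReal.aemeasurable
      (hpos.mono fun a ha => (ENNReal.ofReal_pos.mpr ha).ne')
  refine ⟨φ, hφ.meas, hφ.integrable, hpos, hφ.integral_eq_one, hφ.integrable_energy hb,
    hφ.integral_energy_le hb, fun a x => ⟨hφ.continuous_path h hb x a, ?_⟩, hprob, ?_, ?_⟩
  · refine ((hφ.isPrimitive h hb x a).congr fun t => ?_).hasWeakDeriv
    simp only [stepOp, DynCond.Env.adjGen, h.comp, zero_add, cond_tau]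
    rw [add_comm 1 x, neg_add_eq_sub]
    ring
  · intro t ht A hA
    have hm : Measurable (A.indicator (1 : Ω → ℝ≥0∞)) := measurable_one.indicator hA
    have hK : Measurable fun a => DynCond.envKernel hΩ t a A := by
      simp only [envKernel_apply hP hb t _ hA]
      exact Measurable.tsum fun y => (h.measurable_walkKernel hb _ _ _ _).mul
        (hm.comp (h.measurable_map _ _))
    rw [DynCond.densityLaw, lintegral_withDensity_eq_lintegral_mul _ hφ.meas.ennreal_ofReal hK,
      withDensity_apply _ hA]
    simp only [Pi.mul_apply, envKernel_apply hP hb t _ hA]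
    rw [hφ.lintegral_walkKernel_eq h hb ht hm, ← lintegral_indicator hA]
    refine lintegral_congr fun a => ?_
    by_cases ha : a ∈ A <;> simp [ha]
  · intro A hA hinv
    have hinv' : ∀ t : ℝ, 0 ≤ t → ∀ᵐ a ∂P,
        ∑' y, walkKernel (DynCond.tau hΩ) (fun a : Ω => ((a : DynCond.Env).cond 0 0 : ℝ)) a 0 0
          (-t) y * A.indicator 1 (DynCond.tau hΩ (-t) y a) = A.indicator 1 a := fun t ht => by
      filter_upwards [hac.ae_le (hinv t ht)] with a ha
      rw [← envKernel_apply hP hb t a hA, ha]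
    have hQP : DynCond.densityLaw P φ ≪ P := withDensity_absolutelyContinuous _ _
    rcases h.measure_eq_zero_or_one herg hA
      (h.ae_mem_iff_of_walk_invariant hb hcub hinv') with h0 | h1
    · exact Or.inl (hQP h0)
    · refine Or.inr ?_
      rw [← prob_compl_eq_zero_iff hA] at h1 ⊢
      exact hQP h1
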